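/- Let $G=(A\cup B,E)$ be a finite bipartite graph in which every agent $a\in A$ has a strict partial order $\succ_a$ (irreflexive and transitive) over its neighbours in $B$. An agent prefers a matching $M$ to a matching $N$ if it is matched in $M$ and unmatched in $N$, or if it is matched in both and prefers its partner in $M$ to its partner in $N$. Let $\phi(M,N)$ be the number of agents that prefer $M$ to $N$. A matching $M$ of $G$ is popular if $\phi(M,N)\ge\phi(N,M)$ for every matching $N$ of $G$. The popular matching problem is to decide whether $G$ admits a popular matching, and to find one if so. The popular matching problem, with agents' preferences being arbitrary partial orders, can be solved in $O(m\cdot n^{3/2})$ time on a graph with $n=|A|+|B|$ vertices and $m=|E|\geq 1$ edges, and in $O(1)$ time if $m=0$. Here time is the number of steps of a random access machine with words of $O(\log n)$ bits; the graph is given by adjacency lists, the preferences by a table in which a single comparison $b\succ_a b'$ can be looked up in constant time, and memory that is not part of the input is initially $0$. -/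

import Mathlib

/-! ### One-sided bipartite preference instances and popular matchings -/

/-- A bipartite graph with agent set `A`, object set `B` and edge set `E`, in which every agent `a`
has a strict partial order over its neighbours: `pref a b b'` says that `a` prefers `b` to `b'`. -/
structure PrefInstance (A B : Type) where
  E : Finset (A × B)
  pref : A → B → B → Prop
  pref_nbr : ∀ a b b', pref a b b' → (a, b) ∈ E ∧ (a, b') ∈ E
  pref_irrefl : ∀ a b, ¬ pref a b b
  pref_trans : ∀ a b b' b'', pref a b b' → pref a b' b'' → pref a b b''

namespace PrefInstance

variable {A B : Type}

/-- A set of edges of the graph, no two of which share an agent or an object. -/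
structure IsMatching (G : PrefInstance A B) (M : Finset (A × B)) : Prop where
  subset : M ⊆ G.E
  agent : ∀ e ∈ M, ∀ f ∈ M, e.1 = f.1 → e = f
  object : ∀ e ∈ M, ∀ f ∈ M, e.2 = f.2 → e = f

/-- Agent `a` prefers the matching `M` to the matching `N`: either `a` is matched in both and
prefers its partner in `M`, or `a` is matched in `M` and unmatched in `N`. -/
def Prefers (G : PrefInstance A B) (a : A) (M N : Finset (A × B)) : Prop :=
  (∃ b b', (a, b) ∈ M ∧ (a, b') ∈ N ∧ G.pref a b b') ∨
    ((∃ b, (a, b) ∈ M) ∧ ∀ b, (a, b) ∉ N)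

/-- The number of agents who prefer `M` to `N`. -/
noncomputable def phi [Fintype A] (G : PrefInstance A B) (M N : Finset (A × B)) : ℕ :=
  Set.ncard {a : A | G.Prefers a M N}

noncomputable def Delta [Fintype A] (G : PrefInstance A B) (M N : Finset (A × B)) : ℤ :=
  (G.phi M N : ℤ) - (G.phi N M : ℤ)

/-- A matching that loses the head-to-head election against no matching. -/
def IsPopular [Fintype A] (G : PrefInstance A B) (M : Finset (A × B)) : Prop :=
  G.IsMatching M ∧ ∀ N, G.IsMatching N → 0 ≤ G.Delta M N

end PrefInstance

/-! ### A random access machine with structured programs and a step count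

The memory consists of registers and of one-dimensional arrays, all holding natural numbers. A
program is a finite text, so it uses finitely many registers and arrays, and it does not depend on
the input. All numbers occurring in a computation, addresses and intermediate results included,
have to be less than a word bound `W`; a computation that exceeds it is stuck. -/

namespace RAM

structure State where
  reg : ℕ → ℕ
  arr : ℕ → ℕ → ℕ

def State.setReg (s : State) (x v : ℕ) : State :=
  { s with reg := Function.update s.reg x v }

def State.setArr (s : State) (a i v : ℕ) : State :=
  { s with arr := Function.update s.arr a (Function.update (s.arr a) i v) }

inductive Expr where
  | const (c : ℕ)
  | reg (x : ℕ)
  | read (a : ℕ) (i : Expr)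
  | add (e f : Expr)
  | sub (e f : Expr)
  | mul (e f : Expr)

namespace Expr

/-- The value of an expression (subtraction is truncated at `0`). -/
def eval (s : State) : Expr → ℕ
  | const c => c
  | reg x => s.reg x
  | read a i => s.arr a (i.eval s)
  | add e f => e.eval s + f.eval s
  | sub e f => e.eval s - f.eval s
  | mul e f => e.eval s * f.eval s

/-- All values that occur in the evaluation are less than the word bound `W`. -/
def Fits (W : ℕ) (s : State) : Expr → Prop
  | const c => c < W
  | reg x => s.reg x < W
  | read a i => i.Fits W s ∧ s.arr a (i.eval s) < W
  | add e f => e.Fits W s ∧ f.Fits W s ∧ e.eval s + f.eval s < W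
  | sub e f => e.Fits W s ∧ f.Fits W s
  | mul e f => e.Fits W s ∧ f.Fits W s ∧ e.eval s * f.eval s < W

/-- Every constant, register access, memory access and arithmetic operation costs one step. -/
def cost : Expr → ℕ
  | const _ => 1
  | reg _ => 1
  | read _ i => i.cost + 1
  | add e f => e.cost + f.cost + 1
  | sub e f => e.cost + f.cost + 1
  | mul e f => e.cost + f.cost + 1

end Expr

/-- Programs. Conditions are expressions, and they hold when the value is not `0`. -/
inductive Prog where
  | skip
  | assign (x : ℕ) (e : Expr)
  | store (a : ℕ) (i e : Expr)
  | seq (c d : Prog)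
  | cond (e : Expr) (c d : Prog)
  | loop (e : Expr) (c : Prog)

/-- `Exec W c s t s'`: with word bound `W`, the program `c` started in state `s` halts in state
`s'` after exactly `t` steps. -/
inductive Exec (W : ℕ) : Prog → State → ℕ → State → Prop
  | skip (s : State) : Exec W Prog.skip s 1 s
  | assign (s : State) (x : ℕ) (e : Expr) :
      e.Fits W s → Exec W (Prog.assign x e) s (e.cost + 1) (s.setReg x (e.eval s))
  | store (s : State) (a : ℕ) (i e : Expr) :
      i.Fits W s → e.Fits W s →
        Exec W (Prog.store a i e) s (i.cost + e.cost + 1) (s.setArr a (i.eval s) (e.eval s))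
  | seq (c d : Prog) (s s' s'' : State) (t t' : ℕ) :
      Exec W c s t s' → Exec W d s' t' s'' → Exec W (Prog.seq c d) s (t + t') s''
  | cond_true (e : Expr) (c d : Prog) (s s' : State) (t : ℕ) :
      e.Fits W s → e.eval s ≠ 0 → Exec W c s t s' →
        Exec W (Prog.cond e c d) s (e.cost + 1 + t) s'
  | cond_false (e : Expr) (c d : Prog) (s s' : State) (t : ℕ) :
      e.Fits W s → e.eval s = 0 → Exec W d s t s' →
        Exec W (Prog.cond e c d) s (e.cost + 1 + t) s'
  | loop_true (e : Expr) (c : Prog) (s s' s'' : State) (t t' : ℕ) :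
      e.Fits W s → e.eval s ≠ 0 → Exec W c s t s' → Exec W (Prog.loop e c) s' t' s'' →
        Exec W (Prog.loop e c) s (e.cost + 1 + t + t') s''
  | loop_false (e : Expr) (c : Prog) (s : State) :
      e.Fits W s → e.eval s = 0 → Exec W (Prog.loop e c) s (e.cost + 1) s

end RAM

/-! ### Input and output of the popular matching problem -/

/-- The memory state `s` is an input state for `G`, where agents and objects are numbered from `0`.
Registers `0`, `1`, `2` hold the numbers of agents, objects and edges. The edges are numbered from
`0` so that those of agent `a` are the numbers from `arr 0 a` up to (excluding) `arr 0 (a + 1)`, in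
any order within this range, and `arr 1 e` is the object of edge number `e`. The preferences are
given by their comparison table: if edge number `e` joins agent `a` and object `b`, then the entry
of `arr 2` in row `e` and column `b'` (rows have length `q`) is `1` if `a` prefers `b` to `b'`, and
`0` if not. All other registers and arrays are `0`. -/
structure PrefInstance.Encodes {p q : ℕ} (G : PrefInstance (Fin p) (Fin q)) (s : RAM.State) :
    Prop where
  agents : s.reg 0 = p
  objects : s.reg 1 = q
  edges : s.reg 2 = G.E.card
  reg_zero : ∀ x, 3 ≤ x → s.reg x = 0
  off_zero : s.arr 0 0 = 0
  off_mono : ∀ a : Fin p, s.arr 0 a ≤ s.arr 0 (a + 1)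
  off_last : s.arr 0 p = G.E.card
  nbr_inj : ∀ a : Fin p, Set.InjOn (s.arr 1) (Set.Ico (s.arr 0 a) (s.arr 0 (a + 1)))
  nbr_lt : ∀ e, e < G.E.card → s.arr 1 e < q
  nbr_iff : ∀ (a : Fin p) (b : Fin q),
    (a, b) ∈ G.E ↔ ∃ e ∈ Set.Ico (s.arr 0 a) (s.arr 0 (a + 1)), s.arr 1 e = b
  pref_one : ∀ (a : Fin p) (b b' : Fin q), ∀ e ∈ Set.Ico (s.arr 0 a) (s.arr 0 (a + 1)),
    s.arr 1 e = b → G.pref a b b' → s.arr 2 (e * q + b') = 1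
  pref_zero : ∀ (a : Fin p) (b b' : Fin q), ∀ e ∈ Set.Ico (s.arr 0 a) (s.arr 0 (a + 1)),
    s.arr 1 e = b → ¬ G.pref a b b' → s.arr 2 (e * q + b') = 0
  arr_zero : ∀ k, 3 ≤ k → ∀ i, s.arr k i = 0

/-- Array `3` of the state `s` lists the matching `M`: entry `a` is `b + 1` if `a` is matched to
`b`, and `0` if `a` is unmatched. -/
def RAM.State.Lists {p q : ℕ} (s : RAM.State) (M : Finset (Fin p × Fin q)) : Prop :=
  ∀ a : Fin p, (∀ b : Fin q, (a, b) ∈ M ↔ s.arr 3 a = b + 1) ∧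
    ((∀ b : Fin q, (a, b) ∉ M) ↔ s.arr 3 a = 0)

/-- The state `s` holds a correct answer for `G`: register `3` is `1` and array `3` lists a popular
matching, or register `3` is `0` and there is no popular matching. -/
def PrefInstance.SolvedBy {p q : ℕ} (G : PrefInstance (Fin p) (Fin q)) (s : RAM.State) : Prop :=
  (s.reg 3 = 1 ∧ ∃ M, G.IsPopular M ∧ s.Lists M) ∨ (s.reg 3 = 0 ∧ ¬ ∃ M, G.IsPopular M)

/-! Popularity has a certificate. Let `S` be a set of objects such that `M` covers `S`, every edge
of `M` is a `TopEdge` or a `LowEdge` for `S`, and agents left unmatched by `M` have all their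
neighbours in `S`. If an agent prefers `N`, then `N` matches it into `S` while `M` does not; if `M`
matches an agent into `S` and `N` does not, that agent prefers `M`. Since `N` places no more agents
in `S` than `M` does, `N` cannot win (`Certifies.isPopular`). Conversely, for a popular `M` let `S`
consist of the objects reachable, by letting owners move to objects not worse for them, from an
object that some agent prefers to its own assignment. If the certificate failed there, shifting
agents along a shortest walk would yield a matching that beats `M` (`IsPopular.exists_certifies`).

To find a suitable `S`, the algorithm keeps a set that contains the set of every certificate,
beginning with all non-isolated objects, and tries to cover it by top edges. If an object cannot be
covered, then no object reachable from it by alternating paths lies in any certificate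
(`Certifies.disjoint_of_deficient`), and all of them are lowered, that is, removed from `S`. Once
`S` is covered, an exchange argument turns any certificate into one for this very `S`
(`Certifies.exists_of_cover`). What is left is one bipartite matching problem: cover all
non-isolated agents by top edges, low edges and private last resorts while keeping `S` covered.
Augmenting paths starting at agents never uncover an object, and a stuck search is a Hall violator
that rules out a certificate for `S` (`SecondGraph.not_certifies`).

For the time bound, let `n` be the number of vertices and `m` the number of edges. There are at most
`min m n + 1` phases. In each of them an auction with about `√n` price levels takes `O((m + n) √n)`
steps and leaves at most about `√n` more vertices unmatched than a maximum matching does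
(`Auction.card_uncovered_le`), so as many searches of linear time complete it. This totals `O(m n
√n)`. Switching off edges after lowering costs `O(q)` for each edge to a lowered object, paid once
per edge, and the second matching problem needs at most `min m p` successful searches.

Correctness and running time of the programs are proved together, by weakest preconditions in which
a loop carries an invariant and a potential that pays for its steps (`Wp.loop`). -/

namespace PrefInstance

/-! ### Certificates imply popularity -/

/-- `b` is undominated for `a`, and it dominates all neighbours of `a` outside `S`. -/
def TopEdge {A B : Type} (G : PrefInstance A B) (S : Set B) (a : A) (b : B) : Prop :=
  (a, b) ∈ G.E ∧ (∀ b', ¬ G.pref a b' b) ∧ ∀ b', (a, b') ∈ G.E → b' ∉ S → G.pref a b b'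

/-- `b` lies outside `S`, and it is undominated among the neighbours of `a` outside `S`. -/
def LowEdge {A B : Type} (G : PrefInstance A B) (S : Set B) (a : A) (b : B) : Prop :=
  (a, b) ∈ G.E ∧ b ∉ S ∧ ∀ b', b' ∉ S → ¬ G.pref a b' b

/-- Outside `S`, the object `b` would have to dominate itself. -/
theorem TopEdge.mem {A B : Type} {G : PrefInstance A B} {S : Set B} {a : A} {b : B}
    (h : G.TopEdge S a b) : b ∈ S :=
  by_contra fun hb => G.pref_irrefl a b (h.2.2 b h.1 hb)

/-- A set `S` of objects (those with dual value `1`) that witnesses the popularity of `M`. -/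
structure Certifies {A B : Type} (G : PrefInstance A B) (S : Set B) (M : Finset (A × B)) :
    Prop where
  matching : G.IsMatching M
  edge : ∀ a b, (a, b) ∈ M → G.TopEdge S a b ∨ G.LowEdge S a b
  cover : ∀ b ∈ S, ∃ a, (a, b) ∈ M
  free : ∀ a, (∀ b, (a, b) ∉ M) → ∀ b, (a, b) ∈ G.E → b ∈ S

section matchings

variable {A B : Type} {G : PrefInstance A B} {M : Finset (A × B)}

theorem IsMatching.right_unique (hM : G.IsMatching M) {a : A} {b b' : B} (h : (a, b) ∈ M)
    (h' : (a, b') ∈ M) : b = b' :=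
  congrArg Prod.snd (hM.agent _ h _ h' rfl)

theorem IsMatching.left_unique (hM : G.IsMatching M) {a a' : A} {b : B} (h : (a, b) ∈ M)
    (h' : (a', b) ∈ M) : a = a' :=
  congrArg Prod.fst (hM.object _ h _ h' rfl)

theorem Certifies.top_of_mem {S : Set B} (h : G.Certifies S M) {a : A} {b : B}
    (hab : (a, b) ∈ M) (hb : b ∈ S) : G.TopEdge S a b :=
  (h.edge a b hab).resolve_right fun hl => hl.2.1 hb

theorem Certifies.low_of_not_mem {S : Set B} (h : G.Certifies S M) {a : A} {b : B}
    (hab : (a, b) ∈ M) (hb : b ∉ S) : G.LowEdge S a b :=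
  (h.edge a b hab).resolve_left fun hl => hb hl.mem

/-- The agents that `M` matches into `S`. -/
def matchedInto (M : Finset (A × B)) (S : Set B) : Set A := {a | ∃ b ∈ S, (a, b) ∈ M}

/-- Sending an agent that `N` places at `b ∈ S` to the agent that `M` places at `b` is injective,
because `M` covers `S`. -/
theorem ncard_matchedInto_le [Finite A] {N : Finset (A × B)} (hN : G.IsMatching N) {S : Set B}
    (hS : ∀ b ∈ S, ∃ a, (a, b) ∈ M) (hM : G.IsMatching M) :
    (matchedInto N S).ncard ≤ (matchedInto M S).ncard := by
  classical
  have key : ∀ a ∈ matchedInto N S, ∃ a', ∃ b ∈ S, (a, b) ∈ N ∧ (a', b) ∈ M := by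
    rintro a ⟨b, hb, hab⟩
    obtain ⟨a', ha'⟩ := hS b hb
    exact ⟨a', b, hb, hab, ha'⟩
  choose! f hf using key
  refine Set.ncard_le_ncard_of_injOn f ?_ ?_ (Set.toFinite _)
  · intro a ha
    obtain ⟨b, hb, -, h⟩ := hf a ha
    exact ⟨b, hb, h⟩
  · intro a ha a' ha' he
    obtain ⟨b, -, h1, h2⟩ := hf a ha
    obtain ⟨b', -, h1', h2'⟩ := hf a' ha'
    rw [he] at h2
    obtain rfl := hM.right_unique h2 h2'
    exact hN.left_unique h1 h1'

/-- Agents that `M` matches into `S` cannot improve, so they are disjoint from the supporters `P` of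
`N`. Every supporter of `N` is matched into `S` by `N`, and an agent that leaves `S` is a supporter
of `M`. Comparing cardinalities gives `|P| ≤ |Q|`. -/
theorem Certifies.isPopular [Fintype A] {S : Set B} (h : G.Certifies S M) : G.IsPopular M := by
  refine ⟨h.matching, fun N hN => ?_⟩
  have h1 := ncard_matchedInto_le hN h.cover h.matching
  set P := {a : A | G.Prefers a N M}
  set Q := {a : A | G.Prefers a M N}
  have hdisj : Disjoint P (matchedInto M S) := by
    rw [Set.disjoint_left]
    rintro a hP ⟨b, hb, hab⟩
    rcases hP with ⟨b1, b2, h1, h2, h3⟩ | ⟨-, h2⟩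
    · obtain rfl := h.matching.right_unique hab h2
      exact (h.top_of_mem hab hb).2.1 _ h3
    · exact h2 b hab
  have hsub : P ∪ matchedInto M S ⊆ matchedInto N S ∪ Q := by
    rintro a (hP | ⟨b, hb, hab⟩)
    · left
      rcases hP with ⟨b1, b2, h1, h2, h3⟩ | ⟨⟨b, hb⟩, h2⟩
      · refine ⟨b1, ?_, h1⟩
        rcases h.edge a b2 h2 with ht | hl
        · exact (ht.2.1 _ h3).elim
        · exact by_contra fun hn => hl.2.2 _ hn h3
      · exact ⟨b, h.free a h2 b (hN.subset hb), hb⟩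
    · by_cases hu : ∃ b', (a, b') ∈ N
      · obtain ⟨b', hb'⟩ := hu
        by_cases hs : b' ∈ S
        · exact Or.inl ⟨b', hs, hb'⟩
        · exact Or.inr (Or.inl ⟨b, b', hab, hb', (h.top_of_mem hab hb).2.2 b' (hN.subset hb') hs⟩)
      · exact Or.inr (Or.inr ⟨⟨b, hab⟩, fun b' hb' => hu ⟨b', hb'⟩⟩)
  have h2 := Set.ncard_le_ncard hsub (Set.toFinite _)
  rw [Set.ncard_union_eq hdisj (Set.toFinite _) (Set.toFinite _)] at h2
  have h3 := Set.ncard_union_le (matchedInto N S) Q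
  have : G.phi N M ≤ G.phi M N := by
    change P.ncard ≤ Q.ncard
    omega
  unfold Delta
  omega

/-! ### Popular matchings have certificates -/

/-- Agent `a` likes the assignment `x` better than the assignment `y`. -/
def Better (G : PrefInstance A B) (a : A) (x y : Option B) : Prop :=
  ∃ b, x = some b ∧ ∀ b', y = some b' → G.pref a b b'

theorem not_better_self (a : A) (x : Option B) : ¬ G.Better a x x := by
  rintro ⟨b, rfl, h⟩
  exact G.pref_irrefl a b (h b rfl)

theorem IsMatching.exists_fun (hM : G.IsMatching M) :
    ∃ f : A → Option B, ∀ a b, (a, b) ∈ M ↔ f a = some b := by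
  classical
  refine ⟨fun a => if h : ∃ b, (a, b) ∈ M then some h.choose else none, fun a b => ?_⟩
  by_cases h : ∃ b, (a, b) ∈ M
  · simp only [h, dite_true, Option.some.injEq]
    exact ⟨fun hb => hM.right_unique h.choose_spec hb, fun hb => hb ▸ h.choose_spec⟩
  · simp only [h, dite_false, reduceCtorEq, iff_false]
    exact fun hb => h ⟨b, hb⟩

theorem prefers_iff_better {N : Finset (A × B)} {f g : A → Option B}
    (hf : ∀ a b, (a, b) ∈ M ↔ f a = some b) (hg : ∀ a b, (a, b) ∈ N ↔ g a = some b) (a : A) :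
    G.Prefers a M N ↔ G.Better a (f a) (g a) := by
  unfold Prefers Better
  simp only [hf, hg]
  constructor
  · rintro (⟨b, b', h1, h2, h3⟩ | ⟨⟨b, h1⟩, h2⟩)
    · refine ⟨b, h1, fun c hc => ?_⟩
      rw [h2] at hc
      cases hc
      exact h3
    · exact ⟨b, h1, fun c hc => (h2 c hc).elim⟩
  · rintro ⟨b, h1, h2⟩
    by_cases h : ∃ b', g a = some b'
    · obtain ⟨b', hb'⟩ := h
      exact Or.inl ⟨b, b', h1, hb', h2 b' hb'⟩
    · exact Or.inr ⟨⟨b, h1⟩, fun b' hb' => h ⟨b', hb'⟩⟩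

/-- Popularity in terms of assignments `A → Option B`, where changing a matching is just
`Function.update`. The competitor `f` needs only to respect edges and to be injective. -/
theorem IsPopular.ncard_better_le [Fintype A] {m f : A → Option B} (h : G.IsPopular M)
    (hm : ∀ a b, (a, b) ∈ M ↔ m a = some b) (hE : ∀ a b, f a = some b → (a, b) ∈ G.E)
    (hinj : ∀ a a' b, f a = some b → f a' = some b → a = a') :
    {a | G.Better a (f a) (m a)}.ncard ≤ {a | G.Better a (m a) (f a)}.ncard := by
  classical
  set N := G.E.filter (fun e => f e.1 = some e.2)
  have hN : ∀ a b, (a, b) ∈ N ↔ f a = some b := fun a b => by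
    simp only [N, Finset.mem_filter, and_iff_right_iff_imp]
    exact hE a b
  have hNM : G.IsMatching N := by
    refine ⟨Finset.filter_subset _ _, ?_, ?_⟩
    · rintro ⟨a, b⟩ he ⟨a', b'⟩ he' (rfl : a = a')
      rw [hN] at he he'
      rw [he] at he'
      cases he'
      rfl
    · rintro ⟨a, b⟩ he ⟨a', b'⟩ he' (rfl : b = b')
      rw [hN] at he he'
      rw [hinj _ _ _ he he']
  have := h.2 N hNM
  unfold Delta phi at this
  simp only [prefers_iff_better hm hN, prefers_iff_better hN hm] at this
  omega

/-- The owner of `b` under `m` is adjacent to `b'` and does not prefer `b` to it. -/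
def Shiftable (G : PrefInstance A B) (m : A → Option B) (b b' : B) : Prop :=
  ∃ a, m a = some b ∧ (a, b') ∈ G.E ∧ ¬ G.pref a b b'

/-- There is a walk of length `k` of shifts from `b₁`. -/
def ShiftDist (G : PrefInstance A B) (m : A → Option B) (b₁ : B) : ℕ → B → Prop
  | 0, b => b = b₁
  | k + 1, b' => ∃ b, ShiftDist G m b₁ k b ∧ G.Shiftable m b b'

/-- The assignment `f` arises from `m` by moving `a₀` to `b₁` and shifting along a path from `b₁`
to `b`, where the owner of `b` has not moved. -/
structure Shifted (G : PrefInstance A B) (m : A → Option B) (a₀ : A) (b₁ : B) (k : ℕ) (b : B)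
    (f : A → Option B) : Prop where
  edge : ∀ a c, f a = some c → (a, c) ∈ G.E
  not_worse : ∀ a, ¬ G.Better a (m a) (f a)
  start : f a₀ = some b₁
  better : G.Better a₀ (f a₀) (m a₀)
  inj : ∀ x y c, f x = some c → f y = some c → x = y ∨ c = b
  at_end : ∃ a', ∀ x, f x = some b → x = a' ∨ m x = some b
  old : ∀ c, c ≠ b → (∀ j < k, ¬ G.ShiftDist m b₁ j c) → ∀ x, f x = some c → m x = some c
  owner : ∃ o, o ≠ a₀ ∧ m o = some b ∧ f o = some b

/-- A shifted assignment can violate injectivity only at its end object `b`. Were there no unmoved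
owner at `b`, it would be a genuine matching in which nobody loses and `a₀` gains, against
popularity. -/
theorem exists_owner [Fintype A] (h : G.IsPopular M) {m f : A → Option B}
    (hm : ∀ a b, (a, b) ∈ M ↔ m a = some b) {a₀ : A} {b : B}
    (edge : ∀ a c, f a = some c → (a, c) ∈ G.E)
    (not_worse : ∀ a, ¬ G.Better a (m a) (f a))
    (better : G.Better a₀ (f a₀) (m a₀))
    (inj : ∀ x y c, f x = some c → f y = some c → x = y ∨ c = b)
    (at_end : ∃ a', ∀ x, f x = some b → x = a' ∨ m x = some b) :
    ∃ o, o ≠ a₀ ∧ m o = some b ∧ f o = some b := by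
  by_contra hno
  have hno' : ∀ o, m o = some b → f o = some b → False := by
    intro o h1 h2
    refine hno ⟨o, ?_, h1, h2⟩
    rintro rfl
    rw [h1, h2] at better
    exact not_better_self _ _ better
  have hinj : ∀ x y c, f x = some c → f y = some c → x = y := by
    intro x y c hx hy
    rcases inj x y c hx hy with h | rfl
    · exact h
    · obtain ⟨a', ha'⟩ := at_end
      rw [(ha' x hx).resolve_right fun hh => hno' x hh hx,
        (ha' y hy).resolve_right fun hh => hno' y hh hy]
  have h1 := h.ncard_better_le hm edge hinj
  have h2 : {a | G.Better a (m a) (f a)} = ∅ := Set.eq_empty_of_forall_notMem not_worse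
  rw [h2, Set.ncard_empty, Nat.le_zero, Set.ncard_eq_zero (Set.toFinite _)] at h1
  exact (Set.mem_empty_iff_false _).1 (h1 ▸ (show a₀ ∈ {a | G.Better a (f a) (m a)} from better))

/-- Induction along a shortest walk. Its last object `b` has an owner who has not moved, and who is
the agent allowing the next shift; moving that owner to the next object resolves the conflict at `b`
and creates the only possible new one at the next object. -/
theorem exists_shifted [Fintype A] (h : G.IsPopular M) {m : A → Option B}
    (hm : ∀ a b, (a, b) ∈ M ↔ m a = some b) {a₀ : A} {b₁ : B} (he : (a₀, b₁) ∈ G.E)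
    (hb : G.Better a₀ (some b₁) (m a₀)) (k : ℕ) :
    ∀ b, G.ShiftDist m b₁ k b → (∀ j < k, ¬ G.ShiftDist m b₁ j b) →
      ∃ f, G.Shifted m a₀ b₁ k b f := by
  classical
  have hmE : ∀ a b, m a = some b → (a, b) ∈ G.E := fun a b hab =>
    h.1.subset ((hm a b).2 hab)
  have hminj : ∀ a a' b, m a = some b → m a' = some b → a = a' := fun a a' b h1 h2 =>
    h.1.left_unique ((hm a b).2 h1) ((hm a' b).2 h2)
  induction k with
  | zero =>
    rintro b (rfl : b = b₁) -
    have key : ∀ x c, x ≠ a₀ → Function.update m a₀ (some b) x = some c → m x = some c :=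
      fun x c hx hc => by rwa [Function.update_of_ne hx] at hc
    have edge : ∀ a c, Function.update m a₀ (some b) a = some c → (a, c) ∈ G.E := by
      intro a c hac
      by_cases ha : a = a₀
      · subst ha
        rw [Function.update_self] at hac
        cases hac
        exact he
      · exact hmE _ _ (key a c ha hac)
    have not_worse : ∀ a, ¬ G.Better a (m a) (Function.update m a₀ (some b) a) := by
      intro a
      by_cases ha : a = a₀
      · subst ha
        rw [Function.update_self]
        rintro ⟨c, hc, hc'⟩
        obtain ⟨d, hd, hd'⟩ := hb
        cases hd
        exact G.pref_irrefl _ _ (G.pref_trans _ _ _ _ (hd' c hc) (hc' b rfl))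
      · rw [Function.update_of_ne ha]
        exact not_better_self _ _
    have better : G.Better a₀ (Function.update m a₀ (some b) a₀) (m a₀) := by
      rwa [Function.update_self]
    have inj : ∀ x y c, Function.update m a₀ (some b) x = some c →
        Function.update m a₀ (some b) y = some c → x = y ∨ c = b := by
      intro x y c hx hy
      by_cases hcb : c = b
      · exact Or.inr hcb
      · have hne : ∀ z, Function.update m a₀ (some b) z = some c → z ≠ a₀ := by
          rintro z hz rfl
          rw [Function.update_self] at hz
          cases hz
          exact hcb rfl
        exact Or.inl (hminj _ _ _ (key x c (hne x hx) hx) (key y c (hne y hy) hy))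
    have at_end : ∃ a', ∀ x, Function.update m a₀ (some b) x = some b → x = a' ∨ m x = some b :=
      ⟨a₀, fun x hx => or_iff_not_imp_left.2 fun hne => key x b hne hx⟩
    refine ⟨_, edge, not_worse, Function.update_self .., better, inj, at_end, ?_,
      exists_owner h hm edge not_worse better inj at_end⟩
    intro c hc _ x hx
    refine key x c ?_ hx
    rintro rfl
    rw [Function.update_self] at hx
    cases hx
    exact hc rfl
  | succ k ih =>
    rintro b' ⟨b, hkb, o', ho', hob', hnp⟩ hmin
    -- A shorter walk to `b` would extend to a shorter walk to `b'`.
    have hminb : ∀ j < k, ¬ G.ShiftDist m b₁ j b := fun j hj hjb =>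
      hmin (j + 1) (by omega) ⟨b, hjb, o', ho', hob', hnp⟩
    obtain ⟨f, hf⟩ := ih b hkb hminb
    obtain ⟨o, ho0, hom, hof⟩ := hf.owner
    obtain rfl := hminj _ _ _ hom ho'
    have hbb' : b' ≠ b := by
      rintro rfl
      exact hmin k (by omega) hkb
    have key : ∀ x c, x ≠ o → Function.update f o (some b') x = some c → f x = some c :=
      fun x c hx hc => by rwa [Function.update_of_ne hx] at hc
    have hne : ∀ z c, c ≠ b' → Function.update f o (some b') z = some c → z ≠ o := by
      rintro z c hc hz rfl
      rw [Function.update_self] at hz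
      cases hz
      exact hc rfl
    have edge : ∀ a c, Function.update f o (some b') a = some c → (a, c) ∈ G.E := by
      intro a c hac
      by_cases ha : a = o
      · subst ha
        rw [Function.update_self] at hac
        cases hac
        exact hob'
      · exact hf.edge _ _ (key a c ha hac)
    have not_worse : ∀ a, ¬ G.Better a (m a) (Function.update f o (some b') a) := by
      intro a
      by_cases ha : a = o
      · subst ha
        rw [Function.update_self, hom]
        rintro ⟨c, hc, hc'⟩
        cases hc
        exact hnp (hc' b' rfl)
      · rw [Function.update_of_ne ha]
        exact hf.not_worse a
    have start : Function.update f o (some b') a₀ = some b₁ := by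
      rw [Function.update_of_ne ho0.symm, hf.start]
    have better : G.Better a₀ (Function.update f o (some b') a₀) (m a₀) := by
      rw [Function.update_of_ne ho0.symm]
      exact hf.better
    have inj : ∀ x y c, Function.update f o (some b') x = some c →
        Function.update f o (some b') y = some c → x = y ∨ c = b' := by
      intro x y c hx hy
      by_cases hcb : c = b'
      · exact Or.inr hcb
      · left
        have hxo := hne x c hcb hx
        have hyo := hne y c hcb hy
        have hx := key x c hxo hx
        have hy := key y c hyo hy
        rcases hf.inj x y c hx hy with h | rfl
        · exact h
        · obtain ⟨a', ha'⟩ := hf.at_end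
          rw [(ha' x hx).resolve_right fun hh => hxo (hminj _ _ _ hh hom),
            (ha' y hy).resolve_right fun hh => hyo (hminj _ _ _ hh hom)]
    have at_end : ∃ a', ∀ x, Function.update f o (some b') x = some b' →
        x = a' ∨ m x = some b' :=
      ⟨o, fun x hx => or_iff_not_imp_left.2 fun hne =>
        hf.old b' hbb' (fun j hj => hmin j (by omega)) x (key x b' hne hx)⟩
    refine ⟨_, edge, not_worse, start, better, inj, at_end, ?_,
      exists_owner h hm edge not_worse better inj at_end⟩
    intro c hc hj x hx
    refine hf.old c ?_ (fun j hjk => hj j (by omega)) x (key x c (hne x c hc hx) hx)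
    rintro rfl
    exact hj k (by omega) hkb

theorem exists_shifted_of_reach [Fintype A] (h : G.IsPopular M) {m : A → Option B}
    (hm : ∀ a b, (a, b) ∈ M ↔ m a = some b) {a₀ : A} {b₁ : B} (he : (a₀, b₁) ∈ G.E)
    (hb : G.Better a₀ (some b₁) (m a₀)) {k : ℕ} {b : B} (hk : G.ShiftDist m b₁ k b) :
    ∃ k f, G.Shifted m a₀ b₁ k b f := by
  classical
  have hex : ∃ k, G.ShiftDist m b₁ k b := ⟨k, hk⟩
  obtain ⟨f, hf⟩ := exists_shifted h hm he hb (Nat.find hex) b (Nat.find_spec hex)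
    fun j hj => Nat.find_min hex hj
  exact ⟨_, f, hf⟩

/-- If the owner `o` of a reachable object preferred `b'`, then after the shift `o` could move to
`b'`, evicting at most one agent. Both `a₀` and `o` would gain while only the evicted agent could
lose. -/
theorem not_pref_of_reach [Fintype A] (h : G.IsPopular M) {m : A → Option B}
    (hm : ∀ a b, (a, b) ∈ M ↔ m a = some b) {a₀ : A} {b₁ : B} (he : (a₀, b₁) ∈ G.E)
    (hb : G.Better a₀ (some b₁) (m a₀)) {k : ℕ} {b : B} (hk : G.ShiftDist m b₁ k b) {o : A}
    (hom : m o = some b) (b' : B) : ¬ G.pref o b' b := by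
  classical
  intro hp
  have hmE : ∀ a b, m a = some b → (a, b) ∈ G.E := fun a b hab =>
    h.1.subset ((hm a b).2 hab)
  have hminj : ∀ a a' b, m a = some b → m a' = some b → a = a' := fun a a' b h1 h2 =>
    h.1.left_unique ((hm a b).2 h1) ((hm a' b).2 h2)
  have hbb' : b' ≠ b := by
    rintro rfl
    exact G.pref_irrefl _ _ hp
  have hob' : (o, b') ∈ G.E := (G.pref_nbr _ _ _ hp).1
  have hbo : G.Better o (some b') (m o) := ⟨b', rfl, fun c hc => by
    rw [hom] at hc
    cases hc
    exact hp⟩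
  obtain ⟨k', f, hf⟩ := exists_shifted_of_reach h hm he hb hk
  obtain ⟨o', ho0, hom', hof⟩ := hf.owner
  obtain rfl := hminj _ _ _ hom hom'
  by_cases hb1 : b' = b₁
  -- Eviction at `b₁` would hit `a₀`. Instead `o` itself serves as the starting agent of the walk,
  -- and the unmoved owner of `b` would have to differ from `o`.
  · subst hb1
    obtain ⟨k2, f2, hf2⟩ := exists_shifted_of_reach h hm hob' hbo hk
    obtain ⟨o2, ho2, hom2, -⟩ := hf2.owner
    exact ho2 (hminj _ _ _ hom2 hom)
  -- move `o` to `b'` and evict the other agent there, if any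
  set f' : A → Option B := fun a => if a = o then some b' else if f a = some b' then none else f a
    with hf'
  have ho' : f' o = some b' := by simp [hf']
  have hother : ∀ a, a ≠ o → ∀ c, f' a = some c → f a = some c ∧ c ≠ b' := by
    intro a ha c hc
    simp only [hf', ha, if_false] at hc
    split_ifs at hc with h1
    refine ⟨hc, ?_⟩
    rintro rfl
    exact h1 hc
  have edge : ∀ a c, f' a = some c → (a, c) ∈ G.E := by
    intro a c hac
    by_cases ha : a = o
    · subst ha
      rw [ho'] at hac
      cases hac
      exact hob'
    · exact hf.edge _ _ (hother a ha c hac).1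
  have inj : ∀ x y c, f' x = some c → f' y = some c → x = y := by
    intro x y c hx hy
    by_cases hxo : x = o
    · by_cases hyo : y = o
      · rw [hxo, hyo]
      · subst hxo
        rw [ho'] at hx
        cases hx
        exact absurd rfl (hother y hyo _ hy).2
    · by_cases hyo : y = o
      · subst hyo
        rw [ho'] at hy
        cases hy
        exact absurd rfl (hother x hxo _ hx).2
      · obtain ⟨hx, -⟩ := hother x hxo _ hx
        obtain ⟨hy, -⟩ := hother y hyo _ hy
        rcases hf.inj x y c hx hy with h | rfl
        · exact h
        · obtain ⟨a', ha'⟩ := hf.at_end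
          rw [(ha' x hx).resolve_right fun hh => hxo (hminj _ _ _ hh hom),
            (ha' y hy).resolve_right fun hh => hyo (hminj _ _ _ hh hom)]
  have h1 := h.ncard_better_le hm edge inj
  have hbetter : ({a₀, o} : Set A) ⊆ {a | G.Better a (f' a) (m a)} := by
    rintro a (rfl | rfl)
    · have : f' a = f a := by
        simp only [hf', ho0.symm, if_false, hf.start, Option.some.injEq]
        rw [if_neg (Ne.symm hb1)]
      change G.Better a (f' a) (m a)
      rw [this]
      exact hf.better
    · change G.Better a (f' a) (m a)
      rw [ho']
      exact hbo
  -- The shift harms nobody, so only the evicted agent can be worse off.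
  have hworse : {a | G.Better a (m a) (f' a)} ⊆ {a | a ≠ o ∧ f a = some b'} := by
    intro a ha
    change G.Better a (m a) (f' a) at ha
    by_cases hao : a = o
    · subst hao
      rw [ho', hom] at ha
      obtain ⟨c, hc, hc'⟩ := ha
      cases hc
      exact (G.pref_irrefl _ _ (G.pref_trans _ _ _ _ (hc' b' rfl) hp)).elim
    · refine ⟨hao, ?_⟩
      by_contra hne
      have : f' a = f a := by simp only [hf', hao, if_false, hne]
      rw [this] at ha
      exact hf.not_worse a ha
  have hsub : {a | a ≠ o ∧ f a = some b'}.ncard ≤ 1 := by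
    rw [Set.ncard_le_one_iff]
    rintro x y ⟨-, hx⟩ ⟨-, hy⟩
    exact (hf.inj x y b' hx hy).resolve_right hbb'
  have h2 := Set.ncard_le_ncard hbetter (Set.toFinite _)
  rw [Set.ncard_pair ho0.symm] at h2
  have h3 := Set.ncard_le_ncard hworse (Set.toFinite _)
  omega

/-- Shifting needs a neighbour that the owner does not prefer its own object to, so the closure of
`S` under shifts makes owners in `S` dominate everything outside. Outside `S`, any strictly better
neighbour would be a starting object and hence in `S`. -/
theorem IsPopular.exists_certifies [Fintype A] (h : G.IsPopular M) :
    ∃ S, G.Certifies S M := by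
  obtain ⟨m, hm⟩ := h.1.exists_fun
  let S : Set B := {b | ∃ a₀ b₁ k, (a₀, b₁) ∈ G.E ∧ G.Better a₀ (some b₁) (m a₀) ∧
    G.ShiftDist m b₁ k b}
  have hbase : ∀ a b, (a, b) ∈ G.E → G.Better a (some b) (m a) → b ∈ S := fun a b h1 h2 =>
    ⟨a, b, 0, h1, h2, rfl⟩
  refine ⟨S, h.1, ?_, ?_, ?_⟩
  · intro a b hab
    have hma := (hm a b).1 hab
    by_cases hb : b ∈ S
    · left
      obtain ⟨a₀, b₁, k, h1, h2, h3⟩ := hb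
      refine ⟨h.1.subset hab, fun b' => not_pref_of_reach h hm h1 h2 h3 hma b', ?_⟩
      intro b' hb' hbS
      by_contra hp
      exact hbS ⟨a₀, b₁, k + 1, h1, h2, b, h3, a, hma, hb', hp⟩
    · refine Or.inr ⟨h.1.subset hab, hb, fun b' hb' hp => hb' ?_⟩
      refine hbase a b' (G.pref_nbr _ _ _ hp).1 ⟨b', rfl, fun c hc => ?_⟩
      rw [hma] at hc
      cases hc
      exact hp
  · rintro b ⟨a₀, b₁, k, h1, h2, h3⟩
    obtain ⟨k', f, hf⟩ := exists_shifted_of_reach h hm h1 h2 h3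
    obtain ⟨o, -, hom, -⟩ := hf.owner
    exact ⟨o, (hm o b).2 hom⟩
  · intro a ha b hab
    exact hbase a b hab ⟨b, rfl, fun c hc => (ha c ((hm a c).2 hc)).elim⟩

/-! ### Why lowering is sound, and the exchange to the largest set -/

/-- If `b₀` cannot be covered, then the objects that are reachable from it by alternating paths lie
in no certificate below `S`. -/
theorem Certifies.disjoint_of_deficient [Finite A] [Finite B] {S S' : Set B}
    (h : G.Certifies S' M) (hS : S' ⊆ S)
    {N : Finset (A × B)} (hN : G.IsMatching N) (hNS : ∀ a b, (a, b) ∈ N → G.TopEdge S a b)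
    {R : Set B} {b₀ : B} (hb₀ : b₀ ∈ R) (hfree : ∀ a, (a, b₀) ∉ N)
    (hnbr : ∀ b ∈ R, ∀ a, G.TopEdge S a b → ∃ b' ∈ R, (a, b') ∈ N)
    (hmin : ∀ Z : Set B, b₀ ∈ Z → (∀ b ∈ Z, ∀ a, G.TopEdge S a b → ∀ b', (a, b') ∈ N → b' ∈ Z) →
      R ⊆ Z) : Disjoint R S' := by
  classical
  rcases isEmpty_or_nonempty A with hA | hA
  · rw [Set.disjoint_left]
    intro b _ hb
    obtain ⟨a, -⟩ := h.cover b hb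
    exact hA.elim a
  have : Nonempty B := ⟨b₀⟩
  -- agents adjacent to `R \ S'`
  let X : Set A := {a | ∃ b ∈ R, b ∉ S' ∧ G.TopEdge S a b}
  let Y : Set A := {a | a ∉ X ∧ ∃ b ∈ R, b ∈ S' ∧ (a, b) ∈ N}
  have htop : ∀ a b, (a, b) ∈ M → b ∈ S' → G.TopEdge S a b := fun a b hab hb => by
    have := h.top_of_mem hab hb
    exact ⟨this.1, this.2.1, fun b' h1 h2 => this.2.2 b' h1 fun h3 => h2 (hS h3)⟩
  -- In `S'` the partner of `a` dominates all neighbours outside `S'`, whereas a top edge to an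
  -- object outside `S'` must be undominated.
  have hX : ∀ a b, (a, b) ∈ M → b ∈ S' → a ∉ X := by
    rintro a b hab hb ⟨b', -, hb', ht⟩
    exact ht.2.1 b ((h.top_of_mem hab hb).2.2 b' ht.1 hb')
  have hM : ∀ b ∈ R ∩ S', ∃ a ∈ Y, (a, b) ∈ M := by
    rintro b ⟨hbR, hbS⟩
    obtain ⟨a, ha⟩ := h.cover b hbS
    refine ⟨a, ⟨hX a b ha hbS, ?_⟩, ha⟩
    obtain ⟨b', hb', hab'⟩ := hnbr b hbR a (htop a b ha hbS)
    refine ⟨b', hb', ?_, hab'⟩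
    by_contra hb'S
    exact hX a b ha hbS ⟨b', hb', hb'S, hNS a b' hab'⟩
  choose! f hf using hM
  have h1 : (R ∩ S').ncard ≤ Y.ncard := by
    refine Set.ncard_le_ncard_of_injOn f (fun b hb => (hf b hb).1) ?_ (Set.toFinite _)
    intro b hb b' hb' he
    have h1 := (hf b hb).2
    have h2 := (hf b' hb').2
    rw [he] at h1
    exact h.matching.right_unique h1 h2
  have hY : ∀ a ∈ Y, ∃ b ∈ R ∩ S', (a, b) ∈ N := by
    rintro a ⟨-, b, hb, hb', hab⟩
    exact ⟨b, ⟨hb, hb'⟩, hab⟩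
  choose! g hg using hY
  have himg : g '' Y ⊆ R ∩ S' := by
    rintro _ ⟨a, ha, rfl⟩
    exact (hg a ha).1
  have h2 : (g '' Y).ncard = Y.ncard := by
    refine Set.InjOn.ncard_image ?_
    intro a ha a' ha' he
    have h1 := (hg a ha).2
    have h2 := (hg a' ha').2
    rw [he] at h1
    exact hN.left_unique h1 h2
  -- The `M`-partners inject `R ∩ S'` into `Y`, and `N` injects `Y` into `R ∩ S'`; hence `N` maps
  -- `Y` onto `R ∩ S'`.
  have himg : g '' Y = R ∩ S' := Set.eq_of_subset_of_ncard_le himg (by omega) (Set.toFinite _)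
  have hb₀S : b₀ ∉ S' := by
    intro hb
    have : b₀ ∈ g '' Y := himg ▸ ⟨hb₀, hb⟩
    obtain ⟨a, ha, he⟩ := this
    exact hfree a (he ▸ (hg a ha).2)
  -- An alternating step cannot enter `S'` from `R \ S'`: the object entered would be the
  -- `N`-partner of an agent in `Y`, yet the step passes through an agent in `X`. As `R` is the
  -- smallest closed set containing `b₀`, it avoids `S'`.
  have hsub : R ⊆ R \ S' := by
    refine hmin _ ⟨hb₀, hb₀S⟩ ?_
    rintro b ⟨hbR, hbS⟩ a ht b' hab'
    obtain ⟨b2, hb2, hab2⟩ := hnbr b hbR a ht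
    obtain rfl := hN.right_unique hab' hab2
    refine ⟨hb2, fun hbS' => ?_⟩
    have : b' ∈ g '' Y := himg ▸ ⟨hb2, hbS'⟩
    obtain ⟨a', ha', he⟩ := this
    have h3 := (hg a' ha').2
    rw [he] at h3
    obtain rfl := hN.left_unique hab' h3
    exact ha'.1 ⟨b, hbR, hbS, ht⟩
  rw [Set.disjoint_left]
  exact fun b hb => (hsub hb).2

/-- A certificate below `S` and a covering of `S` by top edges give a certificate for `S`. -/
theorem Certifies.exists_of_cover [Finite A] [Finite B] {S S' : Set B}
    (h : G.Certifies S' M) (hS : S' ⊆ S)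
    {N : Finset (A × B)} (hN : G.IsMatching N) (hNS : ∀ a b, (a, b) ∈ N → G.TopEdge S a b)
    (hcov : ∀ b ∈ S, ∃ a, (a, b) ∈ N) : ∃ M', G.Certifies S M' := by
  classical
  by_cases hSS : S ⊆ S'
  · exact ⟨M, hS.antisymm hSS ▸ h⟩
  obtain ⟨b₀, hb₀, -⟩ := Set.not_subset.1 hSS
  have : Nonempty B := ⟨b₀⟩
  have : Nonempty A := ⟨(hcov b₀ hb₀).choose⟩
  let X : Set A := {a | ∃ b ∈ S, b ∉ S' ∧ G.TopEdge S a b}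
  -- For an agent with a top edge to `b ∈ S \ S'`: being unmatched would force `b ∈ S'`, a partner
  -- in `S'` would dominate `b`, and a partner outside `S` would be dominated by `b`.
  have hX : ∀ a ∈ X, ∃ b ∈ S \ S', (a, b) ∈ M := by
    rintro a ⟨b, hb, hbS, ht⟩
    have hex : ∃ b', (a, b') ∈ M := by
      by_contra hno
      exact hbS (h.free a (fun b' hb' => hno ⟨b', hb'⟩) b ht.1)
    obtain ⟨b', hb'⟩ := hex
    have hb'S : b' ∉ S' := fun hh => ht.2.1 b' ((h.top_of_mem hb' hh).2.2 b ht.1 hbS)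
    refine ⟨b', ⟨?_, hb'S⟩, hb'⟩
    by_contra hn
    exact (h.low_of_not_mem hb' hb'S).2.2 b hbS (ht.2.2 b' (h.matching.subset hb') hn)
  choose! f hf using hX
  have hD : ∀ b ∈ S \ S', ∃ a ∈ X, (a, b) ∈ N := by
    rintro b ⟨hb, hb'⟩
    obtain ⟨a, ha⟩ := hcov b hb
    exact ⟨a, ⟨b, hb, hb', hNS a b ha⟩, ha⟩
  choose! g hg using hD
  have himg : f '' X ⊆ S \ S' := by
    rintro _ ⟨a, ha, rfl⟩
    exact (hf a ha).1
  have h1 : (f '' X).ncard = X.ncard := by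
    refine Set.InjOn.ncard_image ?_
    intro a ha a' ha' he
    have h1 := (hf a ha).2
    have h2 := (hf a' ha').2
    rw [he] at h1
    exact h.matching.left_unique h1 h2
  have gimg : g '' (S \ S') ⊆ X := by
    rintro _ ⟨b, hb, rfl⟩
    exact (hg b hb).1
  have h2 : (g '' (S \ S')).ncard = (S \ S').ncard := by
    refine Set.InjOn.ncard_image ?_
    intro a ha a' ha' he
    have h1 := (hg a ha).2
    have h2 := (hg a' ha').2
    rw [he] at h1
    exact hN.right_unique h1 h2
  have h3 := Set.ncard_le_ncard himg (Set.toFinite _)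
  have h4 := Set.ncard_le_ncard gimg (Set.toFinite _)
  -- Here `M` injects `X` into `S \ S'` and `N` injects `S \ S'` into `X`, so both are bijections.
  have himg : f '' X = S \ S' := Set.eq_of_subset_of_ncard_le himg (by omega) (Set.toFinite _)
  have gimg : g '' (S \ S') = X := Set.eq_of_subset_of_ncard_le gimg (by omega) (Set.toFinite _)
  have hNX : ∀ a ∈ X, ∃ b ∈ S \ S', (a, b) ∈ N := by
    intro a ha
    rw [← gimg] at ha
    obtain ⟨b, hb, rfl⟩ := ha
    exact ⟨b, hb, (hg b hb).2⟩
  have hMX : ∀ a b, (a, b) ∈ M → b ∈ S \ S' → a ∈ X := by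
    intro a b hab hb
    rw [← himg] at hb
    obtain ⟨a', ha', rfl⟩ := hb
    rwa [h.matching.left_unique hab (hf a' ha').2]
  have hNX' : ∀ a b, (a, b) ∈ N → a ∈ X → b ∈ S \ S' := by
    intro a b hab ha
    obtain ⟨b', hb', hab'⟩ := hNX a ha
    rwa [hN.right_unique hab hab']
  -- Since `M` and `N` both match `X` exactly with `S \ S'`, the edges at `X` can be exchanged
  -- without creating conflicts.
  let M' : Finset (A × B) := N.filter (fun e => e.1 ∈ X) ∪ M.filter (fun e => e.1 ∉ X)
  have hM' : ∀ a b, (a, b) ∈ M' ↔ ((a, b) ∈ N ∧ a ∈ X) ∨ ((a, b) ∈ M ∧ a ∉ X) := by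
    intro a b
    simp only [M', Finset.mem_union, Finset.mem_filter]
  refine ⟨M', ⟨?_, ?_, ?_⟩, ?_, ?_, ?_⟩
  · rintro ⟨a, b⟩ he
    rcases (hM' a b).1 he with ⟨h, -⟩ | ⟨hh, -⟩
    · exact hN.subset h
    · exact h.matching.subset hh
  · rintro ⟨a, b⟩ he ⟨a', b'⟩ he' (rfl : a = a')
    rw [hM'] at he he'
    rcases he with ⟨h1, h2⟩ | ⟨h1, h2⟩ <;> rcases he' with ⟨h3, h4⟩ | ⟨h3, h4⟩
    · rw [hN.right_unique h1 h3]
    · exact absurd h2 h4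
    · exact absurd h4 h2
    · rw [h.matching.right_unique h1 h3]
  · rintro ⟨a, b⟩ he ⟨a', b'⟩ he' (rfl : b = b')
    rw [hM'] at he he'
    rcases he with ⟨h1, h2⟩ | ⟨h1, h2⟩ <;> rcases he' with ⟨h3, h4⟩ | ⟨h3, h4⟩
    · rw [hN.left_unique h1 h3]
    · exact absurd (hMX _ _ h3 (hNX' _ _ h1 h2)) h4
    · exact absurd (hMX _ _ h1 (hNX' _ _ h3 h4)) h2
    · rw [h.matching.left_unique h1 h3]
  · intro a b hab
    rcases (hM' a b).1 hab with ⟨h1, -⟩ | ⟨h1, h2⟩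
    · exact Or.inl (hNS a b h1)
    · rcases h.edge a b h1 with ht | hl
      · exact Or.inl ⟨ht.1, ht.2.1, fun b' h3 h4 => ht.2.2 b' h3 fun h5 => h4 (hS h5)⟩
      · refine Or.inr ⟨hl.1, fun hb => h2 (hMX a b h1 ⟨hb, hl.2.1⟩), fun b' hb' => ?_⟩
        exact hl.2.2 b' fun h5 => hb' (hS h5)
  · intro b hb
    by_cases hb' : b ∈ S'
    · obtain ⟨a, ha⟩ := h.cover b hb'
      refine ⟨a, (hM' a b).2 (Or.inr ⟨ha, fun haX => ?_⟩)⟩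
      exact (hf a haX).1.2 (h.matching.right_unique ha (hf a haX).2 ▸ hb')
    · obtain ⟨haX, haN⟩ := hg b ⟨hb, hb'⟩
      exact ⟨_, (hM' _ b).2 (Or.inl ⟨haN, haX⟩)⟩
  · intro a ha b hab
    by_cases haX : a ∈ X
    · obtain ⟨b', -, hb'⟩ := hNX a haX
      exact (ha b' ((hM' _ _).2 (Or.inl ⟨hb', haX⟩))).elim
    · exact hS (h.free a (fun b' hb' => ha b' ((hM' _ _).2 (Or.inr ⟨hb', haX⟩))) b hab)

end matchings

end PrefInstance

/-! ### A program logic with running times -/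

namespace RAM

@[simp] theorem State.reg_setReg (s : State) (x v y : ℕ) :
    (s.setReg x v).reg y = if y = x then v else s.reg y := by
  simp [State.setReg, Function.update_apply]

@[simp] theorem State.arr_setReg (s : State) (x v : ℕ) : (s.setReg x v).arr = s.arr := rfl

@[simp] theorem State.reg_setArr (s : State) (a i v : ℕ) : (s.setArr a i v).reg = s.reg := rfl

@[simp] theorem State.arr_setArr (s : State) (a i v b : ℕ) :
    (s.setArr a i v).arr b = if b = a then Function.update (s.arr a) i v else s.arr b := by
  simp [State.setArr, Function.update_apply]

/-- The registers that a program may write. -/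
def Prog.regs : Prog → List ℕ
  | skip => []
  | assign x _ => [x]
  | store _ _ _ => []
  | seq c d => c.regs ++ d.regs
  | cond _ c d => c.regs ++ d.regs
  | loop _ c => c.regs

/-- The arrays that a program may write. -/
def Prog.arrs : Prog → List ℕ
  | skip => []
  | assign _ _ => []
  | store a _ _ => [a]
  | seq c d => c.arrs ++ d.arrs
  | cond _ c d => c.arrs ++ d.arrs
  | loop _ c => c.arrs

/-- The states agree on everything that `c` does not write. -/
structure Agree (c : Prog) (s s' : State) : Prop where
  reg : ∀ x, x ∉ c.regs → s'.reg x = s.reg x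
  arr : ∀ k, k ∉ c.arrs → s'.arr k = s.arr k

theorem Agree.refl (c : Prog) (s : State) : Agree c s s := ⟨fun _ _ => rfl, fun _ _ => rfl⟩

theorem Agree.trans {c d e : Prog} {s s' s'' : State} (h : Agree c s s') (h' : Agree d s' s'')
    (hr : ∀ x, x ∉ e.regs → x ∉ c.regs ∧ x ∉ d.regs)
    (ha : ∀ x, x ∉ e.arrs → x ∉ c.arrs ∧ x ∉ d.arrs) : Agree e s s'' :=
  ⟨fun x hx => (h'.reg x (hr x hx).2).trans (h.reg x (hr x hx).1),
    fun x hx => (h'.arr x (ha x hx).2).trans (h.arr x (ha x hx).1)⟩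

theorem Exec.agree {W : ℕ} {c : Prog} {s s' : State} {t : ℕ} (h : Exec W c s t s') :
    Agree c s s' := by
  induction h with
  | skip s => exact Agree.refl _ _
  | assign s x e _ =>
    refine ⟨fun y hy => ?_, fun _ _ => rfl⟩
    have : y ≠ x := by simpa [Prog.regs] using hy
    simp [this]
  | store s a i e _ _ =>
    refine ⟨fun _ _ => rfl, fun k hk => ?_⟩
    have : k ≠ a := by simpa [Prog.arrs] using hk
    simp [this]
  | seq c d s s' s'' t t' _ _ ih1 ih2 =>
    exact ih1.trans ih2 (fun x hx => by simpa [Prog.regs] using hx)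
      (fun x hx => by simpa [Prog.arrs] using hx)
  | cond_true e c d s s' t _ _ _ ih =>
    exact (Agree.refl d s).trans ih
      (fun x hx => And.symm (by simpa [Prog.regs] using hx))
      (fun x hx => And.symm (by simpa [Prog.arrs] using hx))
  | cond_false e c d s s' t _ _ _ ih =>
    exact (Agree.refl c s).trans ih
      (fun x hx => by simpa [Prog.regs] using hx)
      (fun x hx => by simpa [Prog.arrs] using hx)
  | loop_true e c s s' s'' t t' _ _ _ _ ih1 ih2 =>
    exact ih1.trans ih2 (fun x hx => ⟨by simpa [Prog.regs] using hx, hx⟩)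
      (fun x hx => ⟨by simpa [Prog.arrs] using hx, hx⟩)
  | loop_false e c s _ _ => exact Agree.refl _ _

/-- Program `c` started in `s` halts, and the number of steps and the final state satisfy `Q`. -/
def Wp (W : ℕ) (c : Prog) (s : State) (Q : ℕ → State → Prop) : Prop :=
  ∃ t s', Exec W c s t s' ∧ Q t s'

variable {W : ℕ} {s : State} {Q : ℕ → State → Prop}

/-- The consequence rule also hands over `Agree`, so specifications mention only what a program
changes; everything it does not write is recovered by deciding membership in `regs` and `arrs`. -/
theorem Wp.mono {c : Prog} {Q' : ℕ → State → Prop} (h : Wp W c s Q)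
    (hQ : ∀ t s', Agree c s s' → Q t s' → Q' t s') : Wp W c s Q' := by
  obtain ⟨t, s', h1, h2⟩ := h
  exact ⟨t, s', h1, hQ t s' h1.agree h2⟩

theorem wp_skip : Wp W Prog.skip s Q ↔ Q 1 s := by
  constructor
  · rintro ⟨t, s', h, hQ⟩
    cases h
    exact hQ
  · exact fun h => ⟨_, _, Exec.skip s, h⟩

theorem wp_assign {x : ℕ} {e : Expr} :
    Wp W (Prog.assign x e) s Q ↔ e.Fits W s ∧ Q (e.cost + 1) (s.setReg x (e.eval s)) := by
  constructor
  · rintro ⟨t, s', h, hQ⟩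
    cases h with
    | assign _ _ _ hf => exact ⟨hf, hQ⟩
  · exact fun h => ⟨_, _, Exec.assign s x e h.1, h.2⟩

theorem wp_store {a : ℕ} {i e : Expr} :
    Wp W (Prog.store a i e) s Q ↔ (i.Fits W s ∧ e.Fits W s) ∧
      Q (i.cost + e.cost + 1) (s.setArr a (i.eval s) (e.eval s)) := by
  constructor
  · rintro ⟨t, s', h, hQ⟩
    cases h with
    | store _ _ _ _ hf hf' => exact ⟨⟨hf, hf'⟩, hQ⟩
  · exact fun h => ⟨_, _, Exec.store s a i e h.1.1 h.1.2, h.2⟩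

theorem wp_seq {c d : Prog} : Wp W (Prog.seq c d) s Q ↔
    Wp W c s (fun t s' => Wp W d s' (fun t' s'' => Q (t + t') s'')) := by
  constructor
  · rintro ⟨t, s', h, hQ⟩
    cases h with
    | seq _ _ _ s1 _ t1 t2 h1 h2 => exact ⟨t1, s1, h1, t2, _, h2, hQ⟩
  · rintro ⟨t1, s1, h1, t2, s2, h2, hQ⟩
    exact ⟨_, _, Exec.seq _ _ _ _ _ _ _ h1 h2, hQ⟩

theorem wp_cond {e : Expr} {c d : Prog} : Wp W (Prog.cond e c d) s Q ↔ e.Fits W s ∧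
    (e.eval s ≠ 0 → Wp W c s (fun t s' => Q (e.cost + 1 + t) s')) ∧
    (e.eval s = 0 → Wp W d s (fun t s' => Q (e.cost + 1 + t) s')) := by
  constructor
  · rintro ⟨t, s', h, hQ⟩
    cases h with
    | cond_true _ _ _ _ _ t hf hne h =>
      exact ⟨hf, fun _ => ⟨t, _, h, hQ⟩, fun h0 => absurd h0 hne⟩
    | cond_false _ _ _ _ _ t hf he h =>
      exact ⟨hf, fun h0 => absurd he h0, fun _ => ⟨t, _, h, hQ⟩⟩
  · rintro ⟨hf, h1, h2⟩
    by_cases he : e.eval s = 0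
    · obtain ⟨t, s', h, hQ⟩ := h2 he
      exact ⟨_, _, Exec.cond_false _ _ _ _ _ _ hf he h, hQ⟩
    · obtain ⟨t, s', h, hQ⟩ := h1 he
      exact ⟨_, _, Exec.cond_true _ _ _ _ _ _ hf he h, hQ⟩

/-- A loop with invariant `I` and potential `Φ` that pays for the steps. -/
theorem Wp.loop {e : Expr} {c : Prog} (I : State → Prop) (Φ : State → ℕ) (hI : I s)
    (hfits : ∀ s', Agree c s s' → I s' → e.Fits W s')
    (hstep : ∀ s', Agree c s s' → I s' → e.eval s' ≠ 0 →
      Wp W c s' (fun t s'' => I s'' ∧ t + (e.cost + 1) + Φ s'' ≤ Φ s'))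
    (hQ : ∀ t s', Agree c s s' → I s' → e.eval s' = 0 → t + Φ s' ≤ Φ s + (e.cost + 1) → Q t s') :
    Wp W (Prog.loop e c) s Q := by
  -- Each iteration pays at least one step for the test, so `Φ` strictly decreases and strong
  -- induction on it proves termination as well.
  have key : ∀ n s', Φ s' = n → Agree c s s' → I s' → ∃ t s'', Exec W (Prog.loop e c) s' t s'' ∧
      Agree c s s'' ∧ I s'' ∧ e.eval s'' = 0 ∧ t + Φ s'' ≤ Φ s' + (e.cost + 1) := by
    intro n
    induction n using Nat.strong_induction_on with
    | _ n ih =>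
      rintro s' rfl ha hI'
      by_cases he : e.eval s' = 0
      · exact ⟨_, _, Exec.loop_false _ _ _ (hfits s' ha hI') he, ha, hI', he, by omega⟩
      · obtain ⟨t, s2, hex, hI2, ht⟩ := hstep s' ha hI' he
        have ha2 : Agree c s s2 := ha.trans hex.agree (fun x hx => ⟨hx, hx⟩) fun x hx => ⟨hx, hx⟩
        obtain ⟨t2, s3, hex2, ha3, hI3, he3, ht3⟩ := ih (Φ s2) (by omega) s2 rfl ha2 hI2
        exact ⟨_, _, Exec.loop_true _ _ _ _ _ _ _ (hfits s' ha hI') he hex hex2, ha3, hI3, he3,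
          by omega⟩
  obtain ⟨t, s', hex, ha, hI', he, ht⟩ := key _ s rfl (Agree.refl _ _) hI
  exact ⟨t, s', hex, hQ t s' ha hI' he ht⟩

/-- Run `body` with register `i` counting from `lo` up to (excluding) the value of register `n`. -/
def Prog.forTo (i : ℕ) (lo : Expr) (n : ℕ) (body : Prog) : Prog :=
  .seq (.assign i lo) (.loop (.sub (.reg n) (.reg i))
    (.seq body (.assign i (.add (.reg i) (.const 1)))))

/-- The overhead `8` of an iteration is four steps for the test and four for the increment; `lo.cost
+ 5` pays for the initial assignment and the last test. -/
theorem Wp.forTo_sum {i n : ℕ} {lo : Expr} {body : Prog} (T : ℕ → ℕ) (I : ℕ → State → Prop)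
    (hlo : lo.Fits W s) (hn : n ≠ i) (hi : i ∉ body.regs) (hn' : n ∉ body.regs) (h1 : 1 < W)
    (hle : lo.eval s ≤ s.reg n) (hnW : s.reg n < W)
    (hI : I (lo.eval s) (s.setReg i (lo.eval s)))
    (hstep : ∀ j s', lo.eval s ≤ j → j < s.reg n → s'.reg i = j →
      Agree (Prog.forTo i lo n body) s s' → I j s' →
      Wp W body s' (fun t s'' => t ≤ T j ∧ I (j + 1) (s''.setReg i (j + 1))))
    (hQ : ∀ t s', Agree (Prog.forTo i lo n body) s s' → s'.reg i = s.reg n → I (s.reg n) s' →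
      t ≤ ∑ j ∈ Finset.Ico (lo.eval s) (s.reg n), (T j + 8) + lo.cost + 5 → Q t s') :
    Wp W (Prog.forTo i lo n body) s Q := by
  have hag : ∀ s', Agree (.seq body (.assign i (.add (.reg i) (.const 1))))
      (s.setReg i (lo.eval s)) s' → Agree (Prog.forTo i lo n body) s s' := by
    intro s' h
    refine ⟨fun x hx => ?_, fun k hk => ?_⟩
    · simp only [Prog.forTo, Prog.regs, List.mem_append, List.mem_singleton, not_or] at hx
      rw [h.reg x (by simp [Prog.regs, hx])]
      simp [hx.1]
    · simp only [Prog.forTo, Prog.arrs, List.mem_append, List.not_mem_nil, or_false,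
        false_or] at hk
      rw [h.arr k (by simp [Prog.arrs, hk]), State.arr_setReg]
  unfold Prog.forTo
  rw [wp_seq, wp_assign]
  refine ⟨hlo, ?_⟩
  have hreg : ∀ s', Agree (.seq body (.assign i (.add (.reg i) (.const 1))))
      (s.setReg i (lo.eval s)) s' → s'.reg n = s.reg n := by
    intro s' h
    rw [h.reg n (by simp [Prog.regs, hn, hn'])]
    simp [hn]
  refine Wp.loop (fun s' => lo.eval s ≤ s'.reg i ∧ s'.reg i ≤ s.reg n ∧ I (s'.reg i) s')
    (fun s' => ∑ j ∈ Finset.Ico (s'.reg i) (s.reg n), (T j + 8)) ?_ ?_ ?_ ?_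
  · simpa using ⟨hle, hI⟩
  · rintro s' ha ⟨h2, h3, -⟩
    have := hreg s' ha
    simp only [Expr.Fits]
    omega
  · rintro s' ha ⟨h2, h3, hI'⟩ he
    have hr := hreg s' ha
    simp only [Expr.eval, hr] at he
    rw [wp_seq]
    refine (hstep (s'.reg i) s' h2 (by omega) rfl (hag s' ha) hI').mono ?_
    rintro t s2 ha2 ⟨ht, hI2⟩
    have hi2 : s2.reg i = s'.reg i := ha2.reg i hi
    rw [wp_assign]
    simp only [Expr.Fits, Expr.eval, Expr.cost, State.reg_setReg, if_true, hi2]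
    refine ⟨by omega, ⟨by omega, by omega, hI2⟩, ?_⟩
    rw [← Finset.sum_Ioo_add_eq_sum_Ico (show s'.reg i < s.reg n by omega)]
    have : Finset.Ico (s'.reg i + 1) (s.reg n) = Finset.Ioo (s'.reg i) (s.reg n) := by
      ext
      simp only [Finset.mem_Ico, Finset.mem_Ioo]
      omega
    rw [this]
    omega
  · rintro t s' ha ⟨h2, h3, hI'⟩ he ht
    have hr := hreg s' ha
    simp only [Expr.eval, hr] at he
    have he : s'.reg i = s.reg n := by omega
    rw [he] at hI'
    refine hQ _ s' (hag s' ha) he hI' ?_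
    simp only [Expr.cost, State.reg_setReg, if_true] at ht
    omega

theorem Wp.forTo {i n : ℕ} {lo : Expr} {body : Prog} (T : ℕ) (I : ℕ → State → Prop)
    (hlo : lo.Fits W s) (hn : n ≠ i) (hi : i ∉ body.regs) (hn' : n ∉ body.regs) (h1 : 1 < W)
    (hle : lo.eval s ≤ s.reg n) (hnW : s.reg n < W)
    (hI : I (lo.eval s) (s.setReg i (lo.eval s)))
    (hstep : ∀ j s', lo.eval s ≤ j → j < s.reg n → s'.reg i = j →
      Agree (Prog.forTo i lo n body) s s' → I j s' →
      Wp W body s' (fun t s'' => t ≤ T ∧ I (j + 1) (s''.setReg i (j + 1))))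
    (hQ : ∀ t s', Agree (Prog.forTo i lo n body) s s' → s'.reg i = s.reg n → I (s.reg n) s' →
      t ≤ (s.reg n - lo.eval s) * (T + 8) + lo.cost + 5 → Q t s') :
    Wp W (Prog.forTo i lo n body) s Q := by
  refine Wp.forTo_sum (fun _ => T) I hlo hn hi hn' h1 hle hnW hI hstep ?_
  intro t s' h1 h2 h3 h4
  refine hQ t s' h1 h2 h3 ?_
  simpa using h4

/-- All numbers in the registers and in the work arrays are less than `B`. -/
structure Small (B : ℕ) (s : State) : Prop where
  reg : ∀ x, s.reg x < B
  arr : ∀ k, 3 ≤ k → ∀ i, s.arr k i < B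

theorem Small.setReg {B : ℕ} (h : Small B s) (x : ℕ) {v : ℕ} (hv : v < B) :
    Small B (s.setReg x v) := by
  refine ⟨fun y => ?_, h.arr⟩
  rw [State.reg_setReg]
  split_ifs
  exacts [hv, h.reg y]

theorem Small.setArr {B : ℕ} (h : Small B s) (k i : ℕ) {v : ℕ} (hv : v < B) :
    Small B (s.setArr k i v) := by
  refine ⟨h.reg, fun k' hk' j => ?_⟩
  rw [State.arr_setArr]
  split_ifs with hk
  · rw [Function.update_apply]
    split_ifs
    exacts [hv, hk ▸ h.arr k' hk' j]
  · exact h.arr k' hk' j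

infixr:60 ";;" => Prog.seq

end RAM

namespace RAM

/-! ### Adjacency lists -/

/-- `x - 1` is the last number below `y` that satisfies `P`, or `x` is `0` and there is none. -/
structure IsLast (P : ℕ → Prop) (y x : ℕ) : Prop where
  lt : ∀ e, P e → e < y → e < x
  le : x ≤ y
  prop : x ≠ 0 → P (x - 1)

theorem isLast_zero (P : ℕ → Prop) : IsLast P 0 0 :=
  ⟨fun _ _ h => h, le_rfl, fun h => (h rfl).elim⟩

theorem IsLast.succ_of_not {P : ℕ → Prop} {y x : ℕ} (h : IsLast P y x) (hP : ¬ P y) :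
    IsLast P (y + 1) x := by
  refine ⟨fun e he hey => h.lt e he ?_, by have := h.le; omega, h.prop⟩
  rcases Nat.lt_succ_iff_lt_or_eq.1 hey with h1 | rfl
  · exact h1
  · exact absurd he hP

theorem isLast_succ {P : ℕ → Prop} {y : ℕ} (hP : P y) : IsLast P (y + 1) (y + 1) :=
  ⟨fun _ _ h => h, le_rfl, fun _ => hP⟩

/-- Edge number `e` is switched on and has the left end `l`. -/
def EdgeFrom (src flag : ℕ → ℕ) (l e : ℕ) : Prop := flag e ≠ 0 ∧ src e = l

/-- Adjacency in the graph whose edges are the numbers `e < N` with `flag e ≠ 0`. -/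
def Adj (N : ℕ) (src tgt flag : ℕ → ℕ) (l r : ℕ) : Prop :=
  ∃ e < N, EdgeFrom src flag l e ∧ tgt e = r

/-- The ends of the edges are vertices. -/
def EndsLt (nL nR N : ℕ) (src tgt flag : ℕ → ℕ) : Prop :=
  ∀ e < N, flag e ≠ 0 → src e < nL ∧ tgt e < nR

/-- `head` and `next` are linked lists of the edges at each left vertex. -/
structure Linked (nL N : ℕ) (src flag head next : ℕ → ℕ) : Prop where
  head : ∀ l < nL, IsLast (EdgeFrom src flag l) N (head l)
  next : ∀ e < N, flag e ≠ 0 → IsLast (EdgeFrom src flag (src e)) e (next e)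

theorem Linked.skip {nL N : ℕ} {src flag head next : ℕ → ℕ}
    (h : Linked nL N src flag head next) (hf : flag N = 0) :
    Linked nL (N + 1) src flag head next := by
  refine ⟨fun l hl => (h.head l hl).succ_of_not fun hh => hh.1 hf, fun e he hfe => ?_⟩
  rcases Nat.lt_succ_iff_lt_or_eq.1 he with h1 | rfl
  · exact h.next e h1 hfe
  · exact absurd hf hfe

/-- Edges are inserted by increasing number, so the new edge becomes the last one at its source and
the former head becomes its successor. Lists thus run through decreasing edge numbers, and all
pointers are shifted by one to let `0` mean the end. -/
theorem Linked.push {nL N : ℕ} {src flag head next : ℕ → ℕ}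
    (h : Linked nL N src flag head next) (hf : flag N ≠ 0) (hs : src N < nL) :
    Linked nL (N + 1) src flag (Function.update head (src N) (N + 1))
      (Function.update next N (head (src N))) := by
  refine ⟨fun l hl => ?_, fun e he hfe => ?_⟩
  · by_cases hl' : l = src N
    · subst hl'
      rw [Function.update_self]
      exact isLast_succ ⟨hf, rfl⟩
    · rw [Function.update_of_ne hl']
      exact (h.head l hl).succ_of_not fun hh => hl' hh.2.symm
  · rcases Nat.lt_succ_iff_lt_or_eq.1 he with h1 | rfl
    · rw [Function.update_of_ne h1.ne]
      exact h.next e h1 hfe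
    · rw [Function.update_self]
      exact h.head _ hs

open RAM.Expr RAM.Prog

/-- Set the entries of array `k` below the value of register `n` to `0`. -/
def clear (k n : ℕ) : Prog := forTo 8 (const 0) n (store k (reg 8) (const 0))

/-- Build the linked lists. -/
def buildLists : Prog :=
  clear 7 4 ;;
  forTo 8 (const 0) 6 (cond (read 6 (reg 8))
    (store 8 (reg 8) (read 7 (read 4 (reg 8))) ;;
      store 7 (read 4 (reg 8)) (add (reg 8) (const 1))) skip)

variable {W B : ℕ} {s : State}

theorem clear_spec (k n : ℕ) (hn : n ≠ 8) (hs : Small B s) (hB : 8 < B) (hW : B ≤ W) :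
    Wp W (clear k n) s (fun t s' => Small B s' ∧ (∀ i, i < s.reg n → s'.arr k i = 0) ∧
      (∀ i, s.reg n ≤ i → s'.arr k i = s.arr k i) ∧ t ≤ s.reg n * 11 + 6) := by
  have hreg := hs.reg
  refine Wp.forTo 3 (fun j s' => Small B s' ∧ (∀ i, i < j → s'.arr k i = 0) ∧
    ∀ i, j ≤ i → s'.arr k i = s.arr k i) ?_ hn ?_ ?_ ?_ ?_ ?_ ?_ ?_ ?_
  · simp only [Fits]; omega
  · simp [regs]
  · simp [regs]
  · omega
  · simp [eval]
  · exact (hreg n).trans_le hW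
  · refine ⟨hs.setReg _ (by simp [eval]; omega), ?_⟩
    simp [eval]
  · rintro j s' - hj hij ha ⟨hs', h1, h2⟩
    have := hreg n
    rw [wp_store]
    simp only [Fits, eval, cost, hij]
    refine ⟨by omega, le_rfl, (hs'.setArr _ _ (by omega)).setReg _ (by omega), ?_, ?_⟩
    · intro i hi
      simp only [State.arr_setReg, State.arr_setArr, if_true, Function.update_apply]
      split_ifs with h3
      · rfl
      · exact h1 i (by omega)
    · intro i hi
      simp only [State.arr_setReg, State.arr_setArr, if_true, Function.update_apply]
      rw [if_neg (by omega)]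
      exact h2 i (by omega)
  · rintro t s' ha - ⟨h1, h2, h3⟩ ht
    refine ⟨h1, h2, h3, ?_⟩
    simp only [eval, cost] at ht
    omega

theorem buildLists_spec (hs : Small B s) (hB : 8 < B) (hW : B ≤ W)
    (he : EndsLt (s.reg 4) (s.reg 5) (s.reg 6) (s.arr 4) (s.arr 5) (s.arr 6)) :
    Wp W buildLists s (fun t s' => Small B s' ∧
      Linked (s.reg 4) (s.reg 6) (s.arr 4) (s.arr 6) (s'.arr 7) (s'.arr 8) ∧
      t ≤ 40 * (s.reg 4 + s.reg 6 + 1)) := by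
  unfold buildLists
  rw [wp_seq]
  refine (clear_spec 7 4 (by decide) hs hB hW).mono ?_
  rintro t1 s1 ha1 ⟨hs1, hz, -, ht1⟩
  have e4 := ha1.reg 4 (by decide)
  have e6 := ha1.reg 6 (by decide)
  have a4 := ha1.arr 4 (by decide)
  have a6 := ha1.arr 6 (by decide)
  have hreg := hs1.reg
  refine Wp.forTo 20 (fun j s' => Small B s' ∧
    Linked (s.reg 4) j (s.arr 4) (s.arr 6) (s'.arr 7) (s'.arr 8))
    ?_ (by decide) (by decide) (by decide) (by omega) ?_ ?_ ?_ ?_ ?_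
  · simp only [Fits]; omega
  · simp [eval]
  · exact (hreg 6).trans_le hW
  · refine ⟨hs1.setReg _ (by simp [eval]; omega), fun l hl => ?_, fun e he => ?_⟩
    · simp only [eval, State.arr_setReg, hz l hl]
      exact isLast_zero _
    · exact absurd he (Nat.not_lt_zero _)
  · rintro j s' - hj hij ha ⟨hs', hl⟩
    have := hreg 6
    have b4 : s'.arr 4 = s.arr 4 := (ha.arr 4 (by decide)).trans a4
    have b6 : s'.arr 6 = s.arr 6 := (ha.arr 6 (by decide)).trans a6
    have hf := hs'.arr 6 (by decide) j
    have h4 := hs'.arr 4 (by decide) j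
    have h7 := hs'.arr 7 (by decide) (s.arr 4 j)
    rw [wp_cond]
    simp only [wp_seq, wp_store, wp_skip, Fits, eval, cost, hij, b4, b6, State.reg_setArr,
      State.arr_setArr, State.arr_setReg, if_true]
    rw [b6] at hf
    rw [b4] at h4
    refine ⟨by omega, fun h0 => ⟨by omega, ?_⟩, fun h0 => ⟨by omega, hs'.setReg _ (by omega), ?_⟩⟩
    · simp only [Nat.reduceEqDiff, if_false]
      refine ⟨by omega, by omega, ((hs'.setArr _ _ h7).setArr _ _ (by omega)).setReg _ (by omega), ?_⟩
      exact hl.push h0 (he j (by omega) h0).1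
    · exact hl.skip h0
  · rintro t s' ha - ⟨h1, h2⟩ ht
    refine ⟨h1, e6 ▸ h2, ?_⟩
    simp only [eval, cost] at ht
    rw [e6] at ht
    omega

end RAM

namespace RAM

open RAM.Expr RAM.Prog

/-! ### Search for an augmenting path -/

/-- `ml` and `mr` describe a matching of left and right vertices along `R`; a mate `v` is stored as
`v + 1`, and `0` means unmatched. -/
structure Mates (nL nR : ℕ) (R : ℕ → ℕ → Prop) (ml mr : ℕ → ℕ) : Prop where
  left : ∀ l < nL, ∀ r, ml l = r + 1 → r < nR ∧ R l r ∧ mr r = l + 1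
  right : ∀ r < nR, ∀ l, mr r = l + 1 → l < nL ∧ ml l = r + 1

/-- The alternating search from `v` has visited exactly the left vertices `que i`, `i < qt`, and it
has not met an unmatched right vertex. -/
structure Stuck (nL nR : ℕ) (R : ℕ → ℕ → Prop) (mr : ℕ → ℕ) (v : ℕ) (que : ℕ → ℕ) (qt : ℕ) :
    Prop where
  pos : 0 < qt
  start : que 0 = v
  lt : ∀ i < qt, que i < nL
  le : qt ≤ nL
  closed : ∀ i < qt, ∀ r < nR, R (que i) r → ∃ j < qt, mr r = que j + 1
  reach : ∀ Z : Set ℕ, v ∈ Z → (∀ l ∈ Z, ∀ r, R l r → ∀ l', mr r = l' + 1 → l' ∈ Z) →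
    ∀ i < qt, que i ∈ Z

/-- The right vertex `r` has a parent among the first `k` entries of the queue. -/
def HasPar (R : ℕ → ℕ → Prop) (par que : ℕ → ℕ) (k r : ℕ) : Prop :=
  ∃ j < k, par r = que j ∧ R (que j) r

/-- The alternating search from `v` has met the unmatched right vertex `r`. -/
structure Found (nL nR : ℕ) (R : ℕ → ℕ → Prop) (mr : ℕ → ℕ) (v : ℕ) (par que : ℕ → ℕ)
    (qt r : ℕ) : Prop where
  start : que 0 = v
  lt : ∀ i < qt, que i < nL
  inj : ∀ i < qt, ∀ j < qt, que i = que j → i = j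
  mate : ∀ i < qt, i ≠ 0 → ∃ r' < nR, mr r' = que i + 1 ∧ HasPar R par que i r'
  lt_right : r < nR
  free : mr r = 0
  par : HasPar R par que qt r

/-- The invariant of breadth-first search. -/
structure Bfs (nL nR N : ℕ) (src tgt flag mr : ℕ → ℕ) (v : ℕ) (vis par que : ℕ → ℕ)
    (qh qt x : ℕ) : Prop where
  pos : 0 < qt
  start : que 0 = v
  head_le : qh ≤ qt
  lt : ∀ i < qt, que i < nL
  inj : ∀ i < qt, ∀ j < qt, que i = que j → i = j
  mate : ∀ i < qt, i ≠ 0 → ∃ r < nR, vis r ≠ 0 ∧ mr r = que i + 1 ∧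
    HasPar (Adj N src tgt flag) par que i r
  seen : ∀ r < nR, vis r ≠ 0 → ∃ i < qt, mr r = que i + 1
  done : ∀ i < qh, ∀ e < N, EdgeFrom src flag (que i) e → vis (tgt e) ≠ 0
  part : qh < qt → ∀ e < N, EdgeFrom src flag (que qh) e → x ≤ e → vis (tgt e) ≠ 0
  ptr : qh < qt → x ≠ 0 → x ≤ N ∧ EdgeFrom src flag (que qh) (x - 1)
  reach : ∀ Z : Set ℕ, v ∈ Z →
    (∀ l ∈ Z, ∀ r, Adj N src tgt flag l r → ∀ l', mr r = l' + 1 → l' ∈ Z) → ∀ i < qt, que i ∈ Z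

section bfs

variable {nL nR N : ℕ} {src tgt flag head next ml mr vis par que : ℕ → ℕ} {v qh qt x : ℕ}

theorem Bfs.le (h : Bfs nL nR N src tgt flag mr v vis par que qh qt x) : qt ≤ nL := by
  have := Finset.card_le_card_of_injOn (s := Finset.range qt) (t := Finset.range nL) que
    (fun i hi => by
      simp only [Finset.coe_range, Set.mem_Iio] at hi ⊢
      exact h.lt i hi)
    (fun i hi j hj hij => h.inj i (by simpa using hi) j (by simpa using hj) hij)
  simpa using this

/-- The edges that are still to be scanned. -/
def unscanned (N : ℕ) (src que : ℕ → ℕ) (qh x : ℕ) : Finset ℕ :=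
  (Finset.range N).filter fun e => (∀ i < qh, que i ≠ src e) ∧ (src e = que qh → e < x)

theorem card_unscanned_le : (unscanned N src que qh x).card ≤ N :=
  (Finset.card_filter_le _ _).trans (Finset.card_range N).le

/-- Advancing the pointer removes edge `x - 1` from the set. The queue may change beyond `qh`,
because scanning can append a vertex. -/
theorem Bfs.card_unscanned_next (h : Bfs nL nR N src tgt flag mr v vis par que qh qt x)
    (hl : Linked nL N src flag head next) (hq : qh < qt) (hx : x ≠ 0) {que' : ℕ → ℕ}
    (hque : ∀ i ≤ qh, que' i = que i) :
    (unscanned N src que' qh (next (x - 1))).card + 1 ≤ (unscanned N src que qh x).card := by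
  obtain ⟨hxN, he⟩ := h.ptr hq hx
  have hn := (hl.next (x - 1) (by omega) he.1).le
  refine Finset.card_lt_card ((Finset.ssubset_iff_of_subset ?_).2 ⟨x - 1, ?_, ?_⟩)
  · intro e hee
    simp only [unscanned, Finset.mem_filter, Finset.mem_range] at hee ⊢
    refine ⟨hee.1, fun i hi => hque i hi.le ▸ hee.2.1 i hi, fun h1 => ?_⟩
    have := hee.2.2 (by rw [h1, hque qh le_rfl])
    omega
  · simp only [unscanned, Finset.mem_filter, Finset.mem_range]
    refine ⟨by omega, fun i hi h1 => ?_, fun _ => by omega⟩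
    have := h.inj i (by omega) qh hq (h1.trans he.2)
    omega
  · simp only [unscanned, Finset.mem_filter, Finset.mem_range, not_and]
    intro _ _ h1
    have := h1 (by rw [he.2, hque qh le_rfl])
    omega

/-- Pointer `0` already counts all edges at the head of the queue as scanned, so popping adds
nothing, whatever the new pointer `y` is. -/
theorem card_unscanned_pop {y : ℕ} :
    (unscanned N src que (qh + 1) y).card ≤ (unscanned N src que qh 0).card := by
  refine Finset.card_le_card fun e he => ?_
  simp only [unscanned, Finset.mem_filter, Finset.mem_range] at he ⊢
  exact ⟨he.1, fun i hi => he.2.1 i (by omega), fun h1 => (he.2.1 qh (by omega) h1.symm).elim⟩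

theorem bfs_init (hl : Linked nL N src flag head next) (hv : v < nL)
    (hvis : ∀ r < nR, vis r = 0) (hq : que 0 = v) :
    Bfs nL nR N src tgt flag mr v vis par que 0 1 (head v) where
  pos := one_pos
  start := hq
  head_le := zero_le_one
  lt := fun i hi => by
    obtain rfl : i = 0 := by omega
    rwa [hq]
  inj := fun i hi j hj _ => by omega
  mate := fun i hi h0 => by omega
  seen := fun r hr hr' => (hr' (hvis r hr)).elim
  done := fun i hi => by omega
  part := fun _ e he h1 h2 => by
    have := (hl.head v hv).lt e (hq ▸ h1) he
    omega
  ptr := fun _ hx => by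
    rw [hq]
    exact ⟨(hl.head v hv).le, (hl.head v hv).prop hx⟩
  reach := fun Z hZ _ i hi => by
    obtain rfl : i = 0 := by omega
    rwa [hq]

theorem Bfs.pop (h : Bfs nL nR N src tgt flag mr v vis par que qh qt 0)
    (hl : Linked nL N src flag head next) (hq : qh < qt) :
    Bfs nL nR N src tgt flag mr v vis par que (qh + 1) qt (head (que (qh + 1))) where
  pos := h.pos
  start := h.start
  head_le := hq
  lt := h.lt
  inj := h.inj
  mate := h.mate
  seen := h.seen
  done := fun i hi e he h1 => by
    rcases Nat.lt_succ_iff_lt_or_eq.1 hi with h2 | rfl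
    · exact h.done i h2 e he h1
    · exact h.part hq e he h1 (Nat.zero_le _)
  part := fun hq' e he h1 h2 => by
    have := (hl.head _ (h.lt _ hq')).lt e h1 he
    omega
  ptr := fun hq' hx => ⟨(hl.head _ (h.lt _ hq')).le, (hl.head _ (h.lt _ hq')).prop hx⟩
  reach := h.reach

/-- No edge at `l` has its number strictly between `next (x - 1) - 1` and `x - 1`, so moving the
pointer adds only the edge `x - 1` to those for which `P` is known. -/
theorem Linked.scan (hl : Linked nL N src flag head next) {l : ℕ} (_hx : x ≠ 0) (hxN : x ≤ N)
    (he : EdgeFrom src flag l (x - 1)) {P : ℕ → Prop} (hP : P (x - 1))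
    (h : ∀ e < N, EdgeFrom src flag l e → x ≤ e → P e) :
    ∀ e < N, EdgeFrom src flag l e → next (x - 1) ≤ e → P e := by
  intro e heN h1 h2
  have hlast := hl.next (x - 1) (by omega) he.1
  rcases lt_trichotomy e (x - 1) with h3 | rfl | h3
  · rw [he.2] at hlast
    have := hlast.lt e h1 h3
    omega
  · exact hP
  · exact h e heN h1 (by omega)

theorem Linked.ptr_next (hl : Linked nL N src flag head next) {l : ℕ} (hx : x ≠ 0) (hxN : x ≤ N)
    (he : EdgeFrom src flag l (x - 1)) (h0 : next (x - 1) ≠ 0) :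
    next (x - 1) ≤ N ∧ EdgeFrom src flag l (next (x - 1) - 1) := by
  have hlast := hl.next (x - 1) (by omega) he.1
  refine ⟨hlast.le.trans (by omega), ?_⟩
  have := hlast.prop h0
  rwa [he.2] at this

theorem Bfs.skip (h : Bfs nL nR N src tgt flag mr v vis par que qh qt x)
    (hl : Linked nL N src flag head next) (hq : qh < qt) (hx : x ≠ 0)
    (hv : vis (tgt (x - 1)) ≠ 0) :
    Bfs nL nR N src tgt flag mr v vis par que qh qt (next (x - 1)) := by
  obtain ⟨hxN, he⟩ := h.ptr hq hx
  exact { h with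
    part := fun hq' => hl.scan hx hxN he hv (h.part hq')
    ptr := fun _ => hl.ptr_next hx hxN he }

theorem Bfs.found (h : Bfs nL nR N src tgt flag mr v vis par que qh qt x)
    (hlt : EndsLt nL nR N src tgt flag) (hq : qh < qt) (hx : x ≠ 0)
    (hv : vis (tgt (x - 1)) = 0) (hm : mr (tgt (x - 1)) = 0) :
    Found nL nR (Adj N src tgt flag) mr v (Function.update par (tgt (x - 1)) (que qh)) que qt
      (tgt (x - 1)) := by
  obtain ⟨hxN, he⟩ := h.ptr hq hx
  refine ⟨h.start, h.lt, h.inj, fun i hi h0 => ?_, (hlt _ (by omega) he.1).2, hm,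
    qh, hq, Function.update_self .., x - 1, by omega, he, rfl⟩
  obtain ⟨r, hr, hvr, hmr, j, hj, hp, hadj⟩ := h.mate i hi h0
  refine ⟨r, hr, hmr, j, hj, ?_, hadj⟩
  rwa [Function.update_of_ne]
  rintro rfl
  exact hvr hv

/-- The mate `l` of a newly visited right vertex is new to the queue: it is not the start, which is
unmatched, and any other queued vertex is the mate of a visited right vertex. Parents recorded
earlier survive because `par` changes only at an unvisited vertex. -/
theorem Bfs.push (h : Bfs nL nR N src tgt flag mr v vis par que qh qt x)
    (hl : Linked nL N src flag head next) (hlt : EndsLt nL nR N src tgt flag)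
    (hM : Mates nL nR (Adj N src tgt flag) ml mr) (hfree : ml v = 0) (hq : qh < qt) (hx : x ≠ 0)
    (hv : vis (tgt (x - 1)) = 0) (hm : mr (tgt (x - 1)) ≠ 0) :
    Bfs nL nR N src tgt flag mr v (Function.update vis (tgt (x - 1)) 1)
      (Function.update par (tgt (x - 1)) (que qh))
      (Function.update que qt (mr (tgt (x - 1)) - 1)) qh (qt + 1) (next (x - 1)) := by
  obtain ⟨hxN, he⟩ := h.ptr hq hx
  have hr := (hlt _ (show x - 1 < N by omega) he.1).2
  obtain ⟨l, hml⟩ := Nat.exists_eq_succ_of_ne_zero hm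
  set r := tgt (x - 1) with hrdef
  rw [hml, Nat.succ_sub_one]
  obtain ⟨hlL, hmlr⟩ := hM.right r hr l hml
  have hold : ∀ i < qt, Function.update que qt l i = que i := fun i hi =>
    Function.update_of_ne hi.ne _ _
  have hnew : ∀ i < qt, que i ≠ l := by
    rintro i hi rfl
    by_cases h0 : i = 0
    · subst h0
      rw [h.start, hfree] at hmlr
      cases hmlr
    · obtain ⟨r', hr', hvr', hmr', -⟩ := h.mate i hi h0
      have h1 := (hM.right r' hr' _ hmr').2
      rw [hmlr] at h1
      have : r = r' := by omega
      exact hvr' (this ▸ hv)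
  have hvis : ∀ r', vis r' ≠ 0 → Function.update vis r 1 r' ≠ 0 := by
    intro r' hr'
    rw [Function.update_apply]
    split_ifs
    exacts [one_ne_zero, hr']
  have hpar : ∀ k ≤ qt, ∀ r', vis r' ≠ 0 → HasPar (Adj N src tgt flag) par que k r' →
      HasPar (Adj N src tgt flag) (Function.update par r (que qh)) (Function.update que qt l) k
        r' := by
    rintro k hk r' hr' ⟨j, hj, h1, h2⟩
    refine ⟨j, hj, ?_, ?_⟩
    · rw [hold j (by omega), Function.update_of_ne, h1]
      rintro rfl
      exact hr' hv
    · rwa [hold j (by omega)]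
  have hadj : Adj N src tgt flag (que qh) r := ⟨x - 1, by omega, he, rfl⟩
  refine ⟨Nat.succ_pos _, ?_, by omega, ?_, ?_, ?_, ?_, ?_, ?_, ?_, ?_⟩
  · rw [hold 0 h.pos, h.start]
  · intro i hi
    rcases Nat.lt_succ_iff_lt_or_eq.1 hi with h2 | rfl
    · rw [hold i h2]
      exact h.lt i h2
    · rwa [Function.update_self]
  · intro i hi j hj hij
    rcases Nat.lt_succ_iff_lt_or_eq.1 hi with h2 | rfl <;>
      rcases Nat.lt_succ_iff_lt_or_eq.1 hj with h3 | rfl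
    · rw [hold i h2, hold j h3] at hij
      exact h.inj i h2 j h3 hij
    · rw [hold i h2, Function.update_self] at hij
      exact absurd hij (hnew i h2)
    · rw [hold j h3, Function.update_self] at hij
      exact absurd hij.symm (hnew j h3)
    · rfl
  · intro i hi h0
    rcases Nat.lt_succ_iff_lt_or_eq.1 hi with h2 | rfl
    · obtain ⟨r', hr', hvr', hmr', hp⟩ := h.mate i h2 h0
      exact ⟨r', hr', hvis r' hvr', by rw [hold i h2, hmr'], hpar i h2.le r' hvr' hp⟩
    · refine ⟨r, hr, by rw [Function.update_self]; exact one_ne_zero,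
        by rw [Function.update_self, hml], qh, hq, ?_, ?_⟩
      · rw [Function.update_self, hold qh hq]
      · rwa [hold qh hq]
  · intro r' hr' hv'
    by_cases h2 : r' = r
    · subst h2
      exact ⟨qt, Nat.lt_succ_self _, by rw [Function.update_self, hml]⟩
    · rw [Function.update_of_ne h2] at hv'
      obtain ⟨i, hi, h3⟩ := h.seen r' hr' hv'
      exact ⟨i, by omega, by rw [hold i hi, h3]⟩
  · intro i hi e heN h1
    rw [hold i (by omega)] at h1
    exact hvis _ (h.done i hi e heN h1)
  · intro _
    rw [hold qh hq]
    refine hl.scan hx hxN he ?_ fun e heN h1 h2 => hvis _ (h.part hq e heN h1 h2)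
    rw [← hrdef, Function.update_self]
    exact one_ne_zero
  · intro _
    rw [hold qh hq]
    exact hl.ptr_next hx hxN he
  · intro Z hZ hcl i hi
    rcases Nat.lt_succ_iff_lt_or_eq.1 hi with h2 | rfl
    · rw [hold i h2]
      exact h.reach Z hZ hcl i h2
    · rw [Function.update_self]
      exact hcl _ (h.reach Z hZ hcl qh hq) r hadj l hml

theorem Bfs.stuck (h : Bfs nL nR N src tgt flag mr v vis par que qt qt x) :
    Stuck nL nR (Adj N src tgt flag) mr v que qt := by
  refine ⟨h.pos, h.start, h.lt, h.le, ?_, h.reach⟩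
  rintro i hi r hr ⟨e, heN, he, rfl⟩
  exact h.seen _ hr (h.done i hi e heN he)

end bfs

/-- Breadth-first search along alternating paths from the left vertex in register `12`. Register
`16` is `r + 1` if the unmatched right vertex `r` is found, and `0` if there is none. -/
def bfs : Prog :=
  clear 11 5 ;;
  store 13 (const 0) (reg 12) ;;
  assign 13 (const 0) ;;
  assign 14 (const 1) ;;
  assign 15 (read 7 (reg 12)) ;;
  assign 16 (const 0) ;;
  loop (sub (reg 14) (reg 13))
    (cond (reg 15)
      (assign 17 (read 5 (sub (reg 15) (const 1))) ;;
        assign 15 (read 8 (sub (reg 15) (const 1))) ;;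
        cond (read 11 (reg 17)) skip
          (store 11 (reg 17) (const 1) ;;
            store 12 (reg 17) (read 13 (reg 13)) ;;
            cond (read 10 (reg 17))
              (store 13 (reg 14) (sub (read 10 (reg 17)) (const 1)) ;;
                assign 14 (add (reg 14) (const 1)))
              (assign 16 (add (reg 17) (const 1)) ;; assign 13 (reg 14))))
      (assign 13 (add (reg 13) (const 1)) ;; assign 15 (read 7 (read 13 (reg 13)))))

variable {W B : ℕ} {s : State}

theorem bfs_spec (hs : Small B s) (hB : 8 < B) (hW : B ≤ W)
    (hlt : EndsLt (s.reg 4) (s.reg 5) (s.reg 6) (s.arr 4) (s.arr 5) (s.arr 6))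
    (hl : Linked (s.reg 4) (s.reg 6) (s.arr 4) (s.arr 6) (s.arr 7) (s.arr 8))
    (hM : Mates (s.reg 4) (s.reg 5) (Adj (s.reg 6) (s.arr 4) (s.arr 5) (s.arr 6)) (s.arr 9)
      (s.arr 10)) (hv : s.reg 12 < s.reg 4) (hfree : s.arr 9 (s.reg 12) = 0) :
    Wp W bfs s (fun t s' => Small B s' ∧ t ≤ 70 * (s.reg 4 + s.reg 5 + s.reg 6 + 1) ∧
      (s'.reg 16 = 0 → Stuck (s.reg 4) (s.reg 5) (Adj (s.reg 6) (s.arr 4) (s.arr 5) (s.arr 6))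
        (s.arr 10) (s.reg 12) (s'.arr 13) (s'.reg 14)) ∧
      (s'.reg 16 ≠ 0 → Found (s.reg 4) (s.reg 5) (Adj (s.reg 6) (s.arr 4) (s.arr 5) (s.arr 6))
        (s.arr 10) (s.reg 12) (s'.arr 12) (s'.arr 13) (s'.reg 14) (s'.reg 16 - 1))) := by
  unfold bfs
  rw [wp_seq]
  refine (clear_spec 11 5 (by decide) hs hB hW).mono ?_
  rintro t1 s1 ha1 ⟨hs1, hz, -, ht1⟩
  have e4 := ha1.reg 4 (by decide)
  have e5 := ha1.reg 5 (by decide)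
  have e6 := ha1.reg 6 (by decide)
  have e12 := ha1.reg 12 (by decide)
  have a4 := ha1.arr 4 (by decide)
  have a5 := ha1.arr 5 (by decide)
  have a6 := ha1.arr 6 (by decide)
  have a7 := ha1.arr 7 (by decide)
  have a8 := ha1.arr 8 (by decide)
  have a9 := ha1.arr 9 (by decide)
  have a10 := ha1.arr 10 (by decide)
  have hr12 := hs.reg 12
  have h7 := hs.arr 7 (by decide) (s.reg 12)
  simp only [wp_seq, wp_store, wp_assign, Fits, eval, cost, State.reg_setArr, State.reg_setReg,
    State.arr_setArr, State.arr_setReg, e12, a7]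
  simp only [Nat.reduceEqDiff, if_false]
  refine ⟨by omega, by omega, by omega, by omega, by omega, ?_⟩
  set s2 := (((((s1.setArr 13 0 (s.reg 12)).setReg 13 0).setReg 14 1).setReg 15
    (s.arr 7 (s.reg 12))).setReg 16 0) with hs2
  have hsm2 : Small B s2 := by
    refine Small.setReg (Small.setReg (Small.setReg (Small.setReg (Small.setArr hs1 _ _ hr12) _ ?_)
      _ ?_) _ h7) _ ?_ <;> omega
  refine Wp.loop (fun s' => Small B s' ∧
      ((s'.reg 16 = 0 ∧ Bfs (s.reg 4) (s.reg 5) (s.reg 6) (s.arr 4) (s.arr 5) (s.arr 6) (s.arr 10)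
        (s.reg 12) (s'.arr 11) (s'.arr 12) (s'.arr 13) (s'.reg 13) (s'.reg 14) (s'.reg 15)) ∨
      (s'.reg 16 ≠ 0 ∧ s'.reg 13 = s'.reg 14 ∧
        Found (s.reg 4) (s.reg 5) (Adj (s.reg 6) (s.arr 4) (s.arr 5) (s.arr 6))
        (s.arr 10) (s.reg 12) (s'.arr 12) (s'.arr 13) (s'.reg 14) (s'.reg 16 - 1))))
    -- Every iteration scans an edge or pops a vertex. After success the potential may vanish, since
    -- the loop ends at once.
    (fun s' => if s'.reg 16 = 0 then 60 * ((s.reg 4 - s'.reg 13) +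
      (unscanned (s.reg 6) (s.arr 4) (s'.arr 13) (s'.reg 13) (s'.reg 15)).card) else 0)
    ?_ ?_ ?_ ?_
  · refine ⟨hsm2, Or.inl ⟨by simp [hs2], ?_⟩⟩
    simp only [hs2, State.reg_setArr, State.reg_setReg, State.arr_setArr, State.arr_setReg]
    simp
    exact bfs_init hl hv hz (by simp)
  · rintro s' ha ⟨hsm, -⟩
    have := hsm.reg 13
    have := hsm.reg 14
    simp only [Fits]
    omega
  · rintro s' ha ⟨hsm, hinv⟩ hne
    simp only [eval] at hne
    rcases hinv with ⟨h16, hinv⟩ | ⟨-, h, -⟩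
    swap
    · omega
    have hq : s'.reg 13 < s'.reg 14 := by omega
    have c5 : s'.arr 5 = s.arr 5 := by rw [ha.arr 5 (by decide)]; simpa [hs2] using a5
    have c7 : s'.arr 7 = s.arr 7 := by rw [ha.arr 7 (by decide)]; simpa [hs2] using a7
    have c8 : s'.arr 8 = s.arr 8 := by rw [ha.arr 8 (by decide)]; simpa [hs2] using a8
    have c10 : s'.arr 10 = s.arr 10 := by rw [ha.arr 10 (by decide)]; simpa [hs2] using a10
    have b13 := hsm.reg 13
    have b14 := hsm.reg 14
    have b15 := hsm.reg 15
    have b4 := hs.reg 4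
    have hle := hinv.le
    have d5 := hs.arr 5 (by decide)
    have d7 := hs.arr 7 (by decide)
    have d8 := hs.arr 8 (by decide)
    have d10 := hs.arr 10 (by decide)
    have d11 := hsm.arr 11 (by decide)
    have d13 := hsm.arr 13 (by decide)
    rw [wp_cond]
    refine ⟨?_, ?_, ?_⟩
    · simp only [Fits]; omega
    · simp only [eval]
      intro hx
      obtain ⟨hxN, he⟩ := hinv.ptr hq hx
      have hrn := (hlt _ (show s'.reg 15 - 1 < s.reg 6 by omega) he.1).2
      have b5 := hs.reg 5
      have d5' := d5 (s'.reg 15 - 1)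
      have d8' := d8 (s'.reg 15 - 1)
      have d11' := d11 (s.arr 5 (s'.reg 15 - 1))
      have d10' := d10 (s.arr 5 (s'.reg 15 - 1))
      have d13' := d13 (s'.reg 13)
      simp only [wp_seq, wp_store, wp_assign, wp_cond, wp_skip, Fits, eval, cost,
        State.reg_setArr, State.reg_setReg, State.arr_setArr, State.arr_setReg, Nat.reduceEqDiff,
        if_true, if_false, c5, c8, c10, h16]
      refine ⟨by omega, by omega, by omega, ?_, ?_⟩
      · intro hvis
        refine ⟨⟨(hsm.setReg _ (by omega)).setReg _ (by omega), Or.inl ⟨trivial,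
          hinv.skip hl hq hx hvis⟩⟩, ?_⟩
        have := hinv.card_unscanned_next hl hq hx (que' := s'.arr 13) (fun _ _ => rfl)
        omega
      · intro hvis
        refine ⟨by omega, by omega, by omega, ?_, ?_⟩
        · intro hm
          have hp := hinv.push hl hlt hM hfree hq hx hvis hm
          have hle := hp.le
          refine ⟨by omega, by omega, ⟨?_, Or.inl ⟨trivial, hp⟩⟩, ?_⟩
          · refine Small.setReg (Small.setArr (Small.setArr (Small.setArr (Small.setReg
              (Small.setReg hsm _ ?_) _ ?_) _ _ ?_) _ _ ?_) _ _ ?_) _ ?_ <;> omega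
          · have := hinv.card_unscanned_next hl hq hx
              (que' := Function.update (s'.arr 13) (s'.reg 14)
                (s.arr 10 (s.arr 5 (s'.reg 15 - 1)) - 1))
              (fun i hi => Function.update_of_ne (by omega) _ _)
            omega
        · intro hm
          have hp := hinv.found hlt hq hx hvis hm
          refine ⟨by omega, by omega, ⟨?_, Or.inr ⟨Nat.succ_ne_zero _, trivial, ?_⟩⟩, ?_⟩
          · refine Small.setReg (Small.setReg (Small.setArr (Small.setArr (Small.setReg
              (Small.setReg hsm _ ?_) _ ?_) _ _ ?_) _ _ ?_) _ ?_) _ ?_ <;> omega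
          · exact hp
          · have := hinv.card_unscanned_next hl hq hx (que' := s'.arr 13) (fun _ _ => rfl)
            omega
    · simp only [eval]
      intro hx
      -- After the last pop this index is the tail of the queue and the value read is meaningless.
      -- It only has to fit into a word, because `part` and `ptr` claim nothing for an empty queue.
      have d13' := d13 (s'.reg 13 + 1)
      have d7' := d7 (s'.arr 13 (s'.reg 13 + 1))
      simp only [wp_seq, wp_assign, Fits, eval, cost,
        State.reg_setReg, State.arr_setReg, Nat.reduceEqDiff,
        if_true, if_false, c7, h16]
      refine ⟨by omega, by omega, ⟨?_, Or.inl ⟨trivial, ?_⟩⟩, ?_⟩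
      · exact (hsm.setReg _ (by omega)).setReg _ (by omega)
      · exact (hx ▸ hinv).pop hl hq
      · have := card_unscanned_pop (N := s.reg 6) (src := s.arr 4) (que := s'.arr 13)
          (qh := s'.reg 13) (y := s.arr 7 (s'.arr 13 (s'.reg 13 + 1)))
        rw [hx]
        omega
  · rintro t s' ha ⟨hsm, hinv⟩ h0 ht
    simp only [eval] at h0
    have h1 : (if s2.reg 16 = 0 then 60 * ((s.reg 4 - s2.reg 13) +
      (unscanned (s.reg 6) (s.arr 4) (s2.arr 13) (s2.reg 13) (s2.reg 15)).card) else 0) ≤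
        60 * (s.reg 4 + s.reg 6) := by
      split_ifs
      · have := card_unscanned_le (N := s.reg 6) (src := s.arr 4) (que := s2.arr 13)
          (qh := s2.reg 13) (x := s2.reg 15)
        omega
      · omega
    simp only [cost] at ht
    refine ⟨hsm, by omega, ?_, ?_⟩
    · intro h16
      rcases hinv with ⟨-, hinv⟩ | ⟨h, -⟩
      · have : s'.reg 13 = s'.reg 14 := by have := hinv.head_le; omega
        exact (this ▸ hinv).stuck
      · exact absurd h16 h
    · intro h16
      rcases hinv with ⟨h, -⟩ | ⟨-, -, h⟩
      · exact absurd h h16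
      · exact h

end RAM

namespace RAM

open RAM.Expr RAM.Prog

/-! ### Augmentation -/

/-- The matching `ml'`, `mr'` covers everything that `ml`, `mr` covers. -/
def Extends (nL nR : ℕ) (ml mr ml' mr' : ℕ → ℕ) : Prop :=
  (∀ l < nL, ml l ≠ 0 → ml' l ≠ 0) ∧ ∀ r < nR, mr r ≠ 0 → mr' r ≠ 0

/-- The invariant of the augmentation: `r` is the right vertex that is to be matched next. -/
structure Augmenting (nL nR : ℕ) (R : ℕ → ℕ → Prop) (ml₀ mr₀ : ℕ → ℕ) (par que : ℕ → ℕ) (qt : ℕ)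
    (ml mr : ℕ → ℕ) (r : ℕ) : Prop where
  lt : r < nR
  par : ∃ j < qt, par r = que j ∧ R (que j) r ∧ ∀ i ≤ j, ml (que i) = ml₀ (que i)
  left : ∀ l < nL, ∀ r', ml l = r' + 1 → r' < nR ∧ R l r' ∧ r' ≠ r ∧ mr r' = l + 1
  right : ∀ r' < nR, r' ≠ r → ∀ l, mr r' = l + 1 → l < nL ∧ ml l = r' + 1
  cover_left : ∀ l < nL, ml₀ l ≠ 0 → ml l ≠ 0
  cover_right : ∀ r' < nR, r' ≠ r → mr₀ r' ≠ 0 → mr r' ≠ 0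

section augment

variable {nL nR : ℕ} {R : ℕ → ℕ → Prop} {ml₀ mr₀ par que ml mr : ℕ → ℕ} {v qt r : ℕ}

/-- The search ends at an unmatched vertex, hence no left vertex is matched to `r` at the start. -/
theorem Found.augmenting (h : Found nL nR R mr₀ v par que qt r) (hM : Mates nL nR R ml₀ mr₀) :
    Augmenting nL nR R ml₀ mr₀ par que qt ml₀ mr₀ r := by
  obtain ⟨j, hj, h1, h2⟩ := h.par
  refine ⟨h.lt_right, ⟨j, hj, h1, h2, fun _ _ => rfl⟩, fun l hl r' hr' => ?_,
    fun r' hr' _ l hl => hM.right r' hr' l hl, fun _ _ h => h, fun _ _ _ h => h⟩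
  obtain ⟨h3, h4, h5⟩ := hM.left l hl r' hr'
  refine ⟨h3, h4, ?_, h5⟩
  rintro rfl
  rw [h.free] at h5
  cases h5

theorem Augmenting.step_left (h : Augmenting nL nR R ml₀ mr₀ par que qt ml mr r)
    (hlt : ∀ i < qt, que i < nL) {x : ℕ} (hx : x = r ∨ ml (par r) = x + 1) :
    ∀ l < nL, ∀ r', Function.update ml (par r) (r + 1) l = r' + 1 →
      r' < nR ∧ R l r' ∧ (ml (par r) = x + 1 → r' ≠ x) ∧
        Function.update mr r (par r + 1) r' = l + 1 := by
  obtain ⟨j, hj, hp, hR, heq⟩ := h.par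
  have hpl : par r < nL := hp ▸ hlt j hj
  intro l hl r' hr'
  by_cases hlp : l = par r
  · subst hlp
    rw [Function.update_self] at hr'
    obtain rfl : r = r' := by omega
    refine ⟨h.lt, hp ▸ hR, fun h1 => ?_, Function.update_self ..⟩
    exact (h.left _ hpl x h1).2.2.1.symm
  · rw [Function.update_of_ne hlp] at hr'
    obtain ⟨h1, h2, h3, h4⟩ := h.left l hl r' hr'
    refine ⟨h1, h2, ?_, by rw [Function.update_of_ne h3, h4]⟩
    rintro h5 rfl
    have := (h.left _ hpl _ h5).2.2.2
    rw [h4] at this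
    exact hlp (by omega)

/-- The old mate of the parent takes over the role of `r`. Its own parent sits strictly earlier in
the queue, where no mates have been changed yet; this is what the condition on indices up to `j` in
`Augmenting.par` records. -/
theorem Augmenting.step (h : Augmenting nL nR R ml₀ mr₀ par que qt ml mr r)
    {r₀ : ℕ} (hF : Found nL nR R mr₀ v par que qt r₀) (hM : Mates nL nR R ml₀ mr₀) (hv : ml₀ v = 0) {x : ℕ}
    (hx : ml (par r) = x + 1) :
    Augmenting nL nR R ml₀ mr₀ par que qt (Function.update ml (par r) (r + 1))
      (Function.update mr r (par r + 1)) x := by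
  obtain ⟨j, hj, hp, hR, heq⟩ := h.par
  have hpl : par r < nL := hp ▸ hF.lt j hj
  have hj0 : j ≠ 0 := by
    rintro rfl
    have := heq 0 le_rfl
    rw [← hp, hx, hp, hF.start, hv] at this
    cases this
  obtain ⟨r', hr', hm, i, hi, hpi, hRi⟩ := hF.mate j hj hj0
  have hml : ml₀ (que j) = x + 1 := by rw [← heq j le_rfl, ← hp, hx]
  have hrx : r' = x := by
    have := (hM.right r' hr' _ hm).2
    omega
  subst hrx
  have hunmoved : ∀ k < j, que k ≠ par r := by
    intro k hk hkp
    have := hF.inj k (by omega) j hj (hkp.trans hp)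
    omega
  refine ⟨hr', ⟨i, by omega, hpi, hRi, fun k hk => ?_⟩, fun l hl r₁ h1 => ?_, fun r₁ h1 h2 l h3 => ?_,
    fun l hl h1 => ?_, fun r₁ h1 h2 h3 => ?_⟩
  · rw [Function.update_of_ne (hunmoved k (by omega))]
    exact heq k (by omega)
  · obtain ⟨a, b, c, d⟩ := h.step_left hF.lt (Or.inr hx) l hl r₁ h1
    exact ⟨a, b, c hx, d⟩
  · by_cases hr1 : r₁ = r
    · subst hr1
      rw [Function.update_self] at h3
      obtain rfl : par r₁ = l := by omega
      exact ⟨hpl, Function.update_self ..⟩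
    · rw [Function.update_of_ne hr1] at h3
      obtain ⟨h4, h5⟩ := h.right r₁ h1 hr1 l h3
      refine ⟨h4, ?_⟩
      rw [Function.update_of_ne, h5]
      rintro rfl
      rw [hx] at h5
      omega
  · rw [Function.update_apply]
    split_ifs
    exacts [Nat.succ_ne_zero _, h.cover_left l hl h1]
  · rw [Function.update_apply]
    split_ifs with h4
    exacts [Nat.succ_ne_zero _, h.cover_right r₁ h1 h4 h3]

/-- Every queued vertex other than the start was matched before, so meeting an unmatched parent
means that the path is back at `v`. -/
theorem Augmenting.finish (h : Augmenting nL nR R ml₀ mr₀ par que qt ml mr r)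
    {r₀ : ℕ} (hF : Found nL nR R mr₀ v par que qt r₀) (hM : Mates nL nR R ml₀ mr₀) (hx : ml (par r) = 0) :
    Mates nL nR R (Function.update ml (par r) (r + 1)) (Function.update mr r (par r + 1)) ∧
      Extends nL nR ml₀ mr₀ (Function.update ml (par r) (r + 1))
        (Function.update mr r (par r + 1)) ∧ Function.update ml (par r) (r + 1) v ≠ 0 := by
  obtain ⟨j, hj, hp, hR, heq⟩ := h.par
  have hpl : par r < nL := hp ▸ hF.lt j hj
  have hj0 : j = 0 := by
    by_contra hj0
    obtain ⟨r', hr', hm, -⟩ := hF.mate j hj hj0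
    have h1 := (hM.right r' hr' _ hm).2
    rw [← heq j le_rfl, ← hp, hx] at h1
    cases h1
  refine ⟨⟨fun l hl r₁ h1 => ?_, fun r₁ h1 l h3 => ?_⟩, ⟨fun l hl h1 => ?_, fun r₁ h1 h3 => ?_⟩, ?_⟩
  · obtain ⟨a, b, -, d⟩ := h.step_left hF.lt (Or.inl rfl) l hl r₁ h1
    exact ⟨a, b, d⟩
  · by_cases hr1 : r₁ = r
    · subst hr1
      rw [Function.update_self] at h3
      obtain rfl : par r₁ = l := by omega
      exact ⟨hpl, Function.update_self ..⟩
    · rw [Function.update_of_ne hr1] at h3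
      obtain ⟨h4, h5⟩ := h.right r₁ h1 hr1 l h3
      refine ⟨h4, ?_⟩
      rw [Function.update_of_ne, h5]
      rintro rfl
      rw [hx] at h5
      omega
  · rw [Function.update_apply]
    split_ifs
    exacts [Nat.succ_ne_zero _, h.cover_left l hl h1]
  · rw [Function.update_apply]
    split_ifs with h4
    exacts [Nat.succ_ne_zero _, h.cover_right r₁ h1 h4 h3]
  · rw [hp, hj0, hF.start, Function.update_self]
    exact Nat.succ_ne_zero _

/-- The length of the path needs no separate bound: each step gives a new mate to a left vertex that
still had its original one. -/
theorem Augmenting.card_lt (h : Augmenting nL nR R ml₀ mr₀ par que qt ml mr r)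
    (hlt : ∀ i < qt, que i < nL) :
    ((Finset.range nL).filter fun l => Function.update ml (par r) (r + 1) l = ml₀ l).card + 1 ≤
      ((Finset.range nL).filter fun l => ml l = ml₀ l).card := by
  obtain ⟨j, hj, hp, hR, heq⟩ := h.par
  have hpl : par r < nL := hp ▸ hlt j hj
  have hne : ml₀ (par r) ≠ r + 1 := by
    rw [hp, ← heq j le_rfl]
    intro h1
    exact (h.left _ (hlt j hj) r h1).2.2.1 rfl
  refine Finset.card_lt_card ((Finset.ssubset_iff_of_subset ?_).2 ⟨par r, ?_, ?_⟩)
  · intro l hl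
    simp only [Finset.mem_filter, Finset.mem_range] at hl ⊢
    refine ⟨hl.1, ?_⟩
    by_cases hlp : l = par r
    · subst hlp
      rw [Function.update_self] at hl
      exact absurd hl.2.symm hne
    · rw [← hl.2, Function.update_of_ne hlp]
  · simp only [Finset.mem_filter, Finset.mem_range]
    exact ⟨hpl, by rw [hp]; exact heq j le_rfl⟩
  · simp only [Finset.mem_filter, Finset.mem_range, Function.update_self, not_and]
    exact fun _ => hne.symm

end augment

/-- Augment the matching along the path that the search has found. -/
def augment : Prog :=
  assign 19 (reg 16) ;;
  loop (reg 19)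
    (assign 17 (sub (reg 19) (const 1)) ;;
      assign 18 (read 12 (reg 17)) ;;
      assign 19 (read 9 (reg 18)) ;;
      store 9 (reg 18) (add (reg 17) (const 1)) ;;
      store 10 (reg 17) (add (reg 18) (const 1)))

variable {W B : ℕ} {s : State}

theorem augment_spec (hs : Small B s) (_hB : 8 < B) (hW : B ≤ W) {nL nR v : ℕ} {R : ℕ → ℕ → Prop}
    (hnL : nL < B) (hnR : nR < B) (hM : Mates nL nR R (s.arr 9) (s.arr 10)) (hv : s.arr 9 v = 0)
    (hF : s.reg 16 ≠ 0 →
      Found nL nR R (s.arr 10) v (s.arr 12) (s.arr 13) (s.reg 14) (s.reg 16 - 1)) :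
    Wp W augment s (fun t s' => Small B s' ∧ t ≤ 50 * (nL + 1) ∧
      Mates nL nR R (s'.arr 9) (s'.arr 10) ∧
      Extends nL nR (s.arr 9) (s.arr 10) (s'.arr 9) (s'.arr 10) ∧
      (s.reg 16 = 0 → s'.arr 9 = s.arr 9 ∧ s'.arr 10 = s.arr 10) ∧
      (s.reg 16 ≠ 0 → s'.arr 9 v ≠ 0) ∧ ∀ i, nL ≤ i → s'.arr 9 i = s.arr 9 i) := by
  unfold augment
  have h16 := hs.reg 16
  simp only [wp_seq, wp_assign, Fits, eval, cost]
  refine ⟨by omega, ?_⟩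
  by_cases h0 : s.reg 16 = 0
  · refine Wp.loop (fun s' => s' = s.setReg 19 (s.reg 16)) (fun _ => 0) rfl ?_ ?_ ?_
    · rintro s' - rfl
      simp [Fits, h0]
      omega
    · rintro s' - rfl h
      simp [eval, h0] at h
    · rintro t s' - rfl - ht
      simp only [cost] at ht
      refine ⟨hs.setReg _ h16, by omega, hM, ⟨fun _ _ h => h, fun _ _ h => h⟩,
        fun _ => ⟨rfl, rfl⟩, fun h => absurd h0 h, fun _ _ => rfl⟩
  · have hF := hF h0
    refine Wp.loop (fun s' => Small B s' ∧ (∀ i, nL ≤ i → s'.arr 9 i = s.arr 9 i) ∧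
        ((s'.reg 19 ≠ 0 ∧ Augmenting nL nR R (s.arr 9) (s.arr 10) (s.arr 12) (s.arr 13) (s.reg 14)
          (s'.arr 9) (s'.arr 10) (s'.reg 19 - 1)) ∨
        (s'.reg 19 = 0 ∧ Mates nL nR R (s'.arr 9) (s'.arr 10) ∧
          Extends nL nR (s.arr 9) (s.arr 10) (s'.arr 9) (s'.arr 10) ∧ s'.arr 9 v ≠ 0)))
      -- The left vertices whose mate has not changed yet pay for the walk.
      (fun s' => 40 * ((Finset.range nL).filter fun l => s'.arr 9 l = s.arr 9 l).card)
      ?_ ?_ ?_ ?_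
    · refine ⟨hs.setReg _ h16, fun _ _ => rfl, Or.inl ⟨by simpa using h0, ?_⟩⟩
      simpa using hF.augmenting hM
    · rintro s' ha ⟨hsm, -⟩
      have := hsm.reg 19
      simp only [Fits]
      omega
    · rintro s' ha ⟨hsm, hout, hinv⟩ hne
      simp only [eval] at hne
      rcases hinv with ⟨-, hinv⟩ | ⟨h, -⟩
      swap
      · exact absurd h hne
      have c12 : s'.arr 12 = s.arr 12 := ha.arr 12 (by decide)
      have d9 := hsm.arr 9 (by decide) (s.arr 12 (s'.reg 19 - 1))
      have d12 := hsm.arr 12 (by decide) (s'.reg 19 - 1)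
      have b19 := hsm.reg 19
      have hcard := hinv.card_lt hF.lt
      have hr := hinv.lt
      have hpl : s.arr 12 (s'.reg 19 - 1) < nL := by
        obtain ⟨j, hj, hp, -⟩ := hinv.par
        exact hp ▸ hF.lt j hj
      rw [c12] at d12
      simp only [wp_seq, wp_store, wp_assign, Fits, eval, cost,
        State.reg_setArr, State.reg_setReg, State.arr_setArr, State.arr_setReg, Nat.reduceEqDiff,
        if_true, if_false, c12]
      refine ⟨by omega, by omega, by omega, by omega, by omega, ⟨?_, ?_, ?_⟩, ?_⟩
      · refine Small.setArr (Small.setArr (Small.setReg (Small.setReg (Small.setReg hsm _ ?_)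
          _ ?_) _ d9) _ _ ?_) _ _ ?_ <;> omega
      · intro i hi
        rw [Function.update_of_ne (by omega)]
        exact hout i hi
      · by_cases hx : s'.arr 9 (s.arr 12 (s'.reg 19 - 1)) = 0
        · exact Or.inr ⟨hx, hinv.finish hF hM hx⟩
        · refine Or.inl ⟨hx, hinv.step hF hM hv ?_⟩
          omega
      · omega
    · rintro t s' ha ⟨hsm, hout, hinv⟩ he ht
      simp only [eval] at he
      rcases hinv with ⟨h, -⟩ | ⟨-, h1, h2, h3⟩
      · exact absurd he h
      have hle : ((Finset.range nL).filter fun l =>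
          (s.setReg 19 (s.reg 16)).arr 9 l = s.arr 9 l).card ≤ nL :=
        (Finset.card_filter_le _ _).trans (Finset.card_range nL).le
      simp only [cost] at ht
      exact ⟨hsm, by omega, h1, h2, fun h => absurd h h0, fun _ => h3, hout⟩

end RAM

namespace RAM

open RAM.Expr RAM.Prog

/-! ### Covering all left vertices by augmentation -/

/-- Augment until all left vertices with entry `0` in array `17` are matched (then register `23` is
`0`) or a search gets stuck (then it is `1`). -/
def cover : Prog :=
  assign 22 (const 0) ;;
  assign 23 (const 0) ;;
  loop (sub (reg 4) (reg 22))
    (cond (add (read 17 (reg 22)) (read 9 (reg 22)))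
      (assign 22 (add (reg 22) (const 1)))
      (assign 12 (reg 22) ;;
        bfs ;;
        augment ;;
        cond (reg 16) (assign 22 (add (reg 22) (const 1)))
          (assign 23 (const 1) ;; assign 22 (reg 4))))

/-- The left vertices that still have to be matched. -/
def uncovered (nL : ℕ) (skip ml : ℕ → ℕ) : Finset ℕ :=
  (Finset.range nL).filter fun l => skip l = 0 ∧ ml l = 0

variable {W B : ℕ} {s : State}

/-- By `hD` no matching has more than `D` fewer uncovered vertices than the initial one. Hence at
most `D` searches succeed, and at most one gets stuck because it ends the loop. -/
theorem cover_spec (hs : Small B s) (hB : 8 < B) (hW : 2 * B ≤ W)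
    (hlt : EndsLt (s.reg 4) (s.reg 5) (s.reg 6) (s.arr 4) (s.arr 5) (s.arr 6))
    (hl : Linked (s.reg 4) (s.reg 6) (s.arr 4) (s.arr 6) (s.arr 7) (s.arr 8))
    (hM : Mates (s.reg 4) (s.reg 5) (Adj (s.reg 6) (s.arr 4) (s.arr 5) (s.arr 6)) (s.arr 9)
      (s.arr 10)) (D : ℕ)
    (hD : ∀ ml mr, Mates (s.reg 4) (s.reg 5) (Adj (s.reg 6) (s.arr 4) (s.arr 5) (s.arr 6)) ml mr →
      (uncovered (s.reg 4) (s.arr 17) (s.arr 9)).card ≤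
        (uncovered (s.reg 4) (s.arr 17) ml).card + D) :
    Wp W cover s (fun t s' => Small B s' ∧
      t ≤ (D + 2) * (160 * (s.reg 4 + s.reg 5 + s.reg 6 + 1)) ∧
      (∀ i, s.reg 4 ≤ i → s'.arr 9 i = s.arr 9 i) ∧
      Mates (s.reg 4) (s.reg 5) (Adj (s.reg 6) (s.arr 4) (s.arr 5) (s.arr 6)) (s'.arr 9)
        (s'.arr 10) ∧
      Extends (s.reg 4) (s.reg 5) (s.arr 9) (s.arr 10) (s'.arr 9) (s'.arr 10) ∧
      (s'.reg 23 = 0 → ∀ l < s.reg 4, s.arr 17 l = 0 → s'.arr 9 l ≠ 0) ∧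
      (s'.reg 23 ≠ 0 → ∃ v < s.reg 4, s.arr 17 v = 0 ∧ s'.arr 9 v = 0 ∧
        Stuck (s.reg 4) (s.reg 5) (Adj (s.reg 6) (s.arr 4) (s.arr 5) (s.arr 6)) (s'.arr 10) v
          (s'.arr 13) (s'.reg 14))) := by
  unfold cover
  set T := 160 * (s.reg 4 + s.reg 5 + s.reg 6 + 1) with hT
  set F : (ℕ → ℕ) → ℕ := fun ml => (uncovered (s.reg 4) (s.arr 17) ml).card with hF
  simp only [wp_seq, wp_assign, Fits, eval, cost]
  refine ⟨by omega, by omega, ?_⟩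
  have hD' : ∀ ml mr, Mates (s.reg 4) (s.reg 5) (Adj (s.reg 6) (s.arr 4) (s.arr 5) (s.arr 6))
      ml mr → F (s.arr 9) ≤ F ml + D := hD
  refine Wp.loop (fun s' => Small B s' ∧ s'.reg 22 ≤ s.reg 4 ∧
      (∀ i, s.reg 4 ≤ i → s'.arr 9 i = s.arr 9 i) ∧
      Mates (s.reg 4) (s.reg 5) (Adj (s.reg 6) (s.arr 4) (s.arr 5) (s.arr 6)) (s'.arr 9)
        (s'.arr 10) ∧
      Linked (s.reg 4) (s.reg 6) (s.arr 4) (s.arr 6) (s'.arr 7) (s'.arr 8) ∧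
      Extends (s.reg 4) (s.reg 5) (s.arr 9) (s.arr 10) (s'.arr 9) (s'.arr 10) ∧
      ((s'.reg 23 = 0 ∧ ∀ l < s'.reg 22, s.arr 17 l = 0 → s'.arr 9 l ≠ 0) ∨
        (s'.reg 23 ≠ 0 ∧ s'.reg 22 = s.reg 4 ∧ ∃ v < s.reg 4, s.arr 17 v = 0 ∧ s'.arr 9 v = 0 ∧
        Stuck (s.reg 4) (s.reg 5) (Adj (s.reg 6) (s.arr 4) (s.arr 5) (s.arr 6)) (s'.arr 10) v
          (s'.arr 13) (s'.reg 14))))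
    -- The three terms pay for advancing the index, for successful searches, and for the single
    -- stuck one. The truncated subtraction is harmless by `hD'`.
    (fun s' => 20 * (s.reg 4 - s'.reg 22) + (F (s'.arr 9) + D - F (s.arr 9)) * T +
      if s'.reg 23 = 0 then T else 0)
    ?_ ?_ ?_ ?_
  · refine ⟨(hs.setReg _ (by omega)).setReg _ (by omega), by simp, fun _ _ => rfl, hM, hl,
      ⟨fun _ _ h => h, fun _ _ h => h⟩, Or.inl ⟨by simp, ?_⟩⟩
    intro l hl
    simp at hl
  · rintro s' ha ⟨hsm, -⟩
    have := hsm.reg 4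
    have := hsm.reg 22
    simp only [Fits]
    omega
  · rintro s' ha ⟨hsm, h22, hout, hMs, hls, hex, hinv⟩ hne
    have e4 : s'.reg 4 = s.reg 4 := (ha.reg 4 (by decide)).trans (by simp)
    have e5 : s'.reg 5 = s.reg 5 := (ha.reg 5 (by decide)).trans (by simp)
    have e6 : s'.reg 6 = s.reg 6 := (ha.reg 6 (by decide)).trans (by simp)
    have c4 : s'.arr 4 = s.arr 4 := ha.arr 4 (by decide)
    have c5 : s'.arr 5 = s.arr 5 := ha.arr 5 (by decide)
    have c6 : s'.arr 6 = s.arr 6 := ha.arr 6 (by decide)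
    have c17 : s'.arr 17 = s.arr 17 := ha.arr 17 (by decide)
    have d17 := hsm.arr 17 (by decide) (s'.reg 22)
    have d9 := hsm.arr 9 (by decide) (s'.reg 22)
    have b22 := hsm.reg 22
    have b4 := hsm.reg 4
    have b5 := hsm.reg 5
    simp only [eval, e4] at hne
    rcases hinv with ⟨h23, hinv⟩ | ⟨-, h, -⟩
    swap
    · omega
    rw [wp_cond]
    refine ⟨?_, ?_, ?_⟩
    · simp only [Fits, eval]
      omega
    · intro h0
      simp only [eval, c17] at h0
      simp only [wp_assign, Fits, eval, cost, State.reg_setReg, State.arr_setReg, Nat.reduceEqDiff,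
        if_true, if_false, h23]
      refine ⟨by omega, ⟨hsm.setReg _ (by omega), by omega, hout, hMs, hls, hex,
        Or.inl ⟨trivial, ?_⟩⟩, by omega⟩
      intro l hl' hs0
      rcases Nat.lt_succ_iff_lt_or_eq.1 hl' with h1 | rfl
      · exact hinv l h1 hs0
      · omega
    · intro h0
      simp only [eval, c17] at h0
      rw [wp_seq, wp_assign]
      refine ⟨by simp only [Fits]; omega, ?_⟩
      rw [wp_seq]
      set s1 := s'.setReg 12 (Expr.eval s' (reg 22)) with hs1
      have hsm1 : Small B s1 := hsm.setReg _ (hsm.reg 22)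
      have f4 : s1.reg 4 = s.reg 4 := by simp [hs1, e4]
      have f5 : s1.reg 5 = s.reg 5 := by simp [hs1, e5]
      have f6 : s1.reg 6 = s.reg 6 := by simp [hs1, e6]
      have f12 : s1.reg 12 = s'.reg 22 := by simp [hs1, eval]
      have f22 : s1.reg 22 = s'.reg 22 := by simp [hs1, eval]
      have f23 : s1.reg 23 = 0 := by simp [hs1, h23]
      have g : s1.arr = s'.arr := rfl
      have hbfs := bfs_spec (s := s1) hsm1 hB (by omega : B ≤ W)
        (by rw [f4, f5, f6, g, c4, c5, c6]; exact hlt) (by rw [f4, f6, g, c4, c6]; exact hls)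
        (by rw [f4, f5, f6, g, c4, c5, c6]; exact hMs) (by omega) (by rw [f12, g]; omega)
      rw [f4, f5, f6, f12, g, c4, c5, c6] at hbfs
      refine hbfs.mono ?_
      rintro t2 s2 ha2 ⟨hsm2, ht2, hst, hfo⟩
      have k4 : s2.reg 4 = s.reg 4 := (ha2.reg 4 (by decide)).trans f4
      have k22 : s2.reg 22 = s'.reg 22 := (ha2.reg 22 (by decide)).trans f22
      have k23 : s2.reg 23 = 0 := (ha2.reg 23 (by decide)).trans f23
      have k7 : s2.arr 7 = s'.arr 7 := ha2.arr 7 (by decide)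
      have k8 : s2.arr 8 = s'.arr 8 := ha2.arr 8 (by decide)
      have k9 : s2.arr 9 = s'.arr 9 := ha2.arr 9 (by decide)
      have k10 : s2.arr 10 = s'.arr 10 := ha2.arr 10 (by decide)
      rw [wp_seq]
      refine (augment_spec (s := s2) hsm2 hB (by omega : B ≤ W) (nL := s.reg 4) (nR := s.reg 5)
        (v := s'.reg 22) (by omega) (by omega) (by rw [k9, k10]; exact hMs) (by rw [k9]; omega)
        (by rw [k10]; exact hfo)).mono ?_
      rintro t3 s3 ha3 ⟨hsm3, ht3, hM3, hex3, hno, hyes, hout3⟩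
      have l4 : s3.reg 4 = s.reg 4 := (ha3.reg 4 (by decide)).trans k4
      have l22 : s3.reg 22 = s'.reg 22 := (ha3.reg 22 (by decide)).trans k22
      have l23 : s3.reg 23 = 0 := (ha3.reg 23 (by decide)).trans k23
      have l16 : s3.reg 16 = s2.reg 16 := ha3.reg 16 (by decide)
      have l14 : s3.reg 14 = s2.reg 14 := ha3.reg 14 (by decide)
      have l7 : s3.arr 7 = s'.arr 7 := (ha3.arr 7 (by decide)).trans k7
      have l8 : s3.arr 8 = s'.arr 8 := (ha3.arr 8 (by decide)).trans k8
      have l13 : s3.arr 13 = s2.arr 13 := ha3.arr 13 (by decide)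
      rw [k9, k10] at hex3 hno
      rw [k9] at hout3
      have hexs : Extends (s.reg 4) (s.reg 5) (s.arr 9) (s.arr 10) (s3.arr 9) (s3.arr 10) :=
        ⟨fun l hl h => hex3.1 l hl (hex.1 l hl h), fun r hr h => hex3.2 r hr (hex.2 r hr h)⟩
      have hmono : ∀ l < s.reg 4, s3.arr 9 l = 0 → s'.arr 9 l = 0 := fun l hl h3 => by
        by_contra h4
        exact hex3.1 l hl h4 h3
      have hb16 := hsm3.reg 16
      have hb22 := hsm3.reg 22
      have hb4 := hsm3.reg 4
      have hF0 := hD' _ _ hM3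
      simp only [wp_cond, wp_seq, wp_assign, Fits, eval, cost, State.reg_setReg, State.arr_setReg,
        Nat.reduceEqDiff, if_true, if_false, h23, l22, l23, l7, l8, l4]
      refine ⟨by omega, ?_, ?_⟩
      · intro h16
        rw [l16] at h16
        have hcov := hyes h16
        refine ⟨by omega, ⟨hsm3.setReg _ (by omega), by omega, ?_, hM3, hls, hexs,
          Or.inl ⟨trivial, ?_⟩⟩, ?_⟩
        · intro i hi
          rw [hout3 i hi, hout i hi]
        · intro l hl' hs0
          rcases Nat.lt_succ_iff_lt_or_eq.1 hl' with h1 | rfl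
          · exact hex3.1 l (by omega) (hinv l h1 hs0)
          · exact hcov
        · have hlt' : F (s3.arr 9) + 1 ≤ F (s'.arr 9) := by
            refine Finset.card_lt_card ((Finset.ssubset_iff_of_subset ?_).2 ⟨s'.reg 22, ?_, ?_⟩)
            · intro l hl'
              simp only [uncovered, Finset.mem_filter, Finset.mem_range] at hl' ⊢
              exact ⟨hl'.1, hl'.2.1, hmono l hl'.1 hl'.2.2⟩
            · simp only [uncovered, Finset.mem_filter, Finset.mem_range]
              omega
            · simp only [uncovered, Finset.mem_filter, Finset.mem_range, not_and]
              exact fun _ _ => hcov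
          have hmul := Nat.mul_le_mul_right T (show F (s3.arr 9) + D - F (s.arr 9) + 1 ≤
            F (s'.arr 9) + D - F (s.arr 9) by omega)
          rw [Nat.add_mul, Nat.one_mul] at hmul
          omega
      · intro h16
        rw [l16] at h16
        obtain ⟨h9, h10⟩ := hno h16
        refine ⟨by omega, by omega, ⟨(hsm3.setReg _ (by omega)).setReg _ (by omega), le_rfl, ?_,
          hM3, hls, hexs, Or.inr ⟨one_ne_zero, trivial, s'.reg 22, by omega, by omega, ?_, ?_⟩⟩, ?_⟩
        · intro i hi
          rw [hout3 i hi, hout i hi]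
        · rw [h9]
          omega
        · rw [h10, l13, l14]
          exact hst h16
        · rw [h9]
          omega
  · rintro t s' ha ⟨hsm, h22, hout, hMs, hls, hex, hinv⟩ he ht
    have e4 : s'.reg 4 = s.reg 4 := (ha.reg 4 (by decide)).trans (by simp)
    simp only [eval, e4] at he
    have h22' : s'.reg 22 = s.reg 4 := by omega
    refine ⟨hsm, ?_, hout, hMs, hex, ?_, ?_⟩
    · simp only [cost, State.reg_setReg, State.arr_setReg, Nat.reduceEqDiff, if_true, if_false,
        Nat.add_sub_cancel_left] at ht
      rw [Nat.add_mul]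
      omega
    · intro h0
      rcases hinv with ⟨-, h⟩ | ⟨h, -⟩
      · exact h22' ▸ h
      · exact absurd h0 h
    · intro h0
      rcases hinv with ⟨h, -⟩ | ⟨-, -, h⟩
      · exact absurd h h0
      · exact h

end RAM

namespace RAM

open RAM.Expr RAM.Prog

/-! ### An almost maximum matching by an auction with bounded prices -/

/-- The invariant of the auction: the right vertices have prices, and left vertex `l` bids for
neighbours of price `lev l`; all edges at `l` from `ptr l` on have been scanned at this level. The
left vertex `b - 1` is about to bid. -/
structure Auction (nL nR N : ℕ) (src tgt flag : ℕ → ℕ) (K : ℕ) (skip price lev ptr ml mr : ℕ → ℕ)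
    (l₀ b : ℕ) : Prop where
  mates : Mates nL nR (Adj N src tgt flag) ml mr
  priced : ∀ r < nR, price r ≠ 0 → mr r ≠ 0
  price_le : ∀ r < nR, price r ≤ K
  lev_le : ∀ l < nL, lev l ≤ K
  nbr : ∀ e < N, flag e ≠ 0 → lev (src e) ≤ price (tgt e)
  scanned : ∀ e < N, flag e ≠ 0 → lev (src e) < K → ptr (src e) ≤ e →
    lev (src e) + 1 ≤ price (tgt e)
  ptr_ok : ∀ l < nL, ptr l ≠ 0 → ptr l ≤ N ∧ EdgeFrom src flag l (ptr l - 1)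
  matched : ∀ l < nL, ∀ r, ml l = r + 1 → price r = lev l + 1
  free : ∀ l < l₀, skip l = 0 → ml l = 0 → l + 1 ≠ b → K ≤ lev l
  fresh : ∀ l < nL, l₀ ≤ l → ml l = 0 ∧ lev l = 0
  active : b ≠ 0 → b - 1 < l₀ ∧ ml (b - 1) = 0 ∧ lev (b - 1) < K
  le : l₀ ≤ nL

/-- The potential of the auction. -/
def auctionPot (nL nR N : ℕ) (src : ℕ → ℕ) (K : ℕ) (price lev ptr : ℕ → ℕ) (l₀ : ℕ) : ℕ :=
  ∑ e ∈ Finset.range N, (K - lev (src e) - if ptr (src e) ≤ e then 1 else 0) +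
    ∑ l ∈ Finset.range nL, (K - lev l) + ∑ r ∈ Finset.range nR, (K - price r) + (nL - l₀)

section auction

variable {nL nR N K : ℕ} {src tgt flag head next skip price lev ptr ml mr : ℕ → ℕ} {l₀ b : ℕ}

theorem auction_init (hl : Linked nL N src flag head next) (hprice : ∀ r < nR, price r = 0)
    (hmr : ∀ r < nR, mr r = 0) (hml : ∀ l < nL, ml l = 0) (hlev : ∀ l < nL, lev l = 0)
    (hptr : ∀ l < nL, ptr l = head l) (hlt : EndsLt nL nR N src tgt flag) :
    Auction nL nR N src tgt flag K skip price lev ptr ml mr 0 0 where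
  mates := ⟨fun l h r h' => absurd (hml l h) (by omega),
    fun r h l h' => absurd (hmr r h) (by omega)⟩
  priced := fun r hr h => absurd (hprice r hr) h
  price_le := fun r hr => by rw [hprice r hr]; exact Nat.zero_le _
  lev_le := fun l h => by rw [hlev l h]; exact Nat.zero_le _
  nbr := fun e he hf => by rw [hlev _ (hlt e he hf).1]; exact Nat.zero_le _
  scanned := fun e he hf _ hp => by
    rw [hptr _ (hlt e he hf).1] at hp
    have := (hl.head _ (hlt e he hf).1).lt e ⟨hf, rfl⟩ he
    omega
  ptr_ok := fun l h h0 => by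
    rw [hptr l h] at h0 ⊢
    exact ⟨(hl.head l h).le, (hl.head l h).prop h0⟩
  matched := fun l h r h' => absurd (hml l h) (by omega)
  free := fun l h => absurd h (Nat.not_lt_zero _)
  fresh := fun l h _ => ⟨hml l h, hlev l h⟩
  active := fun h => absurd rfl h
  le := Nat.zero_le _

/-- A new left vertex enters at level `0`; it starts to bid only if it is not to be skipped. -/
theorem Auction.enter (h : Auction nL nR N src tgt flag K skip price lev ptr ml mr l₀ 0)
    (hl₀ : l₀ < nL) (hK : 0 < K) {b' : ℕ} (hb' : b' = if skip l₀ = 0 then l₀ + 1 else 0) :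
    Auction nL nR N src tgt flag K skip price lev ptr ml mr (l₀ + 1) b' := by
  obtain ⟨h1, h2⟩ := h.fresh l₀ hl₀ le_rfl
  refine { h with
    free := fun l hl hs hm hb => ?_
    fresh := fun l hl hl' => h.fresh l hl (by omega)
    active := fun hb => ?_
    le := hl₀ }
  · rcases Nat.lt_succ_iff_lt_or_eq.1 hl with h3 | rfl
    · exact h.free l h3 hs hm (Nat.succ_ne_zero _)
    · rw [if_pos hs] at hb'
      exact absurd hb'.symm hb
  · split_ifs at hb' with h3
    · subst hb'
      exact ⟨Nat.lt_succ_self _, h1, by simpa [h2] using hK⟩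
    · exact absurd hb' hb

theorem Auction.active_lt (h : Auction nL nR N src tgt flag K skip price lev ptr ml mr l₀ b)
    (hb : b ≠ 0) : b - 1 < nL :=
  (h.active hb).1.trans_le h.le

theorem Auction.skip_edge (h : Auction nL nR N src tgt flag K skip price lev ptr ml mr l₀ b)
    (hl : Linked nL N src flag head next) (hb : b ≠ 0) (hx : ptr (b - 1) ≠ 0)
    (hp : lev (b - 1) < price (tgt (ptr (b - 1) - 1))) :
    Auction nL nR N src tgt flag K skip price lev
      (Function.update ptr (b - 1) (next (ptr (b - 1) - 1))) ml mr l₀ b := by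
  have hbl := h.active_lt hb
  obtain ⟨hxN, he⟩ := h.ptr_ok _ hbl hx
  refine { h with
    scanned := fun e heN hf hK hpe => ?_
    ptr_ok := fun l hlL h0 => ?_ }
  · by_cases hs : src e = b - 1
    · rw [hs, Function.update_self] at hpe
      refine hl.scan (P := fun e => lev (src e) + 1 ≤ price (tgt e)) hx hxN he ?_
        (fun e heN h1 h2 => ?_) e heN ⟨hf, hs⟩ hpe
      · rw [he.2]
        exact hp
      · exact h.scanned e heN h1.1 (by rw [h1.2, ← hs]; exact hK) (by rw [h1.2]; exact h2)
    · rw [Function.update_of_ne hs] at hpe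
      exact h.scanned e heN hf hK hpe
  · by_cases hs : l = b - 1
    · subst hs
      rw [Function.update_self] at h0 ⊢
      exact hl.ptr_next hx hxN he h0
    · rw [Function.update_of_ne hs] at h0 ⊢
      exact h.ptr_ok l hlL h0

/-- The edge at the pointer becomes scanned for the current level, and its summand drops by one. -/
theorem Auction.pot_skip (h : Auction nL nR N src tgt flag K skip price lev ptr ml mr l₀ b)
    (hl : Linked nL N src flag head next) (hb : b ≠ 0) (hx : ptr (b - 1) ≠ 0) :
    auctionPot nL nR N src K price lev
      (Function.update ptr (b - 1) (next (ptr (b - 1) - 1))) l₀ + 1 ≤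
    auctionPot nL nR N src K price lev ptr l₀ := by
  have hbl := h.active_lt hb
  obtain ⟨hxN, he⟩ := h.ptr_ok _ hbl hx
  have hle := (hl.next _ (show ptr (b - 1) - 1 < N by omega) he.1).le
  have hK := (h.active hb).2.2
  have : ∑ e ∈ Finset.range N, (K - lev (src e) -
      if Function.update ptr (b - 1) (next (ptr (b - 1) - 1)) (src e) ≤ e then 1 else 0) <
      ∑ e ∈ Finset.range N, (K - lev (src e) - if ptr (src e) ≤ e then 1 else 0) := by
    refine Finset.sum_lt_sum (fun e _ => ?_) ⟨ptr (b - 1) - 1, Finset.mem_range.2 (by omega), ?_⟩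
    · by_cases hs : src e = b - 1
      · rw [hs, Function.update_self]
        split_ifs <;> omega
      · rw [Function.update_of_ne hs]
    · rw [he.2, Function.update_self, if_pos hle, if_neg (by omega)]
      omega
  unfold auctionPot
  omega

/-- An exhausted list means that all neighbours cost at least `lev + 1`, so the level may rise.
Below `K` the scan restarts from the head; at `K` the vertex gives up and nobody bids. -/
theorem Auction.raise (h : Auction nL nR N src tgt flag K skip price lev ptr ml mr l₀ b)
    (hl : Linked nL N src flag head next) (hb : b ≠ 0) (hx : ptr (b - 1) = 0)
    {ptr' : ℕ → ℕ} {b' : ℕ}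
    (hK : lev (b - 1) + 1 < K → b' = b ∧ ptr' = Function.update ptr (b - 1) (head (b - 1)))
    (hK' : lev (b - 1) + 1 = K → b' = 0 ∧ ptr' = ptr) :
    Auction nL nR N src tgt flag K skip price (Function.update lev (b - 1) (lev (b - 1) + 1)) ptr'
      ml mr l₀ b' := by
  have hbl := h.active_lt hb
  obtain ⟨hb0, hbm, hbK⟩ := h.active hb
  have hptr' : ∀ l, l ≠ b - 1 → ptr' l = ptr l := by
    intro l hl
    rcases Nat.lt_or_ge (lev (b - 1) + 1) K with h1 | h1
    · rw [(hK h1).2, Function.update_of_ne hl]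
    · rw [(hK' (by omega)).2]
  refine { h with
    lev_le := fun l hlL => ?_
    nbr := fun e he hf => ?_
    scanned := fun e he hf hlK hp => ?_
    ptr_ok := fun l hlL h0 => ?_
    matched := fun l hlL r hm => ?_
    free := fun l hl0 hs hm hbb => ?_
    fresh := fun l hlL h0 => ?_
    active := fun h0 => ?_ }
  · rw [Function.update_apply]
    split_ifs
    exacts [hbK, h.lev_le l hlL]
  · by_cases hs : src e = b - 1
    · rw [hs, Function.update_self, ← hs]
      exact h.scanned e he hf (hs ▸ hbK) (by rw [hs, hx]; exact Nat.zero_le _)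
    · rw [Function.update_of_ne hs]
      exact h.nbr e he hf
  · by_cases hs : src e = b - 1
    · rw [hs, Function.update_self] at hlK
      rw [hs, (hK hlK).2, Function.update_self] at hp
      have := (hl.head _ hbl).lt e ⟨hf, hs⟩ he
      omega
    · rw [Function.update_of_ne hs] at hlK ⊢
      rw [hptr' _ hs] at hp
      exact h.scanned e he hf hlK hp
  · by_cases hs : l = b - 1
    · subst hs
      rcases Nat.lt_or_ge (lev (b - 1) + 1) K with h1 | h1
      · rw [(hK h1).2, Function.update_self] at h0 ⊢
        exact ⟨(hl.head _ hbl).le, (hl.head _ hbl).prop h0⟩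
      · rw [(hK' (by omega)).2] at h0
        exact absurd hx h0
    · rw [hptr' l hs] at h0 ⊢
      exact h.ptr_ok l hlL h0
  · rw [Function.update_of_ne]
    · exact h.matched l hlL r hm
    · rintro rfl
      rw [hbm] at hm
      cases hm
  · by_cases hlb : l = b - 1
    · subst hlb
      rw [Function.update_self]
      by_contra h1
      have := (hK (by omega)).1
      omega
    · rw [Function.update_of_ne hlb]
      exact h.free l hl0 hs hm (by omega)
  · rw [Function.update_of_ne (by omega)]
    exact h.fresh l hlL h0
  · rcases Nat.lt_or_ge (lev (b - 1) + 1) K with h1 | h1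
    · rw [(hK h1).1, Function.update_self]
      exact ⟨hb0, hbm, h1⟩
    · exact absurd (hK' (by omega)).1 h0

/-- Restarting the scan is free: before the raise all edges of the bidder were discounted as
scanned, and the higher level discounts them by the same one. -/
theorem Auction.pot_raise (h : Auction nL nR N src tgt flag K skip price lev ptr ml mr l₀ b)
    (hb : b ≠ 0) (hx : ptr (b - 1) = 0) {ptr' : ℕ → ℕ}
    (hptr' : ∀ l, l ≠ b - 1 → ptr' l = ptr l) :
    auctionPot nL nR N src K price (Function.update lev (b - 1) (lev (b - 1) + 1)) ptr' l₀ + 1 ≤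
      auctionPot nL nR N src K price lev ptr l₀ := by
  have hbl := h.active_lt hb
  have hK := (h.active hb).2.2
  have h1 : ∑ e ∈ Finset.range N, (K - Function.update lev (b - 1) (lev (b - 1) + 1) (src e) -
      if ptr' (src e) ≤ e then 1 else 0) ≤
      ∑ e ∈ Finset.range N, (K - lev (src e) - if ptr (src e) ≤ e then 1 else 0) := by
    refine Finset.sum_le_sum fun e _ => ?_
    by_cases hs : src e = b - 1
    · rw [hs, Function.update_self, hx, if_pos (Nat.zero_le _)]
      omega
    · rw [Function.update_of_ne hs, hptr' _ hs]
  have h2 : ∑ l ∈ Finset.range nL, (K - Function.update lev (b - 1) (lev (b - 1) + 1) l) <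
      ∑ l ∈ Finset.range nL, (K - lev l) := by
    refine Finset.sum_lt_sum (fun l _ => ?_) ⟨b - 1, Finset.mem_range.2 hbl, ?_⟩
    · rw [Function.update_apply]
      split_ifs with hs
      · rw [hs]
        omega
      · exact le_rfl
    · rw [Function.update_self]
      omega
  unfold auctionPot
  omega

/-- The evicted owner `mr r` becomes the next bidder, with `0` for none. It is still below level
`K`, since the price it had paid, its level plus one, is at most `K`. Prices only increase, so what
is known about scanned edges persists. -/
theorem Auction.take (h : Auction nL nR N src tgt flag K skip price lev ptr ml mr l₀ b)
    (hlt : EndsLt nL nR N src tgt flag) (hb : b ≠ 0) (hx : ptr (b - 1) ≠ 0) {r : ℕ}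
    (hr : r = tgt (ptr (b - 1) - 1)) (hp : price r ≤ lev (b - 1)) {ml' : ℕ → ℕ}
    (hml' : ∀ l < nL, ml' l = if ml l = r + 1 then 0 else ml l) :
    Auction nL nR N src tgt flag K skip (Function.update price r (lev (b - 1) + 1)) lev ptr
      (Function.update ml' (b - 1) (r + 1)) (Function.update mr r (b - 1 + 1)) l₀ (mr r) := by
  have hbl := h.active_lt hb
  obtain ⟨hb0, hbm, hbK⟩ := h.active hb
  obtain ⟨hxN, he⟩ := h.ptr_ok _ hbl hx
  have heN : ptr (b - 1) - 1 < N := by omega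
  have hrn : r < nR := hr ▸ (hlt _ heN he.1).2
  have hadj : Adj N src tgt flag (b - 1) r := ⟨_, heN, he, hr.symm⟩
  have hother : ∀ l < nL, l ≠ b - 1 → ∀ r', Function.update ml' (b - 1) (r + 1) l = r' + 1 →
      ml l = r' + 1 ∧ r' ≠ r := by
    intro l hlL hne r' h1
    rw [Function.update_of_ne hne, hml' l hlL] at h1
    split_ifs at h1 with h2
    refine ⟨h1, ?_⟩
    rintro rfl
    exact h2 h1
  have hup : ∀ r', price r' ≤ Function.update price r (lev (b - 1) + 1) r' := by
    intro r'
    rw [Function.update_apply]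
    split_ifs with h1
    · rw [h1]
      omega
    · exact le_rfl
  refine { h with
    mates := ⟨fun l hlL r' h1 => ?_, fun r' hr' l h1 => ?_⟩
    priced := fun r' hr' h1 => ?_
    price_le := fun r' hr' => ?_
    nbr := fun e he' hf => (h.nbr e he' hf).trans (hup _)
    scanned := fun e he' hf hK hpe => (h.scanned e he' hf hK hpe).trans (hup _)
    matched := fun l hlL r' h1 => ?_
    free := fun l hl0 hs hm hbb => ?_
    fresh := fun l hlL h0 => ?_
    active := fun h0 => ?_ }
  · by_cases hlb : l = b - 1
    · subst hlb
      rw [Function.update_self] at h1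
      obtain rfl : r = r' := by omega
      exact ⟨hrn, hadj, Function.update_self ..⟩
    · obtain ⟨h2, h3⟩ := hother l hlL hlb r' h1
      obtain ⟨h4, h5, h6⟩ := h.mates.left l hlL r' h2
      exact ⟨h4, h5, by rw [Function.update_of_ne h3, h6]⟩
  · by_cases hrr : r' = r
    · subst hrr
      rw [Function.update_self] at h1
      obtain rfl : b - 1 = l := by omega
      exact ⟨hbl, Function.update_self ..⟩
    · rw [Function.update_of_ne hrr] at h1
      obtain ⟨h2, h3⟩ := h.mates.right r' hr' l h1
      refine ⟨h2, ?_⟩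
      rw [Function.update_of_ne, hml' l h2, if_neg, h3]
      · omega
      · rintro rfl
        rw [hbm] at h3
        cases h3
  · by_cases hrr : r' = r
    · subst hrr
      rw [Function.update_self]
      exact Nat.succ_ne_zero _
    · rw [Function.update_of_ne hrr] at h1 ⊢
      exact h.priced r' hr' h1
  · rw [Function.update_apply]
    split_ifs
    exacts [hbK, h.price_le r' hr']
  · by_cases hlb : l = b - 1
    · subst hlb
      rw [Function.update_self] at h1
      obtain rfl : r = r' := by omega
      rw [Function.update_self]
    · obtain ⟨h2, h3⟩ := hother l hlL hlb r' h1
      rw [Function.update_of_ne h3]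
      exact h.matched l hlL r' h2
  · have hlL : l < nL := hl0.trans_le h.le
    by_cases hlb : l = b - 1
    · subst hlb
      rw [Function.update_self] at hm
      cases hm
    · rw [Function.update_of_ne hlb, hml' l hlL] at hm
      split_ifs at hm with h1
      · exact absurd (h.mates.left l hlL r h1).2.2.symm hbb
      · exact h.free l hl0 hs hm (by omega)
  · obtain ⟨h1, h2⟩ := h.fresh l hlL h0
    refine ⟨?_, h2⟩
    rw [Function.update_of_ne (by omega), hml' l hlL, h1]
    split_ifs <;> rfl
  · obtain ⟨l, hl'⟩ := Nat.exists_eq_succ_of_ne_zero h0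
    obtain ⟨h1, h2⟩ := h.mates.right r hrn l hl'
    rw [hl', Nat.succ_sub_one]
    have h3 := h.matched l h1 r h2
    have h4 := h.price_le r hrn
    have hlb : l ≠ b - 1 := by
      rintro rfl
      rw [hbm] at h2
      cases h2
    refine ⟨?_, ?_, by omega⟩
    · by_contra h5
      rw [(h.fresh l h1 (by omega)).1] at h2
      cases h2
    · rw [Function.update_of_ne hlb, hml' l h1, if_pos h2]

theorem Auction.pot_take (h : Auction nL nR N src tgt flag K skip price lev ptr ml mr l₀ b)
    (hb : b ≠ 0) {r : ℕ} (hr : r < nR) (hp : price r ≤ lev (b - 1)) :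
    auctionPot nL nR N src K (Function.update price r (lev (b - 1) + 1)) lev ptr l₀ + 1 ≤
      auctionPot nL nR N src K price lev ptr l₀ := by
  have hK := (h.active hb).2.2
  have : ∑ r' ∈ Finset.range nR, (K - Function.update price r (lev (b - 1) + 1) r') <
      ∑ r ∈ Finset.range nR, (K - price r) := by
    refine Finset.sum_lt_sum (fun r' _ => ?_) ⟨r, Finset.mem_range.2 hr, ?_⟩
    · rw [Function.update_apply]
      split_ifs with hs
      · rw [hs]
        omega
      · exact le_rfl
    · rw [Function.update_self]
      omega
  unfold auctionPot
  omega

theorem auctionPot_le : auctionPot nL nR N src K price lev ptr l₀ ≤ (N + nL + nR) * K + nL := by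
  have h1 : ∑ e ∈ Finset.range N, (K - lev (src e) - if ptr (src e) ≤ e then 1 else 0) ≤ N * K := by
    refine (Finset.sum_le_card_nsmul _ _ K fun e _ => ?_).trans (by simp)
    omega
  have h2 : ∑ l ∈ Finset.range nL, (K - lev l) ≤ nL * K :=
    (Finset.sum_le_card_nsmul _ _ K fun e _ => Nat.sub_le _ _).trans (by simp)
  have h3 : ∑ r ∈ Finset.range nR, (K - price r) ≤ nR * K :=
    (Finset.sum_le_card_nsmul _ _ K fun e _ => Nat.sub_le _ _).trans (by simp)
  unfold auctionPot
  rw [Nat.add_mul, Nat.add_mul]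
  omega

/-- Compared with any other matching, the auction leaves few more left vertices unmatched, because
one of the price levels is thin. -/
theorem Auction.card_uncovered_le
    (h : Auction nL nR N src tgt flag K skip price lev ptr ml mr nL 0)
    (hskip : ∀ e < N, flag e ≠ 0 → skip (src e) = 0) (hK : 0 < K) (hnR : nR ≤ K * K)
    {ml' mr' : ℕ → ℕ} (hM : Mates nL nR (Adj N src tgt flag) ml' mr') :
    (uncovered nL skip ml).card ≤ (uncovered nL skip ml').card + K := by
  classical
  set F := uncovered nL skip ml with hF
  set F' := uncovered nL skip ml' with hF'
  let Q : ℕ → Finset ℕ := fun j => (Finset.range nR).filter fun r => j ≤ price r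
  -- Unmatched vertices and owners of objects of price above `j` see only prices at least `j`.
  -- Another matching can therefore serve them only with `Q j`, except for those it leaves
  -- uncovered.
  have hstep : ∀ j, 1 ≤ j → j ≤ K → F.card + (Q (j + 1)).card ≤ F'.card + (Q j).card := by
    intro j hj1 hjK
    let L : Finset ℕ := (Q (j + 1)).image fun r => mr r - 1
    have hL : ∀ l ∈ L, ∃ r < nR, j + 1 ≤ price r ∧ l < nL ∧ ml l = r + 1 := by
      intro l hl
      simp only [L, Q, Finset.mem_image, Finset.mem_filter, Finset.mem_range] at hl
      obtain ⟨r, ⟨hr, hp⟩, rfl⟩ := hl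
      obtain ⟨l, hl⟩ := Nat.exists_eq_succ_of_ne_zero (h.priced r hr (by omega))
      obtain ⟨h1, h2⟩ := h.mates.right r hr l hl
      rw [hl, Nat.succ_sub_one]
      exact ⟨r, hr, hp, h1, h2⟩
    have hLcard : L.card = (Q (j + 1)).card := by
      refine Finset.card_image_of_injOn ?_
      intro r hr r' hr' he
      simp only [Q, Finset.coe_filter, Finset.mem_range, Set.mem_ofPred_eq] at hr hr'
      obtain ⟨l, hl⟩ := Nat.exists_eq_succ_of_ne_zero (h.priced r hr.1 (by omega))
      obtain ⟨l', hl'⟩ := Nat.exists_eq_succ_of_ne_zero (h.priced r' hr'.1 (by omega))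
      simp only [hl, hl', Nat.succ_sub_one] at he
      subst he
      have h1 := (h.mates.right r hr.1 l hl).2
      have h2 := (h.mates.right r' hr'.1 l hl').2
      omega
    have hdisj : Disjoint F L := by
      rw [Finset.disjoint_left]
      intro l hl hl'
      obtain ⟨r, -, -, -, h1⟩ := hL l hl'
      simp only [hF, uncovered, Finset.mem_filter] at hl
      omega
    have hsub : F ∪ L ⊆ F' ∪ (Q j).image fun r => mr' r - 1 := by
      intro l hl
      have hprop : l < nL ∧ skip l = 0 ∧ ∀ r, Adj N src tgt flag l r → j ≤ price r := by
        rcases Finset.mem_union.1 hl with hl | hl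
        · simp only [hF, uncovered, Finset.mem_filter, Finset.mem_range] at hl
          refine ⟨hl.1, hl.2.1, ?_⟩
          rintro r ⟨e, he, ⟨hf, rfl⟩, rfl⟩
          have h1 := h.free _ hl.1 hl.2.1 hl.2.2 (Nat.succ_ne_zero _)
          have h2 := h.nbr e he hf
          omega
        · obtain ⟨r, hr, hp, hlL, hm⟩ := hL l hl
          obtain ⟨-, ⟨e, he, ⟨hf, hs⟩, ht⟩, -⟩ := h.mates.left l hlL r hm
          refine ⟨hlL, hs ▸ hskip e he hf, ?_⟩
          rintro r' ⟨e', he', ⟨hf', rfl⟩, rfl⟩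
          have h1 := h.matched _ hlL r hm
          have h2 := h.nbr e' he' hf'
          omega
      obtain ⟨hlL, hs, hnbr⟩ := hprop
      by_cases hm : ml' l = 0
      · refine Finset.mem_union_left _ ?_
        simp only [hF', uncovered, Finset.mem_filter, Finset.mem_range]
        exact ⟨hlL, hs, hm⟩
      · obtain ⟨r, hr⟩ := Nat.exists_eq_succ_of_ne_zero hm
        obtain ⟨h1, h2, h3⟩ := hM.left l hlL r hr
        refine Finset.mem_union_right _ (Finset.mem_image.2 ⟨r, ?_, by omega⟩)
        simp only [Q, Finset.mem_filter, Finset.mem_range]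
        exact ⟨h1, hnbr r h2⟩
    have h1 := Finset.card_le_card hsub
    rw [Finset.card_union_of_disjoint hdisj, hLcard] at h1
    have h2 := Finset.card_union_le F' ((Q j).image fun r => mr' r - 1)
    have h3 : ((Q j).image fun r => mr' r - 1).card ≤ (Q j).card := Finset.card_image_le
    omega
  -- Adding these inequalities telescopes the cardinalities of the price levels.
  have hsum : ∀ k ≤ K, k * F.card + (Q (k + 1)).card ≤ k * F'.card + (Q 1).card := by
    intro k
    induction k with
    | zero => simp
    | succ k ih =>
      intro hk
      have h1 := ih (by omega)
      have h2 := hstep (k + 1) (by omega) hk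
      rw [Nat.succ_mul, Nat.succ_mul]
      omega
  have h1 := hsum K le_rfl
  have h2 : (Q 1).card ≤ nR := (Finset.card_filter_le _ _).trans (Finset.card_range nR).le
  -- From `K * |F| ≤ K * |F'| + nR` and `nR ≤ K * K`, an excess above `K` is impossible. This is why
  -- `K` is chosen about the square root of the number of vertices.
  by_contra h3
  have h4 : K * (F'.card + K + 1) ≤ K * F.card := Nat.mul_le_mul_left K (by omega)
  rw [Nat.mul_add, Nat.mul_add] at h4
  omega

end auction

end RAM

/-! ### The auction as a program -/

namespace RAM

open RAM.Expr RAM.Prog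

/-- Initialize the auction. -/
def auctionInit : Prog :=
  clear 14 5 ;;
  clear 10 5 ;;
  clear 9 4 ;;
  clear 15 4 ;;
  forTo 8 (const 0) 4 (store 16 (reg 8) (read 7 (reg 8))) ;;
  assign 20 (const 0) ;;
  assign 21 (const 0)

/-- The bids of the auction. -/
def auctionLoop : Prog :=
  loop (add (sub (reg 4) (reg 21)) (reg 20))
    (cond (reg 20)
      (assign 18 (sub (reg 20) (const 1)) ;;
        assign 15 (read 16 (reg 18)) ;;
        cond (reg 15)
          (assign 17 (read 5 (sub (reg 15) (const 1))) ;;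
            cond (sub (read 14 (reg 17)) (read 15 (reg 18)))
              (store 16 (reg 18) (read 8 (sub (reg 15) (const 1))))
              (store 14 (reg 17) (add (read 15 (reg 18)) (const 1)) ;;
                assign 20 (read 10 (reg 17)) ;;
                cond (reg 20) (store 9 (sub (reg 20) (const 1)) (const 0)) skip ;;
                store 10 (reg 17) (add (reg 18) (const 1)) ;;
                store 9 (reg 18) (add (reg 17) (const 1))))
          (store 15 (reg 18) (add (read 15 (reg 18)) (const 1)) ;;
            cond (sub (reg 7) (read 15 (reg 18)))
              (store 16 (reg 18) (read 7 (reg 18)))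
              (assign 20 (const 0))))
      (cond (read 17 (reg 21)) skip (assign 20 (add (reg 21) (const 1))) ;;
        assign 21 (add (reg 21) (const 1))))

variable {W B : ℕ} {s : State}

theorem auctionInit_spec (hs : Small B s) (hB : 8 < B) (hW : B ≤ W)
    (hlt : EndsLt (s.reg 4) (s.reg 5) (s.reg 6) (s.arr 4) (s.arr 5) (s.arr 6))
    (hl : Linked (s.reg 4) (s.reg 6) (s.arr 4) (s.arr 6) (s.arr 7) (s.arr 8)) (K : ℕ) :
    Wp W auctionInit s (fun t s' => Small B s' ∧ t ≤ 50 * (s.reg 4 + s.reg 5 + 1) ∧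
      Auction (s.reg 4) (s.reg 5) (s.reg 6) (s.arr 4) (s.arr 5) (s.arr 6) K (s.arr 17)
        (s'.arr 14) (s'.arr 15) (s'.arr 16) (s'.arr 9) (s'.arr 10) (s'.reg 21) (s'.reg 20) ∧
      s'.reg 21 = 0 ∧ s'.reg 20 = 0 ∧ ∀ i, s.reg 4 ≤ i → s'.arr 9 i = s.arr 9 i) := by
  unfold auctionInit
  rw [wp_seq]
  refine (clear_spec 14 5 (by decide) hs hB hW).mono ?_
  rintro t1 s1 ha1 ⟨hs1, hz1, -, ht1⟩
  rw [wp_seq]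
  refine (clear_spec 10 5 (by decide) hs1 hB hW).mono ?_
  rintro t2 s2 ha2 ⟨hs2, hz2, -, ht2⟩
  rw [wp_seq]
  refine (clear_spec 9 4 (by decide) hs2 hB hW).mono ?_
  rintro t3 s3 ha3 ⟨hs3, hz3, hz3', ht3⟩
  rw [wp_seq]
  refine (clear_spec 15 4 (by decide) hs3 hB hW).mono ?_
  rintro t4 s4 ha4 ⟨hs4, hz4, -, ht4⟩
  have e14 : s1.reg 4 = s.reg 4 := ha1.reg 4 (by decide)
  have e15 : s1.reg 5 = s.reg 5 := ha1.reg 5 (by decide)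
  have e24 : s2.reg 4 = s.reg 4 := (ha2.reg 4 (by decide)).trans e14
  have e34 : s3.reg 4 = s.reg 4 := (ha3.reg 4 (by decide)).trans e24
  have e44 : s4.reg 4 = s.reg 4 := (ha4.reg 4 (by decide)).trans e34
  have a7 : s4.arr 7 = s.arr 7 := by
    rw [ha4.arr 7 (by decide), ha3.arr 7 (by decide), ha2.arr 7 (by decide),
      ha1.arr 7 (by decide)]
  have a14 : s4.arr 14 = s1.arr 14 := by
    rw [ha4.arr 14 (by decide), ha3.arr 14 (by decide), ha2.arr 14 (by decide)]
  have a10 : s4.arr 10 = s2.arr 10 := by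
    rw [ha4.arr 10 (by decide), ha3.arr 10 (by decide)]
  have a9 : s4.arr 9 = s3.arr 9 := ha4.arr 9 (by decide)
  have a29 : s2.arr 9 = s.arr 9 := by rw [ha2.arr 9 (by decide), ha1.arr 9 (by decide)]
  have hreg := hs4.reg
  rw [wp_seq]
  refine Wp.forTo 6 (fun j s' => Small B s' ∧ ∀ i < j, s'.arr 16 i = s.arr 7 i)
    ?_ (by decide) (by decide) (by decide) (by omega) ?_ ?_ ?_ ?_ ?_
  · simp only [Fits]; omega
  · simp [eval]
  · exact (hreg 4).trans_le hW
  · refine ⟨hs4.setReg _ (by simp [eval]; omega), fun l hl => absurd hl (by simp [eval])⟩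
  · rintro j s' - hj hij ha ⟨hs', h1⟩
    have c7 : s'.arr 7 = s.arr 7 := (ha.arr 7 (by decide)).trans a7
    have d7 := hs'.arr 7 (by decide) j
    have := hreg 4
    rw [c7] at d7
    rw [wp_store]
    simp only [Fits, eval, cost, hij, c7]
    refine ⟨by omega, by omega, (hs'.setArr _ _ d7).setReg _ (by omega), fun i hi => ?_⟩
    simp only [State.arr_setReg, State.arr_setArr, if_true, Function.update_apply]
    split_ifs with h2
    · rw [h2]
    · exact h1 i (by omega)
  · rintro t5 s5 ha5 - ⟨hs5, hptr⟩ ht5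
    simp only [eval, cost, e44] at ht5
    rw [e44] at hptr
    simp only [wp_seq, wp_assign, Fits, eval, cost, State.reg_setReg, State.arr_setReg,
      Nat.reduceEqDiff, if_true, if_false]
    rw [ha5.arr 14 (by decide), ha5.arr 9 (by decide), ha5.arr 10 (by decide),
      ha5.arr 15 (by decide), a14, a10, a9]
    refine ⟨by omega, by omega, (hs5.setReg _ (by omega)).setReg _ (by omega), by omega, ?_,
      trivial, trivial, fun i hi => ?_⟩
    · refine auction_init hl hz1 (fun r hr => hz2 r (by omega)) (fun l hl => hz3 l (by omega))
        (fun l hl => hz4 l (by omega)) hptr hlt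
    · rw [hz3' i (by omega), a29]

theorem auctionLoop_spec (hs : Small B s) (hB : 8 < B) (hW : 2 * B ≤ W)
    (hlt : EndsLt (s.reg 4) (s.reg 5) (s.reg 6) (s.arr 4) (s.arr 5) (s.arr 6))
    (hl : Linked (s.reg 4) (s.reg 6) (s.arr 4) (s.arr 6) (s.arr 7) (s.arr 8)) (hK : 0 < s.reg 7)
    (hA : Auction (s.reg 4) (s.reg 5) (s.reg 6) (s.arr 4) (s.arr 5) (s.arr 6) (s.reg 7) (s.arr 17)
        (s.arr 14) (s.arr 15) (s.arr 16) (s.arr 9) (s.arr 10) (s.reg 21) (s.reg 20)) :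
    Wp W auctionLoop s (fun t s' => Small B s' ∧
      t ≤ 60 * ((s.reg 6 + s.reg 4 + s.reg 5) * s.reg 7 + s.reg 4 + 1) ∧
      Auction (s.reg 4) (s.reg 5) (s.reg 6) (s.arr 4) (s.arr 5) (s.arr 6) (s.reg 7) (s.arr 17)
        (s'.arr 14) (s'.arr 15) (s'.arr 16) (s'.arr 9) (s'.arr 10) (s.reg 4) 0 ∧
      ∀ i, s.reg 4 ≤ i → s'.arr 9 i = s.arr 9 i) := by
  unfold auctionLoop
  refine Wp.loop (fun s' => Small B s' ∧ (∀ i, s.reg 4 ≤ i → s'.arr 9 i = s.arr 9 i) ∧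
      Auction (s.reg 4) (s.reg 5) (s.reg 6) (s.arr 4) (s.arr 5) (s.arr 6) (s.reg 7) (s.arr 17)
        (s'.arr 14) (s'.arr 15) (s'.arr 16) (s'.arr 9) (s'.arr 10) (s'.reg 21) (s'.reg 20))
    -- Each iteration skips an edge, raises a level, raises a price or admits a vertex, and every
    -- one of these lowers the potential by at least one.
    (fun s' => 60 * auctionPot (s.reg 4) (s.reg 5) (s.reg 6) (s.arr 4) (s.reg 7) (s'.arr 14)
      (s'.arr 15) (s'.arr 16) (s'.reg 21)) ?_ ?_ ?_ ?_
  · exact ⟨hs, fun _ _ => rfl, hA⟩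
  · rintro s' ha ⟨hsm, -⟩
    have := hsm.reg 4
    have := hsm.reg 20
    have := hsm.reg 21
    simp only [Fits, eval]
    omega
  · rintro s' ha ⟨hsm, hout, hA⟩ hne
    have e4 : s'.reg 4 = s.reg 4 := ha.reg 4 (by decide)
    have e7 : s'.reg 7 = s.reg 7 := ha.reg 7 (by decide)
    have c5 : s'.arr 5 = s.arr 5 := ha.arr 5 (by decide)
    have c7 : s'.arr 7 = s.arr 7 := ha.arr 7 (by decide)
    have c8 : s'.arr 8 = s.arr 8 := ha.arr 8 (by decide)
    have c17 : s'.arr 17 = s.arr 17 := ha.arr 17 (by decide)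
    have b4 := hs.reg 4
    have b5 := hs.reg 5
    have b7 := hs.reg 7
    have b20 := hsm.reg 20
    have b21 := hsm.reg 21
    simp only [eval, e4] at hne
    rw [wp_cond]
    refine ⟨by simp only [Fits]; omega, ?_, ?_⟩
    · simp only [eval]
      intro hb
      have hbl := hA.active_lt hb
      obtain ⟨-, -, hbK⟩ := hA.active hb
      have d16 := hsm.arr 16 (by decide) (s'.reg 20 - 1)
      have d15 := hsm.arr 15 (by decide) (s'.reg 20 - 1)
      have d5 := hs.arr 5 (by decide) (s'.arr 16 (s'.reg 20 - 1) - 1)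
      have d8 := hs.arr 8 (by decide) (s'.arr 16 (s'.reg 20 - 1) - 1)
      have d7 := hs.arr 7 (by decide) (s'.reg 20 - 1)
      have d14 := hsm.arr 14 (by decide) (s.arr 5 (s'.arr 16 (s'.reg 20 - 1) - 1))
      have d10 := hsm.arr 10 (by decide) (s.arr 5 (s'.arr 16 (s'.reg 20 - 1) - 1))
      have hsm1 : Small B ((s'.setReg 18 (s'.reg 20 - 1)).setReg 15
        (s'.arr 16 (s'.reg 20 - 1))) := (hsm.setReg _ (by omega)).setReg _ (by omega)
      rw [wp_seq, wp_assign]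
      refine ⟨by simp only [Fits]; omega, ?_⟩
      rw [wp_seq, wp_assign]
      refine ⟨by simp [Fits, eval]; omega, ?_⟩
      rw [wp_cond]
      refine ⟨by simp [Fits, eval]; omega, ?_, ?_⟩
      · intro hx
        simp only [eval, State.reg_setReg, State.arr_setReg, Nat.reduceEqDiff, if_true,
          if_false] at hx
        obtain ⟨hxN, he⟩ := hA.ptr_ok _ hbl hx
        have hrn := (hlt _ (show s'.arr 16 (s'.reg 20 - 1) - 1 < s.reg 6 by omega) he.1).2
        have hlev := hA.nbr _ (show s'.arr 16 (s'.reg 20 - 1) - 1 < s.reg 6 by omega) he.1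
        simp only [wp_seq, wp_assign, wp_cond, wp_store, wp_skip, Fits, eval, cost,
          State.reg_setReg, State.arr_setReg, State.reg_setArr, State.arr_setArr,
          Nat.reduceEqDiff, if_true, if_false, c5, c8]
        refine ⟨by omega, by omega, ?_, ?_⟩
        · intro hp
          have hpot := hA.pot_skip hl hb hx
          refine ⟨by omega, ⟨((hsm1.setReg _ d5).setArr _ _ d8), hout,
            hA.skip_edge hl hb hx (by omega)⟩, ?_⟩
          omega
        · intro hp
          have hpot := hA.pot_take hb hrn (by omega)
          have hsm2 : Small B ((((((s'.setReg 18 (s'.reg 20 - 1)).setReg 15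
              (s'.arr 16 (s'.reg 20 - 1))).setReg 17 (s.arr 5 (s'.arr 16 (s'.reg 20 - 1) - 1))).setArr
              14 (s.arr 5 (s'.arr 16 (s'.reg 20 - 1) - 1)) (s'.arr 15 (s'.reg 20 - 1) + 1))).setReg
              20 (s'.arr 10 (s.arr 5 (s'.arr 16 (s'.reg 20 - 1) - 1)))) :=
            ((hsm1.setReg _ d5).setArr _ _ (by omega)).setReg _ d10
          refine ⟨by omega, by omega, by omega, ?_, ?_⟩
          · intro hm
            obtain ⟨l, hml⟩ := Nat.exists_eq_succ_of_ne_zero hm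
            obtain ⟨hlL, hmlr⟩ := hA.mates.right _ hrn l hml
            refine ⟨by omega, by omega, by omega, ⟨?_, ?_, hA.take hlt hb hx rfl (by omega) ?_⟩, ?_⟩
            · refine Small.setArr (Small.setArr (Small.setArr hsm2 _ _ ?_) _ _ ?_) _ _ ?_ <;> omega
            · intro i hi
              rw [Function.update_of_ne (by omega), hml, Nat.succ_sub_one,
                Function.update_of_ne (by omega)]
              exact hout i hi
            · intro l' hl'
              rw [hml, Nat.succ_sub_one, Function.update_apply]
              split_ifs with h1 h2 h2
              · rfl
              · rw [h1] at h2
                exact absurd hmlr h2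
              · have := (hA.mates.left l' hl' _ h2).2.2
                omega
              · rfl
            · omega
          · intro hm
            refine ⟨by omega, by omega, ⟨?_, ?_, hA.take hlt hb hx rfl (by omega) ?_⟩, ?_⟩
            · refine Small.setArr (Small.setArr hsm2 _ _ ?_) _ _ ?_ <;> omega
            · intro i hi
              rw [Function.update_of_ne (by omega)]
              exact hout i hi
            · intro l' hl'
              split_ifs with h2
              · have := (hA.mates.left l' hl' _ h2).2.2
                omega
              · rfl
            · omega
      · intro hx
        simp only [eval, State.reg_setReg, State.arr_setReg, Nat.reduceEqDiff, if_true,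
          if_false] at hx
        simp only [wp_seq, wp_assign, wp_cond, wp_store, Fits, eval, cost,
          State.reg_setReg, State.arr_setReg, State.reg_setArr, State.arr_setArr,
          Nat.reduceEqDiff, if_true, if_false, c7, e7, Function.update_self]
        refine ⟨by omega, by omega, ?_, ?_⟩
        · intro hlt'
          have hpot := hA.pot_raise hb hx (ptr' := Function.update (s'.arr 16) (s'.reg 20 - 1)
            (s.arr 7 (s'.reg 20 - 1))) (fun l hl => Function.update_of_ne hl _ _)
          refine ⟨by omega, ⟨?_, hout, hA.raise hl hb hx (fun _ => ⟨rfl, rfl⟩)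
            (fun h => by omega)⟩, ?_⟩
          · refine Small.setArr (Small.setArr hsm1 _ _ ?_) _ _ ?_ <;> omega
          · omega
        · intro hge
          have hpot := hA.pot_raise hb hx (ptr' := s'.arr 16) (fun l hl => rfl)
          refine ⟨by omega, ⟨?_, hout, hA.raise hl hb hx (fun h => by omega)
            (fun h => ⟨rfl, rfl⟩)⟩, ?_⟩
          · refine Small.setReg (Small.setArr hsm1 _ _ ?_) _ ?_ <;> omega
          · omega
    · simp only [eval]
      intro hb
      have h21 : s'.reg 21 < s.reg 4 := by omega
      have d17 := hs.arr 17 (by decide) (s'.reg 21)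
      simp only [wp_seq, wp_assign, wp_cond, wp_skip, Fits, eval, cost,
        State.reg_setReg, State.arr_setReg, Nat.reduceEqDiff, if_true, if_false, c17]
      rw [hb] at hA
      have hpot : auctionPot (s.reg 4) (s.reg 5) (s.reg 6) (s.arr 4) (s.reg 7) (s'.arr 14)
          (s'.arr 15) (s'.arr 16) (s'.reg 21 + 1) + 1 ≤ auctionPot (s.reg 4) (s.reg 5) (s.reg 6)
          (s.arr 4) (s.reg 7) (s'.arr 14) (s'.arr 15) (s'.arr 16) (s'.reg 21) := by
        unfold auctionPot
        omega
      refine ⟨by omega, fun h17 => ⟨by omega, ⟨hsm.setReg _ (by omega), hout, ?_⟩, by omega⟩,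
        fun h17 => ⟨by omega, by omega, ⟨(hsm.setReg _ (by omega)).setReg _ (by omega), hout, ?_⟩,
          by omega⟩⟩
      · exact hA.enter h21 hK (by rw [if_neg h17, hb])
      · exact hA.enter h21 hK (by rw [if_pos h17])
  · rintro t s' ha ⟨hsm, hout, hA⟩ he ht
    have e4 : s'.reg 4 = s.reg 4 := ha.reg 4 (by decide)
    simp only [eval, e4] at he
    have h1 : s'.reg 21 = s.reg 4 := by
      have := hA.le
      omega
    have h2 : s'.reg 20 = 0 := by omega
    rw [h1, h2] at hA
    have hpot := auctionPot_le (nL := s.reg 4) (nR := s.reg 5) (N := s.reg 6) (src := s.arr 4)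
      (K := s.reg 7) (price := s.arr 14) (lev := s.arr 15) (ptr := s.arr 16) (l₀ := s.reg 21)
    simp only [cost] at ht
    exact ⟨hsm, by omega, hA, hout⟩

end RAM

/-! ### Array loops and loops over adjacency rows -/

namespace RAM

open RAM.Expr RAM.Prog

variable {W B : ℕ} {s : State} {Q : ℕ → State → Prop}

/-- A counting loop whose invariant concerns the arrays only. -/
theorem Wp.forArr {i n : ℕ} {lo : Expr} {body : Prog} (T : ℕ → ℕ)
    (P : ℕ → (ℕ → ℕ → ℕ) → Prop) (hs : Small B s) (hB : 8 < B) (hW : B ≤ W)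
    (hlo : lo.Fits W s) (hn : n ≠ i) (hi : i ∉ body.regs) (hn' : n ∉ body.regs)
    (hle : lo.eval s ≤ s.reg n) (hP : P (lo.eval s) s.arr)
    (hstep : ∀ j s', lo.eval s ≤ j → j < s.reg n → s'.reg i = j →
      Agree (Prog.forTo i lo n body) s s' → Small B s' → P j s'.arr →
      Wp W body s' (fun t s'' => t ≤ T j ∧ Small B s'' ∧ P (j + 1) s''.arr))
    (hQ : ∀ t s', Agree (Prog.forTo i lo n body) s s' → Small B s' → P (s.reg n) s'.arr →
      t ≤ ∑ j ∈ Finset.Ico (lo.eval s) (s.reg n), (T j + 8) + lo.cost + 5 → Q t s') :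
    Wp W (Prog.forTo i lo n body) s Q := by
  have hnB := hs.reg n
  refine Wp.forTo_sum T (fun j s' => Small B s' ∧ P j s'.arr) hlo hn hi hn' (by omega) hle
    (by omega) ⟨hs.setReg _ (by omega), hP⟩ ?_ ?_
  · rintro j s' h1 h2 h3 ha ⟨h4, h5⟩
    refine (hstep j s' h1 h2 h3 ha h4 h5).mono ?_
    rintro t s'' - ⟨h6, h7, h8⟩
    exact ⟨h6, h7.setReg _ (by omega), h8⟩
  · rintro t s' ha - ⟨h1, h2⟩ ht
    exact hQ t s' ha h1 h2 ht

/-- The version of `Wp.forArr` for loops from `0` with a uniform time bound. -/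
theorem Wp.forArr_const {i n : ℕ} {body : Prog} (T : ℕ)
    (P : ℕ → (ℕ → ℕ → ℕ) → Prop) (hs : Small B s) (hB : 8 < B) (hW : B ≤ W)
    (hn : n ≠ i) (hi : i ∉ body.regs) (hn' : n ∉ body.regs) (hP : P 0 s.arr)
    (hstep : ∀ j s', j < s.reg n → s'.reg i = j →
      Agree (Prog.forTo i (const 0) n body) s s' → Small B s' → P j s'.arr →
      Wp W body s' (fun t s'' => t ≤ T ∧ Small B s'' ∧ P (j + 1) s''.arr))
    (hQ : ∀ t s', Agree (Prog.forTo i (const 0) n body) s s' → Small B s' →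
      P (s.reg n) s'.arr → t ≤ s.reg n * (T + 8) + 6 → Q t s') :
    Wp W (Prog.forTo i (const 0) n body) s Q := by
  refine Wp.forArr (fun _ => T) P hs hB hW (by simp only [Fits]; omega) hn hi hn'
    (Nat.zero_le _) hP (fun j s' _ => hstep j s') ?_
  intro t s' h1 h2 h3 h4
  refine hQ t s' h1 h2 h3 (h4.trans (le_of_eq ?_))
  simp [eval, cost]

/-! ### The input -/

/-- The arrays `off`, `obj` and `tab` describe the instance `G` with `m` edges, and edge number `e`
belongs to agent `own e`. -/
structure Table {p q : ℕ} (G : PrefInstance (Fin p) (Fin q)) (m : ℕ) (off obj tab own : ℕ → ℕ) :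
    Prop where
  off_zero : off 0 = 0
  off_last : off p = m
  off_mono : ∀ a < p, off a ≤ off (a + 1)
  off_le : ∀ a ≤ p, off a ≤ m
  row : ∀ a < p, ∀ e, off a ≤ e ∧ e < off (a + 1) ↔ e < m ∧ own e = a
  row_card : ∀ a < p, off (a + 1) ≤ off a + q
  own_lt : ∀ e < m, own e < p
  obj_lt : ∀ e < m, obj e < q
  edge_iff : ∀ (a : Fin p) (b : Fin q), (a, b) ∈ G.E ↔ ∃ e < m, own e = a ∧ obj e = b
  tab_iff : ∀ e < m, ∀ (a : Fin p) (b b' : Fin q), own e = a → obj e = b →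
    (tab (e * q + b') ≠ 0 ↔ G.pref a b b')
  tab_le : ∀ e < m, ∀ b' < q, tab (e * q + b') ≤ 1

/-- The offsets are monotone from `0` to the number of edges, so every edge number lies in exactly
one row, whose index is `own e`. -/
theorem exists_table {p q : ℕ} {G : PrefInstance (Fin p) (Fin q)} (h : G.Encodes s) :
    ∃ own, Table G G.E.card (s.arr 0) (s.arr 1) (s.arr 2) own := by
  set off := s.arr 0 with hoff
  have hmono : ∀ a < p, off a ≤ off (a + 1) := fun a ha => h.off_mono ⟨a, ha⟩
  have hmono' : ∀ b ≤ p, ∀ a ≤ b, off a ≤ off b := by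
    intro b
    induction b with
    | zero =>
      intro _ a ha
      rw [Nat.le_zero.1 ha]
    | succ b ih =>
      intro hb a ha
      rcases Nat.lt_or_ge b a with h1 | h1
      · rw [show a = b + 1 by omega]
      · exact (ih (by omega) a h1).trans (hmono b (by omega))
  have hex : ∀ e < G.E.card, ∃ a < p, off a ≤ e ∧ e < off (a + 1) := by
    intro e he
    by_contra hno
    push Not at hno
    have : ∀ a ≤ p, off a ≤ e := by
      intro a
      induction a with
      | zero =>
        intro _
        rw [hoff, h.off_zero]
        exact Nat.zero_le _
      | succ a ih => exact fun ha => hno a ha (ih (by omega))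
    have h1 := this p le_rfl
    rw [hoff, h.off_last] at h1
    omega
  have huniq : ∀ e, ∀ a < p, ∀ a' < p, off a ≤ e → e < off (a + 1) → off a' ≤ e →
      e < off (a' + 1) → a = a' := by
    intro e a ha a' ha' h1 h2 h3 h4
    rcases lt_trichotomy a a' with h5 | h5 | h5
    · have := hmono' a' ha'.le (a + 1) h5
      omega
    · exact h5
    · have := hmono' a ha.le (a' + 1) h5
      omega
  choose! own hown using hex
  have hrow : ∀ a < p, ∀ e, off a ≤ e ∧ e < off (a + 1) ↔ e < G.E.card ∧ own e = a := by
    intro a ha e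
    constructor
    · rintro ⟨h1, h2⟩
      have h3 := hmono' p le_rfl (a + 1) ha
      rw [hoff, h.off_last, ← hoff] at h3
      have he : e < G.E.card := by omega
      obtain ⟨h4, h5, h6⟩ := hown e he
      exact ⟨he, huniq e _ h4 a ha h5 h6 h1 h2⟩
    · rintro ⟨he, rfl⟩
      exact (hown e he).2
  have hval : ∀ e < G.E.card, ∀ (a : Fin p) (b b' : Fin q), own e = a → s.arr 1 e = b →
      (G.pref a b b' → s.arr 2 (e * q + b') = 1) ∧
      (¬ G.pref a b b' → s.arr 2 (e * q + b') = 0) := by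
    intro e he a b b' h1 h2
    have h3 : e ∈ Set.Ico (s.arr 0 a) (s.arr 0 (a + 1)) := (hrow a a.2 e).2 ⟨he, h1⟩
    exact ⟨h.pref_one a b b' e h3 h2, h.pref_zero a b b' e h3 h2⟩
  refine ⟨own, h.off_zero, h.off_last, hmono, ?_, hrow, ?_, fun e he => (hown e he).1, h.nbr_lt,
    ?_, ?_, ?_⟩
  · intro a ha
    have := hmono' p le_rfl a ha
    rwa [hoff, h.off_last, ← hoff] at this
  -- Objects within a row are distinct, so a row has at most `q` edges. This is what bounds the cost
  -- of a row scan.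
  · intro a ha
    have h1 : ((Finset.Ico (off a) (off (a + 1))).image (s.arr 1)).card =
        off (a + 1) - off a := by
      rw [Finset.card_image_of_injOn, Nat.card_Ico]
      simpa using h.nbr_inj ⟨a, ha⟩
    have h2 : ((Finset.Ico (off a) (off (a + 1))).image (s.arr 1)) ⊆ Finset.range q := by
      intro b hb
      simp only [Finset.mem_image, Finset.mem_Ico] at hb
      obtain ⟨e, he, rfl⟩ := hb
      exact Finset.mem_range.2 (h.nbr_lt e ((hrow a ha e).1 he).1)
    have h3 := Finset.card_le_card h2
    rw [h1, Finset.card_range] at h3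
    omega
  · intro a b
    rw [h.nbr_iff]
    constructor
    · rintro ⟨e, he, hb⟩
      obtain ⟨h1, h2⟩ := (hrow a a.2 e).1 he
      exact ⟨e, h1, h2, hb⟩
    · rintro ⟨e, he, ha, hb⟩
      exact ⟨e, (hrow a a.2 e).2 ⟨he, ha⟩, hb⟩
  · intro e he a b b' h1 h2
    obtain ⟨h3, h4⟩ := hval e he a b b' h1 h2
    by_cases hp : G.pref a b b'
    · rw [h3 hp]
      simp [hp]
    · rw [h4 hp]
      simp [hp]
  · intro e he b' hb'
    obtain ⟨h3, h4⟩ := hval e he ⟨own e, (hown e he).1⟩ ⟨s.arr 1 e, h.nbr_lt e he⟩ ⟨b', hb'⟩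
      rfl rfl
    by_cases hp : G.pref ⟨own e, (hown e he).1⟩ ⟨s.arr 1 e, h.nbr_lt e he⟩ ⟨b', hb'⟩
    · exact (h3 hp).le
    · exact (h4 hp).le.trans (Nat.zero_le _)

/-- The input is still in place. -/
structure Holds (p q m : ℕ) (off obj tab : ℕ → ℕ) (s : State) : Prop where
  reg0 : s.reg 0 = p
  reg1 : s.reg 1 = q
  reg2 : s.reg 2 = m
  arr0 : s.arr 0 = off
  arr1 : s.arr 1 = obj
  arr2 : s.arr 2 = tab

theorem Holds.of_agree {p q m : ℕ} {off obj tab : ℕ → ℕ} (h : Holds p q m off obj tab s)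
    {c : Prog} {s' : State} (ha : Agree c s s')
    (hc : ∀ x < 3, x ∉ c.regs ∧ x ∉ c.arrs) : Holds p q m off obj tab s' :=
  ⟨(ha.reg 0 (hc 0 (by omega)).1).trans h.reg0, (ha.reg 1 (hc 1 (by omega)).1).trans h.reg1,
    (ha.reg 2 (hc 2 (by omega)).1).trans h.reg2, (ha.arr 0 (hc 0 (by omega)).2).trans h.arr0,
    (ha.arr 1 (hc 1 (by omega)).2).trans h.arr1, (ha.arr 2 (hc 2 (by omega)).2).trans h.arr2⟩

/-- Run `body` for all edge numbers in register `9` that belong to the agent in register `11`. -/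
def forRow (body : Prog) : Prog :=
  assign 10 (read 0 (add (reg 11) (const 1))) ;; forTo 9 (read 0 (reg 11)) 10 body

theorem forRow_spec {p q m : ℕ} {G : PrefInstance (Fin p) (Fin q)} {off obj tab own : ℕ → ℕ}
    (hT : Table G m off obj tab own) {body : Prog} (T : ℕ) (P : ℕ → (ℕ → ℕ → ℕ) → Prop)
    (hs : Small B s) (hB : 8 < B) (hW : B ≤ W) (hmB : m < B) (hpB : p < B)
    (h0 : s.arr 0 = off) (h11 : s.reg 11 < p)
    (hbody : 9 ∉ body.regs ∧ 10 ∉ body.regs) (hP : P (off (s.reg 11)) s.arr)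
    (hstep : ∀ j s', j < m → own j = s.reg 11 → s'.reg 9 = j → Agree (forRow body) s s' →
      Small B s' → P j s'.arr →
      Wp W body s' (fun t s'' => t ≤ T ∧ Small B s'' ∧ P (j + 1) s''.arr))
    (hQ : ∀ t s', Small B s' → P (off (s.reg 11 + 1)) s'.arr →
      t ≤ (off (s.reg 11 + 1) - off (s.reg 11)) * (T + 8) + 12 → Q t s') :
    Wp W (forRow body) s Q := by
  unfold forRow
  have h1 := hT.off_le (s.reg 11 + 1) h11
  have h2 := hT.off_le (s.reg 11) h11.le
  have h3 := hT.off_mono _ h11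
  rw [wp_seq, wp_assign]
  simp only [Fits, eval, cost, h0]
  refine ⟨by omega, ?_⟩
  refine Wp.forArr (fun _ => T) P (hs.setReg 10 (by omega)) hB hW ?_ (by decide) hbody.1 hbody.2
    ?_ ?_ ?_ ?_
  · simp [Fits, eval, h0]
    omega
  · simpa [eval, h0] using h3
  · simpa [eval, h0] using hP
  · intro j s' h5 h6 h7 ha hs' hPj
    simp only [eval, State.reg_setReg, State.arr_setReg, Nat.reduceEqDiff, if_true, if_false,
      h0] at h5 h6
    obtain ⟨h8, h9⟩ := (hT.row _ h11 j).1 ⟨h5, h6⟩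
    refine hstep j s' h8 h9 h7 ⟨fun x hx => ?_, fun k hk => ?_⟩ hs' hPj
    · simp only [forRow, Prog.forTo, Prog.regs, List.mem_append, not_or, List.mem_singleton] at hx
      rw [ha.reg x (by simp [Prog.forTo, Prog.regs, hx])]
      simp [hx.1]
    · exact ha.arr k (by simpa [forRow, Prog.forTo, Prog.arrs] using hk)
  · intro t s' ha hs' hPj ht
    simp only [eval, cost, State.reg_setReg, State.arr_setReg, Nat.reduceEqDiff, if_true, if_false,
      h0] at ht hPj
    refine hQ _ s' hs' hPj ?_
    rw [Finset.sum_const, Nat.card_Ico, smul_eq_mul] at ht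
    omega

end RAM

namespace RAM

open RAM.Expr RAM.Prog

/-! ### Initialization -/

/-- Edge `e` is switched on iff its object is undominated and dominates all lowered neighbours. -/
def FlagInv (q m : ℕ) (obj tab own low flag : ℕ → ℕ) : Prop :=
  ∀ e < m, flag e ≠ 0 ↔ (∀ e' < m, own e' = own e → tab (e' * q + obj e) = 0) ∧
    ∀ e' < m, own e' = own e → low (obj e') ≠ 0 → tab (e * q + obj e') ≠ 0

/-- The state between two phases of the first part of the algorithm. -/
structure Ready (p q m : ℕ) (off obj tab own : ℕ → ℕ) (K : ℕ) (s : State) : Prop where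
  holds : Holds p q m off obj tab s
  reg4 : s.reg 4 = q
  reg5 : s.reg 5 = p
  reg6 : s.reg 6 = m
  reg7 : s.reg 7 = K
  src : ∀ e < m, s.arr 4 e = obj e
  tgt : ∀ e < m, s.arr 5 e = own e
  low : ∀ b < q, s.arr 17 b = 0 ∨ s.arr 17 b = 2
  flag : FlagInv q m obj tab own (s.arr 17) (s.arr 6)
  ml : ∀ i, q ≤ i → s.arr 9 i = 0

/-- Load the sizes of the graph, and let register `7` be the price bound, which is about the square
root of the number of vertices. -/
def initRegs : Prog :=
  assign 4 (reg 1) ;;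
  assign 5 (reg 0) ;;
  assign 6 (reg 2) ;;
  assign 7 (const 1) ;;
  loop (sub (add (reg 0) (reg 1)) (mul (reg 7) (reg 7))) (assign 7 (add (reg 7) (const 1)))

/-- Load the edges. -/
def initEdges : Prog :=
  forTo 8 (const 0) 0 (assign 11 (reg 8) ;;
    forRow (store 4 (reg 9) (read 1 (reg 9)) ;; store 5 (reg 9) (reg 8) ;;
      store 6 (reg 9) (const 1)))

/-- Lower the isolated objects. -/
def initLow : Prog :=
  forTo 8 (const 0) 1 (store 17 (reg 8) (const 2)) ;;
  forTo 8 (const 0) 2 (store 17 (read 4 (reg 8)) (const 0))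

/-- Switch off the edges to dominated objects. -/
def initFlags : Prog :=
  forTo 8 (const 0) 2 (assign 11 (read 5 (reg 8)) ;;
    forRow (cond (read 2 (add (mul (reg 8) (reg 1)) (read 4 (reg 9))))
      (store 6 (reg 9) (const 0)) skip))

variable {W B : ℕ} {s : State} {p q m : ℕ} {G : PrefInstance (Fin p) (Fin q)}
  {off obj tab own : ℕ → ℕ}

/-- Register `7` ends as the least positive number whose square is at least `p + q`. The lower bound
is the failed test before the last increment, or trivial when there was none. -/
theorem initRegs_spec (hs : Small B s) (hB : 8 < B) (hW : B * B + B ≤ W)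
    (hH : Holds p q m off obj tab s) (hn : p + q + m + 2 < B) (hpq : 0 < p + q) :
    Wp W initRegs s (fun t s' => Small B s' ∧ t ≤ 20 * (p + q + 2) ∧
      (s'.reg 4 = q ∧ s'.reg 5 = p ∧ s'.reg 6 = m) ∧ 0 < s'.reg 7 ∧
      p + q ≤ s'.reg 7 * s'.reg 7 ∧ (s'.reg 7 - 1) * (s'.reg 7 - 1) ≤ p + q) := by
  have hW' : B ≤ W := by
    have := Nat.zero_le (B * B)
    omega
  unfold initRegs
  simp only [wp_seq, wp_assign, Fits, eval, cost, State.reg_setReg, Nat.reduceEqDiff,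
    if_false, hH.reg0, hH.reg1, hH.reg2]
  refine ⟨by omega, by omega, by omega, by omega, ?_⟩
  have hsm : Small B ((((s.setReg 4 q).setReg 5 p).setReg 6 m).setReg 7 1) := by
    refine Small.setReg (Small.setReg (Small.setReg (Small.setReg hs _ ?_) _ ?_) _ ?_) _ ?_ <;>
      omega
  refine Wp.loop (fun s' => Small B s' ∧ 0 < s'.reg 7 ∧ s'.reg 7 ≤ p + q + 1 ∧
    (s'.reg 7 - 1) * (s'.reg 7 - 1) ≤ p + q) (fun s' => 15 * (p + q + 1 - s'.reg 7)) ?_ ?_ ?_ ?_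
  · exact ⟨hsm, by simp, by simp, by simp⟩
  · rintro s' ha ⟨hsm, h1, h2, h3⟩
    have e0 : s'.reg 0 = p := (ha.reg 0 (by decide)).trans (by simp [hH.reg0])
    have e1 : s'.reg 1 = q := (ha.reg 1 (by decide)).trans (by simp [hH.reg1])
    have hb := hsm.reg 7
    have := Nat.mul_le_mul hb.le hb.le
    simp only [Fits, eval, e0, e1]
    omega
  · rintro s' ha ⟨hsm, h1, h2, h3⟩ hne
    have e0 : s'.reg 0 = p := (ha.reg 0 (by decide)).trans (by simp [hH.reg0])
    have e1 : s'.reg 1 = q := (ha.reg 1 (by decide)).trans (by simp [hH.reg1])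
    simp only [eval, e0, e1] at hne
    have h4 := Nat.le_mul_self (s'.reg 7)
    simp only [wp_assign, Fits, eval, cost, State.reg_setReg, if_true]
    refine ⟨by omega, ⟨hsm.setReg _ (by omega), by omega, by omega, ?_⟩, by omega⟩
    rw [Nat.add_sub_cancel]
    omega
  · rintro t s' ha ⟨hsm, h1, h2, h3⟩ he ht
    have e0 : s'.reg 0 = p := (ha.reg 0 (by decide)).trans (by simp [hH.reg0])
    have e1 : s'.reg 1 = q := (ha.reg 1 (by decide)).trans (by simp [hH.reg1])
    simp only [eval, e0, e1] at he
    simp only [cost, State.reg_setReg, if_true] at ht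
    refine ⟨hsm, by omega, ⟨?_, ?_, ?_⟩, h1, by omega, h3⟩
    · exact (ha.reg 4 (by decide)).trans (by simp)
    · exact (ha.reg 5 (by decide)).trans (by simp)
    · exact (ha.reg 6 (by decide)).trans (by simp)

/-- Row lengths telescope, so scanning every row once is linear in the number of edges. -/
theorem Table.sum_row (hT : Table G m off obj tab own) (c d : ℕ) (k : ℕ) (hk : k ≤ p) :
    ∑ a ∈ Finset.Ico 0 k, ((off (a + 1) - off a) * c + d) = off k * c + k * d := by
  induction k with
  | zero => simp [hT.off_zero]
  | succ k ih =>
    rw [Finset.sum_Ico_succ_top (Nat.zero_le k), ih (by omega)]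
    have h := hT.off_mono k hk
    obtain ⟨x, hx⟩ := Nat.exists_eq_add_of_le h
    rw [hx, Nat.add_sub_cancel_left, Nat.add_mul, Nat.add_mul]
    omega

theorem initEdges_spec (hT : Table G m off obj tab own) (hs : Small B s) (hB : 8 < B)
    (hW : B ≤ W) (hH : Holds p q m off obj tab s) (hn : p + q + m + 2 < B) :
    Wp W initEdges s (fun t s' => Small B s' ∧ t ≤ 30 * (p + m + 1) ∧
      ∀ e < m, s'.arr 4 e = obj e ∧ s'.arr 5 e = own e ∧ s'.arr 6 e = 1) := by
  unfold initEdges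
  refine Wp.forArr (fun a => (off (a + 1) - off a) * 20 + 15)
    (fun a A => ∀ e < off a, A 4 e = obj e ∧ A 5 e = own e ∧ A 6 e = 1) hs hB hW
    (by simp only [Fits]; omega) (by decide) (by decide) (by decide) (Nat.zero_le _) ?_ ?_ ?_
  · intro e he
    simp only [eval, hT.off_zero] at he
    omega
  · intro a s' _ hap h8 ha hs' hP
    rw [hH.reg0] at hap
    have hH' := hH.of_agree ha (by decide)
    rw [wp_seq, wp_assign]
    simp only [Fits, eval, cost, h8]
    refine ⟨by omega, ?_⟩
    refine forRow_spec hT 12 (fun i A => ∀ e < i, A 4 e = obj e ∧ A 5 e = own e ∧ A 6 e = 1)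
      (hs'.setReg 11 (by omega)) hB hW (by omega) (by omega) (by simpa using hH'.arr0)
      (by simpa using hap) (by decide) (by simpa using hP) ?_ ?_
    · intro j s'' hj hoj h9 ha2 hs'' hP2
      have f8 : s''.reg 8 = a := (ha2.reg 8 (by decide)).trans (by simpa using h8)
      have f1 : s''.arr 1 = obj := (ha2.arr 1 (by decide)).trans (by simpa using hH'.arr1)
      have hob := hT.obj_lt j hj
      simp only [State.reg_setReg, if_true] at hoj
      simp only [wp_seq, wp_store, Fits, eval, cost, State.reg_setArr, h9, f8, f1]
      refine ⟨by omega, by omega, by omega, by omega, ?_, ?_⟩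
      · refine Small.setArr (Small.setArr (Small.setArr hs'' _ _ ?_) _ _ ?_) _ _ ?_ <;> omega
      · intro e he
        simp only [State.arr_setArr, Nat.reduceEqDiff, if_true, if_false, Function.update_apply]
        split_ifs with h1
        · rw [h1]
          exact ⟨rfl, hoj.symm, rfl⟩
        · exact hP2 e (by omega)
    · intro t s'' hs'' hP2 ht
      simp only [State.reg_setReg, if_true] at hP2 ht
      exact ⟨by omega, hs'', hP2⟩
  · intro t s' ha hs' hP ht
    rw [hH.reg0] at hP ht
    rw [hT.off_last] at hP
    refine ⟨hs', ?_, hP⟩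
    simp only [eval, cost] at ht
    have h1 := hT.sum_row 20 23 p le_rfl
    rw [hT.off_last] at h1
    have h2 : ∑ a ∈ Finset.Ico 0 p, ((off (a + 1) - off a) * 20 + 15 + 8) =
      ∑ a ∈ Finset.Ico 0 p, ((off (a + 1) - off a) * 20 + 23) := rfl
    omega

theorem initLow_spec (hobj : ∀ e < m, obj e < q) (hs : Small B s) (hB : 8 < B)
    (hW : B ≤ W) (hH : Holds p q m off obj tab s) (hn : p + q + m + 2 < B)
    (hsrc : ∀ e < m, s.arr 4 e = obj e) :
    Wp W initLow s (fun t s' => Small B s' ∧ t ≤ 30 * (q + m + 1) ∧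
      ∀ b < q, (s'.arr 17 b = 0 ∧ ∃ e < m, obj e = b) ∨
        (s'.arr 17 b = 2 ∧ ∀ e < m, obj e ≠ b)) := by
  unfold initLow
  rw [wp_seq]
  refine Wp.forArr_const 5 (fun j A => ∀ b < j, A 17 b = 2) hs hB hW (by decide) (by decide)
    (by decide) (by simp) ?_ ?_
  · intro j s' hj h8 ha hs' hP
    simp only [wp_store, Fits, eval, cost, h8]
    refine ⟨by have := hs.reg 1; omega, by omega, hs'.setArr _ _ (by omega), ?_⟩
    intro b hb
    simp only [State.arr_setArr, if_true, Function.update_apply]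
    split_ifs
    · rfl
    · exact hP b (by omega)
  · intro t1 s1 ha1 hs1 hP1 ht1
    have hH1 := hH.of_agree ha1 (by decide)
    rw [hH.reg1] at hP1 ht1
    refine Wp.forArr_const 5 (fun j A => ∀ b < q, (A 17 b = 0 ∧ ∃ e < j, obj e = b) ∨
        (A 17 b = 2 ∧ ∀ e < j, obj e ≠ b)) hs1 hB hW (by decide) (by decide)
      (by decide) (fun b hb => Or.inr ⟨hP1 b hb, by simp⟩) ?_ ?_
    · intro j s' hj h8 ha hs' hP
      rw [hH1.reg2] at hj
      have f4 : s'.arr 4 j = obj j := by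
        rw [ha.arr 4 (by decide), ha1.arr 4 (by decide), hsrc j hj]
      have := hobj j hj
      simp only [wp_store, Fits, eval, cost, h8, f4]
      refine ⟨by omega, by omega, hs'.setArr _ _ (by omega), ?_⟩
      intro b hb
      simp only [State.arr_setArr, if_true, Function.update_apply]
      split_ifs with h1
      · exact Or.inl ⟨rfl, j, by omega, h1.symm⟩
      · rcases hP b hb with ⟨h2, e, he, h3⟩ | ⟨h2, h3⟩
        · exact Or.inl ⟨h2, e, by omega, h3⟩
        · refine Or.inr ⟨h2, fun e he heb => ?_⟩
          rcases Nat.lt_succ_iff_lt_or_eq.1 he with h4 | rfl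
          · exact h3 e h4 heb
          · exact h1 heb.symm
    · intro t2 s2 ha2 hs2 hP2 ht2
      rw [hH1.reg2] at hP2 ht2
      exact ⟨hs2, by omega, hP2⟩

/-- Table positions are products of an edge number and a row length; they are the reason for asking
`B * B + B ≤ W`. -/
theorem Table.idx_lt (_hT : Table G m off obj tab own) (hn : p + q + m + 2 < B)
    (hW : B * B + B ≤ W) {e b : ℕ} (he : e < m) (hb : b < q) : e * q < W ∧ e * q + b < W := by
  have h1 : e * q ≤ B * B := Nat.mul_le_mul (by omega) (by omega)
  omega

/-- For each edge, its row is scanned and all edges to objects it dominates are switched off. The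
remaining ones are undominated, which is `FlagInv` as long as no neighbour is lowered. -/
theorem initFlags_spec (hT : Table G m off obj tab own) (hs : Small B s) (hB : 8 < B)
    (hW : B * B + B ≤ W) (hH : Holds p q m off obj tab s) (hn : p + q + m + 2 < B)
    (hsrc : ∀ e < m, s.arr 4 e = obj e) (htgt : ∀ e < m, s.arr 5 e = own e)
    (hflag : ∀ e < m, s.arr 6 e = 1) :
    Wp W initFlags s (fun t s' => Small B s' ∧ t ≤ 50 * (m * (q + 1) + 1) ∧
      ∀ e < m, s'.arr 6 e ≠ 0 ↔ ∀ e' < m, own e' = own e → tab (e' * q + obj e) = 0) := by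
  have hW' : B ≤ W := by
    have := Nat.zero_le (B * B)
    omega
  unfold initFlags
  refine Wp.forArr_const (q * 25 + 20) (fun j A => ∀ e < m, A 6 e ≠ 0 ↔
      ∀ e' < j, own e' = own e → tab (e' * q + obj e) = 0) hs hB hW' (by decide) (by decide)
    (by decide) (fun e he => by simp [hflag e he]) ?_ ?_
  · intro j s' hj h8 ha hs' hP
    rw [hH.reg2] at hj
    have hH' := hH.of_agree ha (by decide)
    have f5 : s'.arr 5 j = own j := by rw [ha.arr 5 (by decide), htgt j hj]
    have hop := hT.own_lt j hj
    rw [wp_seq, wp_assign]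
    simp only [Fits, eval, cost, h8, f5]
    refine ⟨by omega, ?_⟩
    refine forRow_spec hT 17 (fun i A => ∀ e < m, A 6 e ≠ 0 ↔
      (∀ e' < j, own e' = own e → tab (e' * q + obj e) = 0) ∧
        (e < i → own e = own j → tab (j * q + obj e) = 0))
      (hs'.setReg 11 (by omega)) hB hW' (by omega) (by omega) (by simpa using hH'.arr0)
      (by simpa using hop) (by decide) ?_ ?_ ?_
    · intro e he
      simp only [State.arr_setReg, State.reg_setReg, if_true]
      rw [hP e he, iff_self_and]
      intro _ h1 h2
      have := (hT.row _ hop e).2 ⟨he, h2⟩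
      omega
    · intro i s'' hi hoi h9 ha2 hs'' hP2
      simp only [State.reg_setReg, if_true] at hoi
      have g8 : s''.reg 8 = j := (ha2.reg 8 (by decide)).trans (by simpa using h8)
      have g1 : s''.reg 1 = q := (ha2.reg 1 (by decide)).trans (by simpa using hH'.reg1)
      have g4 : s''.arr 4 i = obj i := by
        rw [ha2.arr 4 (by decide), State.arr_setReg, ha.arr 4 (by decide), hsrc i hi]
      have g2 : s''.arr 2 = tab := (ha2.arr 2 (by decide)).trans (by simpa using hH'.arr2)
      have hob := hT.obj_lt i hi
      obtain ⟨hx1, hx2⟩ := hT.idx_lt hn hW hj hob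
      have hx3 := hT.tab_le j hj _ hob
      simp only [wp_cond, wp_store, wp_skip, Fits, eval, cost, h9, g8, g1, g4, g2]
      refine ⟨by omega, fun h1 => ⟨by omega, by omega, hs''.setArr _ _ (by omega), ?_⟩,
        fun h1 => ⟨by omega, hs'', ?_⟩⟩
      · intro e he
        simp only [State.arr_setArr, if_true, Function.update_apply]
        split_ifs with h2
        · subst h2
          simp only [ne_eq, not_true_eq_false, false_iff, not_and]
          exact fun _ h3 => h1 (h3 (Nat.lt_succ_self _) hoi)
        · rw [hP2 e he]
          refine and_congr_right fun _ => ?_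
          rw [show e < i + 1 ↔ e < i by omega]
      · intro e he
        rw [hP2 e he]
        refine and_congr_right fun _ => ⟨fun h2 h3 h4 => ?_, fun h2 h3 h4 => h2 (by omega) h4⟩
        rcases Nat.lt_succ_iff_lt_or_eq.1 h3 with h5 | rfl
        · exact h2 h5 h4
        · exact h1
    · intro t s'' hs'' hP2 ht
      simp only [State.reg_setReg, if_true] at hP2 ht
      have hrc := hT.row_card _ hop
      refine ⟨by omega, hs'', fun e he => ?_⟩
      rw [hP2 e he]
      constructor
      · rintro ⟨h1, h2⟩ e' he' h3
        rcases Nat.lt_succ_iff_lt_or_eq.1 he' with h5 | rfl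
        · exact h1 e' h5 h3
        · exact h2 ((hT.row _ hop e).2 ⟨he, h3.symm⟩).2 h3.symm
      · exact fun h1 => ⟨fun e' he' h3 => h1 e' (by omega) h3,
          fun _ h3 => h1 j (Nat.lt_succ_self _) h3.symm⟩
  · intro t s' ha hs' hP ht
    rw [hH.reg2] at hP ht
    refine ⟨hs', ?_, hP⟩
    have : m * (q * 25 + 20 + 8) = 25 * (m * q) + 28 * m := by ring
    rw [this] at ht
    rw [Nat.mul_succ m q]
    omega

/-- Prepare the first phase. -/
def init : Prog := initRegs ;; initEdges ;; initLow ;; initFlags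

theorem init_spec (hT : Table G m off obj tab own) (hs : Small B s) (hB : 8 < B)
    (hW : B * B + B ≤ W) (hH : Holds p q m off obj tab s) (hn : p + q + m + 2 < B)
    (hpq : 0 < p + q) (hml : ∀ i, s.arr 9 i = 0) :
    Wp W init s (fun t s' => Small B s' ∧ t ≤ 200 * (p + q + m * (q + 1) + 1) ∧
      ∃ K, 0 < K ∧ p + q ≤ K * K ∧ (K - 1) * (K - 1) ≤ p + q ∧
        Ready p q m off obj tab own K s' ∧
        ∀ b < q, s'.arr 17 b = 0 ↔ ∃ e < m, obj e = b) := by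
  have hW' : B ≤ W := by
    have := Nat.zero_le (B * B)
    omega
  unfold init
  rw [wp_seq]
  refine (initRegs_spec hs hB hW hH hn hpq).mono ?_
  rintro t1 s1 ha1 ⟨hs1, ht1, ⟨h4, h5, h6⟩, hK0, hK1, hK2⟩
  have hH1 := hH.of_agree ha1 (by decide)
  rw [wp_seq]
  refine (initEdges_spec hT hs1 hB hW' hH1 hn).mono ?_
  rintro t2 s2 ha2 ⟨hs2, ht2, hE2⟩
  have hH2 := hH1.of_agree ha2 (by decide)
  rw [wp_seq]
  refine (initLow_spec hT.obj_lt hs2 hB hW' hH2 hn fun e he => (hE2 e he).1).mono ?_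
  rintro t3 s3 ha3 ⟨hs3, ht3, hL3⟩
  have hH3 := hH2.of_agree ha3 (by decide)
  have c4 : s3.arr 4 = s2.arr 4 := ha3.arr 4 (by decide)
  have c5 : s3.arr 5 = s2.arr 5 := ha3.arr 5 (by decide)
  have c6 : s3.arr 6 = s2.arr 6 := ha3.arr 6 (by decide)
  refine (initFlags_spec hT hs3 hB hW hH3 hn (fun e he => c4 ▸ (hE2 e he).1)
    (fun e he => c5 ▸ (hE2 e he).2.1) (fun e he => c6 ▸ (hE2 e he).2.2)).mono ?_
  rintro t4 s4 ha4 ⟨hs4, ht4, hF4⟩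
  have d17 : s4.arr 17 = s3.arr 17 := ha4.arr 17 (by decide)
  have hlow0 : ∀ e < m, s3.arr 17 (obj e) = 0 := fun e he => by
    rcases hL3 _ (hT.obj_lt e he) with h | h
    · exact h.1
    · exact absurd rfl (h.2 e he)
  have hreg : ∀ x, x = 4 ∨ x = 5 ∨ x = 6 ∨ x = 7 → s4.reg x = s1.reg x := by
    rintro x (rfl | rfl | rfl | rfl) <;>
      rw [ha4.reg _ (by decide), ha3.reg _ (by decide), ha2.reg _ (by decide)]
  refine ⟨hs4, ?_, s1.reg 7, hK0, hK1, hK2, ⟨hH3.of_agree ha4 (by decide), ?_, ?_, ?_, ?_, ?_, ?_,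
    ?_, ?_, ?_⟩, ?_⟩
  · rw [Nat.mul_succ m q] at ht4 ⊢
    omega
  · rw [hreg 4 (by simp), h4]
  · rw [hreg 5 (by simp), h5]
  · rw [hreg 6 (by simp), h6]
  · exact hreg 7 (by simp)
  · intro e he
    rw [ha4.arr 4 (by decide), c4, (hE2 e he).1]
  · intro e he
    rw [ha4.arr 5 (by decide), c5, (hE2 e he).2.1]
  · intro b hb
    rw [d17]
    rcases hL3 b hb with h | h
    exacts [Or.inl h.1, Or.inr h.1]
  · intro e he
    rw [hF4 e he, iff_self_and, d17]
    exact fun _ e' he' _ h => absurd (hlow0 e' he') h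
  · intro i _
    rw [ha4.arr 9 (by decide), ha3.arr 9 (by decide), ha2.arr 9 (by decide),
      ha1.arr 9 (by decide), hml]
  · intro b hb
    rw [d17]
    rcases hL3 b hb with h | h
    · exact iff_of_true h.1 h.2
    · refine iff_of_false (by rw [h.1]; decide) ?_
      rintro ⟨e, he, heb⟩
      exact h.2 e he heb

end RAM

namespace RAM

open RAM.Expr RAM.Prog

/-! ### Lowering objects -/

/-- Lower the objects in the queue, and switch off the edges to objects that do not dominate them. -/
def lower : Prog :=
  forTo 8 (const 0) 14 (store 17 (read 13 (reg 8)) (const 1)) ;;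
  forTo 8 (const 0) 2 (cond (sub (read 17 (read 4 (reg 8))) (const 1)) skip
    (cond (read 17 (read 4 (reg 8))) (assign 11 (read 5 (reg 8)) ;;
      forRow (cond (read 2 (add (mul (reg 9) (reg 1)) (read 4 (reg 8)))) skip
        (store 6 (reg 9) (const 0)))) skip)) ;;
  forTo 8 (const 0) 1 (cond (read 17 (reg 8)) (store 17 (reg 8) (const 2)) skip)

/-- The number of edges to objects that are not lowered. -/
def upperEdges (m : ℕ) (obj low : ℕ → ℕ) : ℕ := ((Finset.range m).filter fun e => low (obj e) = 0).card

variable {W B : ℕ} {s : State} {p q m : ℕ} {G : PrefInstance (Fin p) (Fin q)}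
  {off obj tab own : ℕ → ℕ} {K : ℕ}

/-- A row is scanned only for an edge whose object is newly lowered. Such an edge stops counting in
`upperEdges`, which therefore serves as an amortized budget across all phases. -/
theorem lower_spec (hT : Table G m off obj tab own) (hs : Small B s) (hB : 8 < B)
    (hW : B * B + B ≤ W) (hR : Ready p q m off obj tab own K s) (hn : p + q + m + 2 < B)
    (hqt : s.reg 14 ≤ q) (hque : ∀ i < s.reg 14, s.arr 13 i < q ∧ s.arr 17 (s.arr 13 i) = 0) :
    Wp W lower s (fun t s' => Small B s' ∧ Ready p q m off obj tab own K s' ∧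
      (∀ b < q, s'.arr 17 b = 0 ↔ s.arr 17 b = 0 ∧ ∀ i < s.reg 14, s.arr 13 i ≠ b) ∧
      t + 50 * (q + 1) * upperEdges m obj (s'.arr 17) ≤
        100 * (m + q + 1) + 50 * (q + 1) * upperEdges m obj (s.arr 17)) := by
  have hW' : B ≤ W := by
    have := Nat.zero_le (B * B)
    omega
  have hH := hR.holds
  unfold lower
  rw [wp_seq]
  -- Mark `1` means lowered just now and `2` lowered earlier; the last loop turns all marks into
  -- `2`.
  refine Wp.forArr_const 6 (fun j A => ∀ b < q,
    (A 17 b = 1 ∧ ∃ i < j, s.arr 13 i = b) ∨ (A 17 b = s.arr 17 b ∧ ∀ i < j, s.arr 13 i ≠ b))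
    hs hB hW' (by decide) (by decide) (by decide) (fun b _ => Or.inr ⟨rfl, by simp⟩) ?_ ?_
  · intro j s' hj h8 ha hs' hP
    have f13 : s'.arr 13 = s.arr 13 := ha.arr 13 (by decide)
    have := hque j hj
    simp only [wp_store, Fits, eval, cost, h8, f13]
    refine ⟨by omega, by omega, hs'.setArr _ _ (by omega), ?_⟩
    intro b hb
    simp only [State.arr_setArr, if_true, Function.update_apply]
    split_ifs with h1
    · exact Or.inl ⟨rfl, j, Nat.lt_succ_self _, h1.symm⟩
    · rcases hP b hb with ⟨h2, i, hi, h3⟩ | ⟨h2, h3⟩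
      · exact Or.inl ⟨h2, i, by omega, h3⟩
      · refine Or.inr ⟨h2, fun i hi h4 => ?_⟩
        rcases Nat.lt_succ_iff_lt_or_eq.1 hi with h5 | rfl
        exacts [h3 i h5 h4, h1 h4.symm]
  intro t1 s1 ha1 hs1 hP1 ht1
  have hH1 := hH.of_agree ha1 (by decide)
  have c4 : s1.arr 4 = s.arr 4 := ha1.arr 4 (by decide)
  have c5 : s1.arr 5 = s.arr 5 := ha1.arr 5 (by decide)
  have c6 : s1.arr 6 = s.arr 6 := ha1.arr 6 (by decide)
  set low := s1.arr 17 with hlow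
  have hle2 : ∀ b < q, low b ≤ 2 := fun b hb => by
    rcases hP1 b hb with h | h
    · omega
    · rcases hR.low b hb with h1 | h1 <;> omega
  rw [wp_seq]
  -- The time of an iteration depends on the edge: only newly lowered objects pay for a row scan.
  refine Wp.forArr (fun e => (if low (obj e) = 1 then 25 * q + 40 else 0) + 20)
    (fun j A => ∀ e < m, A 6 e ≠ 0 ↔ s.arr 6 e ≠ 0 ∧
      ∀ e' < j, own e' = own e → low (obj e') = 1 → tab (e * q + obj e') ≠ 0)
    hs1 hB hW' (by simp only [Fits]; omega) (by decide) (by decide) (by decide) (Nat.zero_le _)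
    (fun e he => by simp [eval, c6]) ?_ ?_
  · intro j s' _ hj h8 ha hs' hP
    rw [hH1.reg2] at hj
    have hH' := hH1.of_agree ha (by decide)
    have f4 : s'.arr 4 j = obj j := by rw [ha.arr 4 (by decide), c4, hR.src j hj]
    have f5 : s'.arr 5 j = own j := by rw [ha.arr 5 (by decide), c5, hR.tgt j hj]
    have f17 : s'.arr 17 = low := ha.arr 17 (by decide)
    have hop := hT.own_lt j hj
    have hoq := hT.obj_lt j hj
    have hl2 := hle2 _ hoq
    have hskip : low (obj j) ≠ 1 → ∀ e < m, s'.arr 6 e ≠ 0 ↔ s.arr 6 e ≠ 0 ∧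
        ∀ e' < j + 1, own e' = own e → low (obj e') = 1 → tab (e * q + obj e') ≠ 0 := by
      intro h1 e he
      rw [hP e he]
      refine and_congr_right fun _ => ⟨fun h2 e' he' h3 h4 => ?_, fun h2 e' he' => h2 e' (by omega)⟩
      rcases Nat.lt_succ_iff_lt_or_eq.1 he' with h5 | rfl
      exacts [h2 e' h5 h3 h4, absurd h4 h1]
    rw [wp_cond]
    simp only [Fits, eval, cost, h8, f4, f17, wp_skip]
    refine ⟨by omega, fun h1 => ⟨by omega, hs', hskip (by omega)⟩, fun h1 => ?_⟩
    rw [wp_cond]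
    simp only [Fits, eval, cost, h8, f4, f17, wp_skip]
    refine ⟨by omega, fun h2 => ?_, fun h2 => ⟨by omega, hs', hskip (by omega)⟩⟩
    have hl1 : low (obj j) = 1 := by omega
    rw [wp_seq, wp_assign]
    simp only [Fits, eval, cost, h8, f5]
    refine ⟨by omega, ?_⟩
    refine forRow_spec hT 17 (fun i A => ∀ e < m, A 6 e ≠ 0 ↔
      (s.arr 6 e ≠ 0 ∧
        ∀ e' < j, own e' = own e → low (obj e') = 1 → tab (e * q + obj e') ≠ 0) ∧
        (e < i → own e = own j → tab (e * q + obj j) ≠ 0))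
      (hs'.setReg 11 (by omega)) hB hW' (by omega) (by omega) (by simpa using hH'.arr0)
      (by simpa using hop) (by decide) ?_ ?_ ?_
    · intro e he
      simp only [State.arr_setReg, State.reg_setReg, if_true]
      rw [hP e he, iff_self_and]
      intro _ h3 h4
      have := (hT.row _ hop e).2 ⟨he, h4⟩
      omega
    · intro i s'' hi hoi h9 ha2 hs'' hP2
      simp only [State.reg_setReg, if_true] at hoi
      have g8 : s''.reg 8 = j := (ha2.reg 8 (by decide)).trans (by simpa using h8)
      have g1 : s''.reg 1 = q := (ha2.reg 1 (by decide)).trans (by simpa using hH'.reg1)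
      have g4 : s''.arr 4 j = obj j := by rw [ha2.arr 4 (by decide), State.arr_setReg, f4]
      have g2 : s''.arr 2 = tab := (ha2.arr 2 (by decide)).trans (by simpa using hH'.arr2)
      obtain ⟨hx1, hx2⟩ := hT.idx_lt hn hW hi hoq
      have hx3 := hT.tab_le i hi _ hoq
      simp only [wp_cond, wp_store, wp_skip, Fits, eval, cost, h9, g8, g1, g4, g2]
      refine ⟨by omega, fun h1 => ⟨by omega, hs'', ?_⟩,
        fun h1 => ⟨by omega, by omega, hs''.setArr _ _ (by omega), ?_⟩⟩
      · intro e he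
        rw [hP2 e he]
        refine and_congr_right fun _ => ⟨fun h2 h3 h4 => ?_, fun h2 h3 h4 => h2 (by omega) h4⟩
        rcases Nat.lt_succ_iff_lt_or_eq.1 h3 with h5 | rfl
        · exact h2 h5 h4
        · exact h1
      · intro e he
        simp only [State.arr_setArr, if_true, Function.update_apply]
        split_ifs with h2
        · subst h2
          simp only [ne_eq, not_true_eq_false, false_iff, not_and]
          exact fun _ h3 => h3 (Nat.lt_succ_self _) hoi h1
        · rw [hP2 e he]
          refine and_congr_right fun _ => ?_
          rw [show e < i + 1 ↔ e < i by omega]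
    · intro t s'' hs'' hP2 ht
      simp only [State.reg_setReg, if_true] at hP2 ht
      have hrc := hT.row_card _ hop
      rw [if_pos hl1]
      refine ⟨by omega, hs'', fun e he => ?_⟩
      rw [hP2 e he, and_assoc]
      refine and_congr_right fun _ => ⟨?_, fun h1 => ⟨fun e' he' h3 h4 => h1 e' (by omega) h3 h4,
        fun _ h3 => h1 j (Nat.lt_succ_self _) h3.symm hl1⟩⟩
      rintro ⟨h1, h2⟩ e' he' h3 h4
      rcases Nat.lt_succ_iff_lt_or_eq.1 he' with h5 | rfl
      · exact h1 e' h5 h3 h4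
      · exact h2 ((hT.row _ hop e).2 ⟨he, h3.symm⟩).2 h3.symm
  intro t2 s2 ha2 hs2 hP2 ht2
  have hH2 := hH1.of_agree ha2 (by decide)
  have c17 : s2.arr 17 = low := ha2.arr 17 (by decide)
  rw [hH1.reg2] at hP2 ht2
  refine Wp.forArr_const 8 (fun j A => ∀ b, A 17 b = if b < j ∧ low b ≠ 0 then 2 else low b)
    hs2 hB hW' (by decide) (by decide) (by decide) (fun b => by simp [c17]) ?_ ?_
  · intro j s' hj h8 ha hs' hP
    have h17 := hP j
    rw [if_neg (by omega)] at h17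
    rw [hH2.reg1] at hj
    have := hle2 j hj
    simp only [wp_cond, wp_store, wp_skip, Fits, eval, cost, h8, h17]
    refine ⟨by omega, fun h1 => ⟨by omega, by omega, hs'.setArr _ _ (by omega), ?_⟩,
      fun h1 => ⟨by omega, hs', ?_⟩⟩
    · intro b
      simp only [State.arr_setArr, if_true, Function.update_apply, hP b]
      by_cases hb : b = j
      · subst hb
        simp [h1]
      · rw [if_neg hb]
        exact if_congr (and_congr_left fun _ => by omega) rfl rfl
    · intro b
      rw [hP b]
      by_cases hb : b = j
      · subst hb
        simp [h1]
      · exact if_congr (and_congr_left fun _ => by omega) rfl rfl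
  intro t3 s3 ha3 hs3 hP3 ht3
  rw [hH2.reg1] at hP3 ht3
  have c63 : s3.arr 6 = s2.arr 6 := ha3.arr 6 (by decide)
  have hlow3 : ∀ b < q, s3.arr 17 b = 0 ↔ low b = 0 := by
    intro b hb
    rw [hP3 b]
    split_ifs with h
    · simp [h.2]
    · rfl
  have hlow' : ∀ b < q, low b = 0 ↔ s.arr 17 b = 0 ∧ ∀ i < s.reg 14, s.arr 13 i ≠ b := by
    intro b hb
    rcases hP1 b hb with ⟨h1, i, hi, h2⟩ | ⟨h1, h2⟩
    · refine iff_of_false (by omega) fun h => h.2 i hi h2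
    · rw [h1]
      exact ⟨fun h => ⟨h, h2⟩, fun h => h.1⟩
  have hreg : ∀ x, x = 4 ∨ x = 5 ∨ x = 6 ∨ x = 7 → s3.reg x = s.reg x := by
    rintro x (rfl | rfl | rfl | rfl) <;>
      rw [ha3.reg _ (by decide), ha2.reg _ (by decide), ha1.reg _ (by decide)]
  refine ⟨hs3, ⟨hH2.of_agree ha3 (by decide), ?_, ?_, ?_, ?_, ?_, ?_, ?_, ?_, ?_⟩, ?_, ?_⟩
  · rw [hreg 4 (by simp), hR.reg4]
  · rw [hreg 5 (by simp), hR.reg5]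
  · rw [hreg 6 (by simp), hR.reg6]
  · rw [hreg 7 (by simp), hR.reg7]
  · intro e he
    rw [ha3.arr 4 (by decide), ha2.arr 4 (by decide), c4, hR.src e he]
  · intro e he
    rw [ha3.arr 5 (by decide), ha2.arr 5 (by decide), c5, hR.tgt e he]
  · intro b hb
    rw [hP3 b]
    split_ifs with h
    · exact Or.inr rfl
    · exact Or.inl (by tauto)
  · intro e he
    rw [c63, hP2 e he, hR.flag e he, and_assoc]
    refine and_congr_right fun _ => ⟨?_, fun h => ⟨fun e' he' h1 h2 => h e' he' h1 ?_,
      fun e' he' h1 h2 => h e' he' h1 ?_⟩⟩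
    · rintro ⟨h1, h2⟩ e' he' h3 h4
      have hq := hT.obj_lt e' he'
      rw [Ne, hlow3 _ hq] at h4
      rcases hP1 _ hq with ⟨h5, -⟩ | ⟨h5, -⟩
      · exact h2 e' he' h3 h5
      · exact h1 e' he' h3 (h5 ▸ h4)
    · have hq := hT.obj_lt e' he'
      rw [Ne, hlow3 _ hq, hlow' _ hq]
      tauto
    · have hq := hT.obj_lt e' he'
      rw [Ne, hlow3 _ hq]
      omega
  · intro i hi
    rw [ha3.arr 9 (by decide), ha2.arr 9 (by decide), ha1.arr 9 (by decide), hR.ml i hi]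
  · intro b hb
    rw [hlow3 b hb, hlow' b hb]
  · simp only [eval, cost] at ht2
    -- The edges to newly lowered objects counted as upper before and do not any more.
    have hcard : upperEdges m obj (s3.arr 17) +
        ((Finset.range m).filter fun e => low (obj e) = 1).card ≤ upperEdges m obj (s.arr 17) := by
      unfold upperEdges
      rw [← Finset.card_union_of_disjoint]
      · refine Finset.card_le_card fun e he => ?_
        simp only [Finset.mem_union, Finset.mem_filter, Finset.mem_range] at he ⊢
        have hem : e < m := by tauto
        refine ⟨hem, ?_⟩
        rcases he with ⟨-, h⟩ | ⟨-, h⟩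
        · exact ((hlow' _ (hT.obj_lt e hem)).1 ((hlow3 _ (hT.obj_lt e hem)).1 h)).1
        · rcases hP1 _ (hT.obj_lt e hem) with ⟨-, i, hi, h2⟩ | ⟨h1, -⟩
          · rw [← h2]
            exact (hque i hi).2
          · rcases hR.low _ (hT.obj_lt e hem) with h2 | h2 <;> omega
      · rw [Finset.disjoint_left]
        intro e he he'
        simp only [Finset.mem_filter, Finset.mem_range] at he he'
        have := (hlow3 _ (hT.obj_lt e he.1)).1 he.2
        omega
    have hsum : ∑ j ∈ Finset.Ico 0 m, ((if low (obj j) = 1 then 25 * q + 40 else 0) + 20 + 8) =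
        ((Finset.range m).filter fun e => low (obj e) = 1).card * (25 * q + 40) + m * 28 := by
      simp only [add_assoc]
      rw [Finset.sum_add_distrib, ← Finset.sum_filter, Finset.sum_const, Finset.sum_const,
        Nat.card_Ico, smul_eq_mul, smul_eq_mul, Nat.Ico_zero_eq_range]
      rfl
    rw [hsum] at ht2
    have h1 := Nat.mul_le_mul_left (50 * (q + 1)) hcard
    rw [Nat.mul_add] at h1
    have h2 : ((Finset.range m).filter fun e => low (obj e) = 1).card * (25 * q + 40) ≤
        50 * (q + 1) * ((Finset.range m).filter fun e => low (obj e) = 1).card := by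
      rw [Nat.mul_comm]
      exact Nat.mul_le_mul_right _ (by omega)
    omega

end RAM

namespace RAM

open RAM.Expr RAM.Prog

/-! ### The first part of the algorithm -/

/-- The objects that are not lowered. -/
def lowSet (q : ℕ) (low : ℕ → ℕ) : Set (Fin q) := {b | low b = 0}

/-- The pairs of an agent and an object listed by `f`. -/
def pairs (p q : ℕ) (f : ℕ → ℕ) : Finset (Fin p × Fin q) :=
  Finset.univ.filter fun e => f e.1 = e.2 + 1

variable {W B : ℕ} {s s' : State} {p q m : ℕ} {G : PrefInstance (Fin p) (Fin q)}
  {off obj tab own : ℕ → ℕ} {K : ℕ}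

theorem mem_pairs {f : ℕ → ℕ} {a : Fin p} {b : Fin q} : (a, b) ∈ pairs p q f ↔ f a = b + 1 := by
  simp [pairs]

theorem isMatching_pairs {f : ℕ → ℕ} (hE : ∀ (a : Fin p) (b : Fin q), f a = b + 1 → (a, b) ∈ G.E)
    (hinj : ∀ (a a' : Fin p) (b : Fin q), f a = b + 1 → f a' = b + 1 → a = a') :
    G.IsMatching (pairs p q f) := by
  refine ⟨fun ⟨a, b⟩ h => hE a b (mem_pairs.1 h), ?_, ?_⟩
  · rintro ⟨a, b⟩ h ⟨a', b'⟩ h' he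
    have he : a = a' := he
    subst he
    have h1 := mem_pairs.1 h
    have h2 := mem_pairs.1 h'
    have : b = b' := Fin.ext (by omega)
    rw [this]
  · rintro ⟨a, b⟩ h ⟨a', b'⟩ h' he
    have he : b = b' := he
    subst he
    rw [hinj a a' b (mem_pairs.1 h) (mem_pairs.1 h')]

theorem FlagInv.top_iff {low flag : ℕ → ℕ} (hT : Table G m off obj tab own)
    (hF : FlagInv q m obj tab own low flag) {e : ℕ} (he : e < m) {a : Fin p} {b : Fin q}
    (ha : own e = a) (hb : obj e = b) : flag e ≠ 0 ↔ G.TopEdge (lowSet q low) a b := by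
  rw [hF e he]
  constructor
  · rintro ⟨h1, h2⟩
    refine ⟨(hT.edge_iff a b).2 ⟨e, he, ha, hb⟩, fun b' hp => ?_, fun b' hE hb' => ?_⟩
    · obtain ⟨e', he', ha', hb'⟩ := (hT.edge_iff a b').1 (G.pref_nbr _ _ _ hp).1
      have := h1 e' he' (ha'.trans ha.symm)
      rw [hb] at this
      exact (hT.tab_iff e' he' a b' b ha' hb').2 hp this
    · obtain ⟨e', he', ha', hb''⟩ := (hT.edge_iff a b').1 hE
      have := h2 e' he' (ha'.trans ha.symm) (by rw [hb'']; exact hb')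
      rw [hb''] at this
      exact (hT.tab_iff e he a b b' ha hb).1 this
  · rintro ⟨-, h1, h2⟩
    refine ⟨fun e' he' ho => ?_, fun e' he' ho hl => ?_⟩
    · by_contra h3
      rw [hb] at h3
      exact h1 ⟨obj e', hT.obj_lt e' he'⟩ ((hT.tab_iff e' he' a ⟨obj e', hT.obj_lt e' he'⟩ b
        (ho.trans ha) rfl).1 h3)
    · exact (hT.tab_iff e he a b ⟨obj e', hT.obj_lt e' he'⟩ ha hb).2
        (h2 ⟨obj e', hT.obj_lt e' he'⟩ ((hT.edge_iff _ _).2 ⟨e', he', ho.trans ha, rfl⟩) hl)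

theorem Ready.endsLt (h : Ready p q m off obj tab own K s) (hT : Table G m off obj tab own) :
    EndsLt q p m (s.arr 4) (s.arr 5) (s.arr 6) := fun e he _ => by
  rw [h.src e he, h.tgt e he]
  exact ⟨hT.obj_lt e he, hT.own_lt e he⟩

theorem Ready.adj_iff (h : Ready p q m off obj tab own K s) (hT : Table G m off obj tab own)
    {a : Fin p} {b : Fin q} : Adj m (s.arr 4) (s.arr 5) (s.arr 6) b a ↔
      G.TopEdge (lowSet q (s.arr 17)) a b := by
  constructor
  · rintro ⟨e, he, ⟨hf, hs⟩, ht⟩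
    rw [h.src e he] at hs
    rw [h.tgt e he] at ht
    exact (FlagInv.top_iff hT h.flag he ht hs).1 hf
  · intro h1
    obtain ⟨e, he, ha, hb⟩ := (hT.edge_iff a b).1 h1.1
    refine ⟨e, he, ⟨(FlagInv.top_iff hT h.flag he ha hb).2 h1, ?_⟩, ?_⟩
    · rw [h.src e he, hb]
    · rw [h.tgt e he, ha]

theorem Ready.adj_lt (h : Ready p q m off obj tab own K s) (hT : Table G m off obj tab own)
    {r l : ℕ} (ha : Adj m (s.arr 4) (s.arr 5) (s.arr 6) l r) : l < q ∧ r < p := by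
  obtain ⟨e, he, ⟨hf, hs⟩, ht⟩ := ha
  have := h.endsLt hT e he hf
  rwa [hs, ht] at this

theorem Ready.low_of_adj (h : Ready p q m off obj tab own K s) (hT : Table G m off obj tab own)
    {r l : ℕ} (ha : Adj m (s.arr 4) (s.arr 5) (s.arr 6) l r) : s.arr 17 l = 0 := by
  obtain ⟨h1, h2⟩ := h.adj_lt hT ha
  exact ((h.adj_iff hT (a := ⟨r, h2⟩) (b := ⟨l, h1⟩)).1 ha).mem

theorem Ready.of_agree (h : Ready p q m off obj tab own K s) {c : Prog} (ha : Agree c s s')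
    (hc : ∀ x < 8, (x = 3 ∨ x ∉ c.regs) ∧ (x = 3 ∨ x = 7 ∨ x ∉ c.arrs)) (hc' : 17 ∉ c.arrs)
    (hml : ∀ i, q ≤ i → s'.arr 9 i = s.arr 9 i) : Ready p q m off obj tab own K s' := by
  have hr : ∀ x < 8, x ≠ 3 → s'.reg x = s.reg x := fun x hx h3 =>
    ha.reg x (((hc x hx).1).resolve_left h3)
  have hr' : ∀ x < 7, x ≠ 3 → s'.arr x = s.arr x := fun x hx h3 =>
    ha.arr x ((((hc x (by omega)).2).resolve_left h3).resolve_left (by omega))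
  have h17 := ha.arr 17 hc'
  refine ⟨⟨?_, ?_, ?_, ?_, ?_, ?_⟩, ?_, ?_, ?_, ?_, ?_, ?_, ?_, ?_, ?_⟩
  · rw [hr 0 (by decide) (by decide), h.holds.reg0]
  · rw [hr 1 (by decide) (by decide), h.holds.reg1]
  · rw [hr 2 (by decide) (by decide), h.holds.reg2]
  · rw [hr' 0 (by decide) (by decide), h.holds.arr0]
  · rw [hr' 1 (by decide) (by decide), h.holds.arr1]
  · rw [hr' 2 (by decide) (by decide), h.holds.arr2]
  · rw [hr 4 (by decide) (by decide), h.reg4]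
  · rw [hr 5 (by decide) (by decide), h.reg5]
  · rw [hr 6 (by decide) (by decide), h.reg6]
  · rw [hr 7 (by decide) (by decide), h.reg7]
  · rw [hr' 4 (by decide) (by decide)]
    exact h.src
  · rw [hr' 5 (by decide) (by decide)]
    exact h.tgt
  · rw [h17]
    exact h.low
  · rw [h17, hr' 6 (by decide) (by decide)]
    exact h.flag
  · intro i hi
    rw [hml i hi, h.ml i hi]

/-- Match as many undominated objects as possible. -/
def phase : Prog := buildLists ;; auctionInit ;; auctionLoop ;; cover

/-- A time bound for one phase, including the lowering of objects. -/
def phaseTime (p q m K : ℕ) : ℕ := 1000 * ((p + q + m + 1) * (K + 2))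

/-- The objects are the left vertices and the agents the right ones. The auction yields a matching
with deficit at most `K` against any other, which is the bound `D` for the searches in `cover`. -/
theorem phase_spec (hT : Table G m off obj tab own) (hs : Small B s) (hB : 8 < B)
    (hW : 2 * B ≤ W) (hR : Ready p q m off obj tab own K s) (hK : 0 < K) (hpK : p ≤ K * K) :
    Wp W phase s (fun t s' => Small B s' ∧ Ready p q m off obj tab own K s' ∧
      s'.arr 17 = s.arr 17 ∧ t + 100 * (m + q + 1) + 10 ≤ phaseTime p q m K ∧
      Mates q p (Adj m (s'.arr 4) (s'.arr 5) (s'.arr 6)) (s'.arr 9) (s'.arr 10) ∧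
      (s'.reg 23 = 0 → ∀ b < q, s'.arr 17 b = 0 → s'.arr 9 b ≠ 0) ∧
      (s'.reg 23 ≠ 0 → ∃ v < q, s'.arr 17 v = 0 ∧ s'.arr 9 v = 0 ∧
        Stuck q p (Adj m (s'.arr 4) (s'.arr 5) (s'.arr 6)) (s'.arr 10) v (s'.arr 13)
          (s'.reg 14))) := by
  unfold phase
  rw [wp_seq]
  have hlt : EndsLt (s.reg 4) (s.reg 5) (s.reg 6) (s.arr 4) (s.arr 5) (s.arr 6) := by
    rw [hR.reg4, hR.reg5, hR.reg6]
    exact hR.endsLt hT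
  have hskip : ∀ e < s.reg 6, s.arr 6 e ≠ 0 → s.arr 17 (s.arr 4 e) = 0 := fun e he hf =>
    hR.low_of_adj hT ⟨e, hR.reg6 ▸ he, ⟨hf, rfl⟩, rfl⟩
  refine (buildLists_spec hs hB (by omega) hlt).mono ?_
  rintro t1 s1 ha1 ⟨hs1, hl1, ht1⟩
  have hR1 := hR.of_agree ha1 (by decide) (by decide) fun i _ => by rw [ha1.arr 9 (by decide)]
  have q4 : s1.reg 4 = s.reg 4 := ha1.reg 4 (by decide)
  have q5 : s1.reg 5 = s.reg 5 := ha1.reg 5 (by decide)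
  have q6 : s1.reg 6 = s.reg 6 := ha1.reg 6 (by decide)
  have c4 : s1.arr 4 = s.arr 4 := ha1.arr 4 (by decide)
  have c5 : s1.arr 5 = s.arr 5 := ha1.arr 5 (by decide)
  have c6 : s1.arr 6 = s.arr 6 := ha1.arr 6 (by decide)
  have c17 : s1.arr 17 = s.arr 17 := ha1.arr 17 (by decide)
  rw [← q4, ← q5, ← q6, ← c4, ← c5, ← c6] at hlt
  rw [← q4, ← q6, ← c4, ← c6] at hl1
  rw [wp_seq]
  refine (auctionInit_spec hs1 hB (by omega) hlt hl1 K).mono ?_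
  rintro t2 s2 ha2 ⟨hs2, ht2, hA2, -, -, ho2⟩
  have hR2 := hR1.of_agree ha2 (by decide) (by decide) (hR1.reg4 ▸ ho2)
  rw [← ha2.reg 4 (by decide), ← ha2.reg 5 (by decide), ← ha2.reg 6 (by decide),
    ← ha2.arr 4 (by decide), ← ha2.arr 5 (by decide), ← ha2.arr 6 (by decide)] at hlt hA2
  rw [← ha2.reg 4 (by decide), ← ha2.reg 6 (by decide), ← ha2.arr 4 (by decide),
    ← ha2.arr 6 (by decide), ← ha2.arr 7 (by decide), ← ha2.arr 8 (by decide)] at hl1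
  rw [← ha2.arr 17 (by decide)] at hA2 c17
  rw [wp_seq]
  refine (auctionLoop_spec hs2 hB hW hlt hl1 (hR2.reg7.symm ▸ hK) (hR2.reg7.symm ▸ hA2)).mono ?_
  rintro t3 s3 ha3 ⟨hs3, ht3, hA3, ho3⟩
  have hR3 := hR2.of_agree ha3 (by decide) (by decide) (hR2.reg4 ▸ ho3)
  rw [← ha3.reg 4 (by decide), ← ha3.reg 5 (by decide), ← ha3.reg 6 (by decide),
    ← ha3.arr 4 (by decide), ← ha3.arr 5 (by decide), ← ha3.arr 6 (by decide)] at hlt hA3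
  rw [← ha3.reg 4 (by decide), ← ha3.reg 6 (by decide), ← ha3.arr 4 (by decide),
    ← ha3.arr 6 (by decide), ← ha3.arr 7 (by decide), ← ha3.arr 8 (by decide)] at hl1
  rw [← ha3.arr 17 (by decide)] at hA3 c17
  rw [hR2.reg7] at hA3
  have hskip3 : ∀ e < s3.reg 6, s3.arr 6 e ≠ 0 → s3.arr 17 (s3.arr 4 e) = 0 := fun e he hf =>
    hR3.low_of_adj hT ⟨e, hR3.reg6 ▸ he, ⟨hf, rfl⟩, rfl⟩
  refine (cover_spec hs3 hB hW hlt hl1 hA3.mates K fun ml mr hM =>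
    hA3.card_uncovered_le hskip3 hK (by rw [hR3.reg5]; exact hpK) hM).mono ?_
  rintro t4 s4 ha4 ⟨hs4, ht4, ho4, hM4, -, h0, h1⟩
  have hR4 := hR3.of_agree ha4 (by decide) (by decide) (hR3.reg4 ▸ ho4)
  rw [← ha4.arr 17 (by decide)] at h0 h1 c17
  rw [hR3.reg4, hR3.reg5, hR3.reg6, ← ha4.arr 4 (by decide), ← ha4.arr 5 (by decide),
    ← ha4.arr 6 (by decide)] at hM4 h1
  rw [hR3.reg4] at h0
  refine ⟨hs4, hR4, c17, ?_, hM4, h0, h1⟩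
  rw [hR.reg4, hR.reg6] at ht1
  rw [hR1.reg4, hR1.reg5] at ht2
  rw [hR2.reg4, hR2.reg5, hR2.reg6, hR2.reg7] at ht3
  rw [hR3.reg4, hR3.reg5, hR3.reg6] at ht4
  unfold phaseTime
  have e1 : (p + q + m + 1) * (K + 2) = (m + q + p) * K + K + 2 * (m + q + p + 1) := by ring
  have e2 : (K + 2) * (160 * (q + p + m + 1)) = 160 * ((p + q + m + 1) * (K + 2)) := by ring
  rw [e2, e1] at ht4
  rw [e1]
  omega

/-- Lower objects until all objects that are not lowered are matched. -/
def raiseLoop : Prog :=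
  assign 24 (const 1) ;;
  loop (reg 24) (phase ;; cond (reg 23) lower (assign 24 (const 0)))

/-- The number of objects that are not lowered. -/
def upperObjects (q : ℕ) (low : ℕ → ℕ) : ℕ := ((Finset.range q).filter fun b => low b = 0).card

/-- Every certificate lies above the lowered objects. -/
def CertBound (G : PrefInstance (Fin p) (Fin q)) (low : ℕ → ℕ) : Prop :=
  ∀ S' M, G.Certifies S' M → S' ⊆ lowSet q low

theorem Ready.isMatching (hR : Ready p q m off obj tab own K s) (hT : Table G m off obj tab own)
    {ml mr : ℕ → ℕ} (hM : Mates q p (Adj m (s.arr 4) (s.arr 5) (s.arr 6)) ml mr) :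
    G.IsMatching (pairs p q mr) ∧
      (∀ a b, (a, b) ∈ pairs p q mr → G.TopEdge (lowSet q (s.arr 17)) a b) ∧
      ∀ (a : Fin p) (b : Fin q), (a, b) ∈ pairs p q mr ↔ ml b = a + 1 := by
  have h1 : ∀ (a : Fin p) (b : Fin q), mr a = b + 1 ↔ ml b = a + 1 := fun a b =>
    ⟨fun h => (hM.right a a.2 b h).2, fun h => (hM.left b b.2 a h).2.2⟩
  have h2 : ∀ (a : Fin p) (b : Fin q), mr a = b + 1 → G.TopEdge (lowSet q (s.arr 17)) a b :=
    fun a b h => (hR.adj_iff hT).1 (hM.left b b.2 a ((h1 a b).1 h)).2.1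
  refine ⟨isMatching_pairs (fun a b h => (h2 a b h).1) fun a a' b h h' => ?_,
    fun a b h => h2 a b (mem_pairs.1 h), fun a b => mem_pairs.trans (h1 a b)⟩
  have := ((h1 a b).1 h).symm.trans ((h1 a' b).1 h')
  exact Fin.ext (by omega)

/-- The queue of the stuck search is the set `R` of `Certifies.disjoint_of_deficient`: `closed`
gives the neighbours' partners and `reach` gives minimality. -/
theorem CertBound.lower (hT : Table G m off obj tab own) (hR : Ready p q m off obj tab own K s)
    (hC : CertBound G (s.arr 17)) {ml mr que low : ℕ → ℕ} {v qt : ℕ}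
    (hM : Mates q p (Adj m (s.arr 4) (s.arr 5) (s.arr 6)) ml mr) (hml : ml v = 0)
    (hS : Stuck q p (Adj m (s.arr 4) (s.arr 5) (s.arr 6)) mr v que qt)
    (hlow : ∀ b < q, low b = 0 ↔ s.arr 17 b = 0 ∧ ∀ i < qt, que i ≠ b) : CertBound G low := by
  intro S' M hcert b hb
  obtain ⟨hN, hNS, hmem⟩ := hR.isMatching hT hM
  have hv : v < q := hS.start ▸ hS.lt 0 hS.pos
  refine (hlow b b.2).2 ⟨hC S' M hcert hb, fun i hi hib => ?_⟩
  refine Set.disjoint_left.1 (hcert.disjoint_of_deficient (hC S' M hcert) hN hNS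
    (R := {b : Fin q | ∃ i < qt, que i = b}) (b₀ := ⟨v, hv⟩) ⟨0, hS.pos, hS.start⟩ ?_ ?_ ?_)
    ⟨i, hi, hib⟩ hb
  · intro a ha
    have := (hmem _ _).1 ha
    change ml v = a + 1 at this
    omega
  · rintro b ⟨i, hi, hib⟩ a hab
    obtain ⟨j, hj, hmj⟩ := hS.closed i hi a a.2 (hib ▸ (hR.adj_iff hT).2 hab)
    exact ⟨⟨que j, hS.lt j hj⟩, ⟨j, hj, rfl⟩, mem_pairs.2 hmj⟩
  · rintro Z hvZ hcl b ⟨i, hi, hib⟩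
    obtain ⟨x, hx, hxb⟩ := hS.reach {l | ∃ x ∈ Z, (x : ℕ) = l} ⟨_, hvZ, rfl⟩ (by
      rintro l ⟨x, hx, rfl⟩ r hr l' hl'
      have hrp := (hR.adj_lt hT hr).2
      have hlq := (hM.right r hrp l' hl').1
      exact ⟨⟨l', hlq⟩, hcl x hx ⟨r, hrp⟩ ((hR.adj_iff hT).1 hr) _ (mem_pairs.2 hl'), rfl⟩) i hi
    have : x = b := Fin.ext (hxb.trans hib)
    exact this ▸ hx

/-- Every visited object other than the start is matched by a top edge, so the search stays among
objects that have not been lowered. -/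
theorem Stuck.low (hT : Table G m off obj tab own) (hR : Ready p q m off obj tab own K s)
    {ml mr que : ℕ → ℕ} {v qt : ℕ}
    (hM : Mates q p (Adj m (s.arr 4) (s.arr 5) (s.arr 6)) ml mr) (hv : s.arr 17 v = 0)
    (hS : Stuck q p (Adj m (s.arr 4) (s.arr 5) (s.arr 6)) mr v que qt) :
    ∀ i < qt, s.arr 17 (que i) = 0 :=
  hS.reach {l | s.arr 17 l = 0} hv fun l _ r hr l' hl' => by
    have hrp := (hR.adj_lt hT hr).2
    obtain ⟨h1, h2⟩ := hM.right r hrp l' hl'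
    exact hR.low_of_adj hT (hM.left l' h1 r h2).2.1

theorem raiseLoop_spec (hT : Table G m off obj tab own) (hs : Small B s) (hB : 8 < B)
    (hW : B * B + B ≤ W) (hR : Ready p q m off obj tab own K s) (hK : 0 < K) (hpK : p ≤ K * K)
    (hn : p + q + m + 2 < B) (hC : CertBound G (s.arr 17)) :
    Wp W raiseLoop s (fun t s' => Small B s' ∧ Ready p q m off obj tab own K s' ∧
      CertBound G (s'.arr 17) ∧
      Mates q p (Adj m (s'.arr 4) (s'.arr 5) (s'.arr 6)) (s'.arr 9) (s'.arr 10) ∧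
      (∀ b < q, s'.arr 17 b = 0 → s'.arr 9 b ≠ 0) ∧
      t ≤ (upperObjects q (s.arr 17) + 1) * phaseTime p q m K +
        50 * (q + 1) * upperEdges m obj (s.arr 17) + 10) := by
  have hW2 : 2 * B ≤ W := by
    have := Nat.mul_le_mul_right B hB.le
    omega
  unfold raiseLoop
  rw [wp_seq, wp_assign]
  refine ⟨by simp only [Fits]; omega, ?_⟩
  set T := phaseTime p q m K with hTdef
  have hR' : Ready p q m off obj tab own K (s.setReg 24 1) :=
    hR.of_agree (c := assign 24 (const 1)) ⟨fun x hx => by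
      rw [State.reg_setReg, if_neg (by simpa [Prog.regs] using hx)], fun _ _ => rfl⟩ (by decide)
      (by decide) fun _ _ => rfl
  refine Wp.loop (fun s' => Small B s' ∧ Ready p q m off obj tab own K s' ∧
      CertBound G (s'.arr 17) ∧ (s'.reg 24 = 0 →
      Mates q p (Adj m (s'.arr 4) (s'.arr 5) (s'.arr 6)) (s'.arr 9) (s'.arr 10) ∧
      ∀ b < q, s'.arr 17 b = 0 → s'.arr 9 b ≠ 0))
    -- An unsuccessful phase lowers at least the uncovered object `v`, so the objects not yet
    -- lowered bound the number of phases to come.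
    (fun s' => (if s'.reg 24 = 0 then 0 else (upperObjects q (s'.arr 17) + 1) * T) +
      50 * (q + 1) * upperEdges m obj (s'.arr 17)) ?_ ?_ ?_ ?_
  · exact ⟨hs.setReg _ (by simp only [eval]; omega), hR', hC, fun h => by simp [eval] at h⟩
  · rintro s' - ⟨hsm, -⟩
    have := hsm.reg 24
    simp only [Fits]
    omega
  · rintro s1 - ⟨hs1, hR1, hC1, -⟩ hne
    simp only [eval] at hne
    rw [wp_seq]
    refine (phase_spec hT hs1 hB hW2 hR1 hK hpK).mono ?_
    rintro t2 s2 ha2 ⟨hs2, hR2, h17, ht2, hM2, h0, h1⟩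
    have h24 : s2.reg 24 ≠ 0 := by rwa [ha2.reg 24 (by decide)]
    have h23 := hs2.reg 23
    rw [wp_cond]
    refine ⟨by simp only [Fits]; omega, fun h => ?_, fun h => ?_⟩
    · obtain ⟨v, hv, hv17, hv9, hS⟩ := h1 h
      have hlow0 := Stuck.low hT hR2 hM2 hv17 hS
      refine (lower_spec hT hs2 hB hW hR2 hn hS.le fun i hi => ⟨hS.lt i hi, hlow0 i hi⟩).mono ?_
      rintro t3 s3 ha3 ⟨hs3, hR3, hl3, ht3⟩
      have h24' : s3.reg 24 ≠ 0 := by rwa [ha3.reg 24 (by decide)]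
      refine ⟨⟨hs3, hR3, CertBound.lower hT hR2 (h17 ▸ hC1) hM2 hv9 hS hl3,
        fun h => absurd h h24'⟩, ?_⟩
      have hcnt : upperObjects q (s3.arr 17) + 1 ≤ upperObjects q (s1.arr 17) := by
        rw [← h17]
        refine Finset.card_lt_card ((Finset.ssubset_iff_of_subset ?_).2 ⟨v, ?_, ?_⟩)
        · intro b hb
          simp only [Finset.mem_filter, Finset.mem_range] at hb ⊢
          exact ⟨hb.1, ((hl3 b hb.1).1 hb.2).1⟩
        · simp only [Finset.mem_filter, Finset.mem_range]
          exact ⟨hv, hv17⟩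
        · simp only [Finset.mem_filter, Finset.mem_range, not_and]
          exact fun _ hb => ((hl3 v hv).1 hb).2 0 hS.pos hS.start
      rw [if_neg hne, if_neg h24']
      rw [h17] at ht3
      have hmul := Nat.mul_le_mul_right T hcnt
      rw [Nat.add_mul, Nat.one_mul] at hmul
      rw [Nat.add_mul, Nat.one_mul, Nat.add_mul, Nat.one_mul]
      simp only [cost]
      omega
    · rw [wp_assign]
      have hR3 : Ready p q m off obj tab own K (s2.setReg 24 0) :=
        hR2.of_agree (c := assign 24 (const 0)) ⟨fun x hx => by
          rw [State.reg_setReg, if_neg (by simpa [Prog.regs] using hx)], fun _ _ => rfl⟩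
          (by decide) (by decide) fun _ _ => rfl
      refine ⟨by simp only [Fits]; omega, ⟨hs2.setReg _ (by simp only [eval]; omega), hR3,
        h17 ▸ hC1, fun _ => ⟨hM2, h0 h⟩⟩, ?_⟩
      rw [if_neg hne]
      simp only [cost, eval, State.reg_setReg, State.arr_setReg, if_true, h17]
      rw [Nat.add_mul, Nat.one_mul]
      omega
  · rintro t s' ha ⟨hsm, hR1, hC1, hM1⟩ he ht
    simp only [eval] at he
    obtain ⟨hM1, hcov⟩ := hM1 he
    refine ⟨hsm, hR1, hC1, hM1, hcov, ?_⟩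
    simp only [cost, eval, State.reg_setReg, State.arr_setReg, if_true, he, one_ne_zero,
      if_false] at ht
    simp only [cost]
    omega

end RAM

namespace RAM

open RAM.Expr RAM.Prog

/-! ### The graph of the second part -/

/-- Add an edge from every agent to a last resort object of its own. -/
def lastResorts : Prog :=
  forTo 8 (const 0) 0 (store 6 (add (reg 2) (reg 8)) (const 1) ;;
    store 4 (add (reg 2) (reg 8)) (reg 8) ;;
    store 5 (add (reg 2) (reg 8)) (add (reg 1) (reg 8)))

/-- Switch on the edges to the best lowered objects, and switch off the last resorts of agents with
a lowered neighbour. -/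
def lowFlags : Prog :=
  forTo 8 (const 0) 2 (cond (read 17 (read 4 (reg 8)))
    (store 6 (add (reg 2) (read 5 (reg 8))) (const 0) ;;
      store 6 (reg 8) (const 1) ;;
      assign 11 (read 5 (reg 8)) ;;
      forRow (cond (read 17 (read 4 (reg 9)))
        (cond (read 2 (add (mul (reg 9) (reg 1)) (read 4 (reg 8)))) (store 6 (reg 8) (const 0)) skip)
        skip))
    skip)

/-- Exchange the roles of agents and objects. -/
def swapSides : Prog :=
  forTo 8 (const 0) 2 (store 4 (reg 8) (read 5 (reg 8)) ;; store 5 (reg 8) (read 1 (reg 8))) ;;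
  assign 25 (add (reg 0) (reg 1)) ;;
  forTo 8 (const 0) 25 (assign 11 (read 9 (reg 8)) ;; store 9 (reg 8) (read 10 (reg 8)) ;;
    store 10 (reg 8) (reg 11))

/-- Mark the isolated agents, and load the sizes of the new graph. -/
def skipIsolated : Prog :=
  forTo 8 (const 0) 0 (store 17 (reg 8) (sub (const 1)
    (sub (read 0 (add (reg 8) (const 1))) (read 0 (reg 8))))) ;;
  assign 4 (reg 0) ;;
  assign 5 (add (reg 1) (reg 0)) ;;
  assign 6 (add (reg 2) (reg 0))

/-- Edge `e` belongs to the graph of the second part. -/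
def SecondFlag (q m : ℕ) (obj tab own low flag : ℕ → ℕ) (e : ℕ) : Prop :=
  (low (obj e) = 0 ∧ flag e ≠ 0) ∨ (low (obj e) ≠ 0 ∧
    ∀ e' < m, own e' = own e → low (obj e') ≠ 0 → tab (e' * q + obj e) = 0)

variable {W B : ℕ} {s : State} {p q m : ℕ} {G : PrefInstance (Fin p) (Fin q)}
  {off obj tab own : ℕ → ℕ} {K : ℕ}

theorem lastResorts_spec (hs : Small B s) (hB : 8 < B)
    (hW : B ≤ W) (hH : Holds p q m off obj tab s) (hn : p + q + m + 2 < B) :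
    Wp W lastResorts s (fun t s' => Small B s' ∧ t ≤ 40 * (p + 1) ∧
      (∀ a < p, s'.arr 4 (m + a) = a ∧ s'.arr 5 (m + a) = q + a ∧ s'.arr 6 (m + a) = 1) ∧
      ∀ e < m, s'.arr 4 e = s.arr 4 e ∧ s'.arr 5 e = s.arr 5 e ∧ s'.arr 6 e = s.arr 6 e) := by
  unfold lastResorts
  refine Wp.forArr_const 20 (fun j A =>
    (∀ a < j, A 4 (m + a) = a ∧ A 5 (m + a) = q + a ∧ A 6 (m + a) = 1) ∧
      ∀ e < m, A 4 e = s.arr 4 e ∧ A 5 e = s.arr 5 e ∧ A 6 e = s.arr 6 e)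
    hs hB hW (by decide) (by decide) (by decide) ⟨by simp, by simp⟩ ?_ ?_
  · rintro j s' hj h8 ha hs' ⟨hP1, hP2⟩
    rw [hH.reg0] at hj
    have hH' := hH.of_agree ha (by decide)
    simp only [wp_seq, wp_store, Fits, eval, cost, h8, State.reg_setArr, hH'.reg1, hH'.reg2]
    refine ⟨by omega, by omega, by omega, by omega, ?_, ?_, ?_⟩
    · refine Small.setArr (Small.setArr (Small.setArr hs' _ _ ?_) _ _ ?_) _ _ ?_ <;> omega
    · intro a haj
      simp only [State.arr_setArr, Nat.reduceEqDiff, if_true, if_false, Function.update_apply,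
        Nat.add_left_cancel_iff]
      split_ifs with h1
      · rw [h1]
        exact ⟨rfl, rfl, rfl⟩
      · exact hP1 a (by omega)
    · intro e he
      simp only [State.arr_setArr, Nat.reduceEqDiff, if_true, if_false, Function.update_apply]
      rw [if_neg (by omega), if_neg (by omega), if_neg (by omega)]
      exact hP2 e he
  · rintro t s' ha hs' ⟨hP1, hP2⟩ ht
    rw [hH.reg0] at hP1 ht
    exact ⟨hs', by omega, hP1, hP2⟩

/-- An edge to a lowered object starts with flag `1` and loses it as soon as a lowered neighbour of
the same agent is found to dominate it. Meeting any such edge removes the agent's last resort. -/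
theorem lowFlags_spec (hT : Table G m off obj tab own) (hs : Small B s) (hB : 8 < B)
    (hW : B * B + B ≤ W) (hH : Holds p q m off obj tab s) (hn : p + q + m + 2 < B)
    (hsrc : ∀ e < m, s.arr 4 e = obj e) (htgt : ∀ e < m, s.arr 5 e = own e)
    (hlast : ∀ a < p, s.arr 6 (m + a) = 1) :
    Wp W lowFlags s (fun t s' => Small B s' ∧ t ≤ 70 * (m * (q + 1) + 1) ∧
      (∀ e < m, s'.arr 6 e ≠ 0 ↔ SecondFlag q m obj tab own (s.arr 17) (s.arr 6) e) ∧
      ∀ a < p, s'.arr 6 (m + a) ≠ 0 ↔ ∀ e < m, own e = a → s.arr 17 (obj e) = 0) := by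
  have hW' : B ≤ W := by
    have := Nat.zero_le (B * B)
    omega
  unfold lowFlags
  set low := s.arr 17 with hlow
  set flag := s.arr 6 with hflag
  refine Wp.forArr_const (q * 30 + 50) (fun j A =>
    (∀ e < j, A 6 e ≠ 0 ↔ SecondFlag q m obj tab own low flag e) ∧
    (∀ e < m, j ≤ e → A 6 e = flag e) ∧
      ∀ a < p, A 6 (m + a) ≠ 0 ↔ ∀ e < j, own e = a → low (obj e) = 0)
    hs hB hW' (by decide) (by decide) (by decide)
    ⟨by simp, fun _ _ _ => rfl, fun a ha => by simp [← hflag, hlast a ha]⟩ ?_ ?_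
  · rintro j s' hj h8 ha hs' ⟨hP1, hP2, hP3⟩
    rw [hH.reg2] at hj
    have hH' := hH.of_agree ha (by decide)
    have f4 : ∀ e < m, s'.arr 4 e = obj e := fun e he => by
      rw [ha.arr 4 (by decide), hsrc e he]
    have f5 : s'.arr 5 j = own j := by rw [ha.arr 5 (by decide), htgt j hj]
    have f17 : s'.arr 17 = low := ha.arr 17 (by decide)
    have hop := hT.own_lt j hj
    have hoq := hT.obj_lt j hj
    have hl := hs'.arr 17 (by decide) (obj j)
    rw [f17] at hl
    rw [wp_cond]
    simp only [Fits, eval, cost, h8, f4 j hj, f17, wp_skip]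
    refine ⟨by omega, fun h1 => ?_, fun h1 => ⟨by omega, hs', ?_, fun e he h2 => hP2 e he (by omega),
      ?_⟩⟩
    · simp only [wp_seq, wp_store, wp_assign, Fits, eval, cost, h8, f5, hH'.reg2, State.reg_setArr,
        State.arr_setArr, Nat.reduceEqDiff, if_false]
      refine ⟨by omega, by omega, by omega, ?_⟩
      have hsm : Small B (((s'.setArr 6 (m + own j) 0).setArr 6 j 1).setReg 11 (own j)) := by
        refine Small.setReg (Small.setArr (Small.setArr hs' _ _ ?_) _ _ ?_) _ ?_ <;> omega
      refine forRow_spec hT 22 (fun i A =>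
        (A 6 j ≠ 0 ↔ ∀ e' < i, own e' = own j → low (obj e') ≠ 0 → tab (e' * q + obj j) = 0) ∧
        ∀ x, x ≠ j → A 6 x = if x = m + own j then 0 else s'.arr 6 x)
        hsm hB hW' (by omega) (by omega) (by simpa using hH'.arr0)
        (by simpa using hop) (by decide) ?_ ?_ ?_
      · refine ⟨?_, fun x hx => ?_⟩
        · simp only [State.arr_setReg, State.reg_setReg, State.arr_setArr, if_true,
            Function.update_self]
          refine iff_of_true one_ne_zero fun e' he' h3 _ => ?_
          have h4 := hT.off_le (own j) hop.le
          have := (hT.row _ hop e').2 ⟨by omega, h3⟩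
          omega
        · simp only [State.arr_setReg, State.arr_setArr, if_true, Function.update_apply, if_neg hx]
      · rintro i s'' hi hoi h9 ha2 hs'' ⟨hP4, hP5⟩
        simp only [State.reg_setReg, if_true] at hoi
        have g8 : s''.reg 8 = j := (ha2.reg 8 (by decide)).trans (by simpa using h8)
        have g1 : s''.reg 1 = q := (ha2.reg 1 (by decide)).trans (by simpa using hH'.reg1)
        have g4 : s''.arr 4 = s'.arr 4 := ha2.arr 4 (by decide)
        have g17 : s''.arr 17 = low := (ha2.arr 17 (by decide)).trans f17
        have g2 : s''.arr 2 = tab := (ha2.arr 2 (by decide)).trans hH'.arr2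
        have hoi' := hT.obj_lt i hi
        obtain ⟨hx1, hx2⟩ := hT.idx_lt hn hW hi hoq
        have hx3 := hT.tab_le i hi _ hoq
        have hli := hs''.arr 17 (by decide) (obj i)
        rw [g17] at hli
        simp only [wp_cond, wp_store, wp_skip, Fits, eval, cost, h9, g8, g1, g4, g2, g17,
          f4 i hi, f4 j hj]
        have hstay : (low (obj i) ≠ 0 → tab (i * q + obj j) = 0) →
            (s''.arr 6 j ≠ 0 ↔ ∀ e' < i + 1, own e' = own j → low (obj e') ≠ 0 →
              tab (e' * q + obj j) = 0) := by
          intro h2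
          rw [hP4]
          refine ⟨fun h3 e' he' h4 h5 => ?_, fun h3 e' he' => h3 e' (by omega)⟩
          rcases Nat.lt_succ_iff_lt_or_eq.1 he' with h6 | rfl
          exacts [h3 e' h6 h4 h5, h2 h5]
        refine ⟨by omega, fun h2 => ⟨by omega, fun h3 => ⟨by omega, by omega,
          hs''.setArr _ _ (by omega), ?_, ?_⟩, fun h3 => ⟨by omega, hs'', hstay fun _ => h3, hP5⟩⟩,
          fun h2 => ⟨by omega, hs'', hstay fun h3 => absurd h2 h3, hP5⟩⟩
        · simp only [State.arr_setArr, if_true, Function.update_self]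
          exact iff_of_false (fun h4 => h4 rfl) fun h4 => h3 (h4 i (Nat.lt_succ_self _) hoi h2)
        · intro x hx
          simp only [State.arr_setArr, if_true, Function.update_apply, if_neg hx]
          exact hP5 x hx
      · rintro t s'' hs'' ⟨hP4, hP5⟩ ht
        simp only [State.reg_setReg, if_true] at hP4 ht
        have hrc := hT.row_card _ hop
        refine ⟨by omega, hs'', ?_, ?_, ?_⟩
        · intro e he
          rcases Nat.lt_succ_iff_lt_or_eq.1 he with h6 | rfl
          · rw [hP5 e (by omega), if_neg (by omega)]
            exact hP1 e h6
          · rw [hP4]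
            constructor
            · exact fun h => Or.inr ⟨h1, fun e' he' h3 h4 =>
                h e' ((hT.row _ hop e').2 ⟨he', h3⟩).2 h3 h4⟩
            · rintro (⟨h, -⟩ | ⟨-, h⟩) e' he' h3 h4
              · exact absurd h h1
              · have h5 := hT.off_le (own e + 1) hop
                exact h e' (by omega) h3 h4
        · intro e he h2
          rw [hP5 e (by omega), if_neg (by omega)]
          exact hP2 e he (by omega)
        · intro a hap
          rw [hP5 (m + a) (by omega)]
          split_ifs with h2
          · exact iff_of_false (fun h => h rfl)
              fun h => h1 (h j (Nat.lt_succ_self _) (by omega))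
          · rw [hP3 a hap]
            refine ⟨fun h e he h3 => ?_, fun h e he => h e (by omega)⟩
            rcases Nat.lt_succ_iff_lt_or_eq.1 he with h6 | rfl
            exacts [h e h6 h3, absurd h3 (by omega)]
    · intro e he
      rcases Nat.lt_succ_iff_lt_or_eq.1 he with h6 | rfl
      · exact hP1 e h6
      · rw [hP2 e hj le_rfl]
        exact ⟨fun h => Or.inl ⟨h1, h⟩, fun h => h.elim And.right fun h => absurd h1 h.1⟩
    · intro a hap
      rw [hP3 a hap]
      refine ⟨fun h e he h3 => ?_, fun h e he => h e (by omega)⟩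
      rcases Nat.lt_succ_iff_lt_or_eq.1 he with h6 | rfl
      exacts [h e h6 h3, h1]
  · rintro t s' ha hs' ⟨hP1, -, hP3⟩ ht
    rw [hH.reg2] at hP1 hP3 ht
    refine ⟨hs', ?_, hP1, hP3⟩
    have : m * (q * 30 + 50 + 8) = 30 * (m * q) + 58 * m := by ring
    rw [this] at ht
    rw [Nat.mul_succ m q]
    omega

/-- The first loop overwrites the objects in array `4`, so they are read again from the input. Edges
from `m` on are left alone, because the last resorts were stored with their agents as sources
already. -/
theorem swapSides_spec (hobj : ∀ e < m, obj e < q) (hs : Small B s) (hB : 8 < B)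
    (hW : B ≤ W) (hH : Holds p q m off obj tab s) (hn : p + q + m + 2 < B) :
    Wp W swapSides s (fun t s' => Small B s' ∧ t ≤ 40 * (p + q + m + 1) ∧
      (∀ e < m, s'.arr 4 e = s.arr 5 e ∧ s'.arr 5 e = obj e) ∧
      (∀ e, m ≤ e → s'.arr 4 e = s.arr 4 e ∧ s'.arr 5 e = s.arr 5 e) ∧
      ∀ i < p + q, s'.arr 9 i = s.arr 10 i ∧ s'.arr 10 i = s.arr 9 i) := by
  unfold swapSides
  rw [wp_seq]
  refine Wp.forArr_const 12 (fun j A =>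
    (∀ e < j, A 4 e = s.arr 5 e ∧ A 5 e = obj e) ∧
      ∀ e, j ≤ e → A 4 e = s.arr 4 e ∧ A 5 e = s.arr 5 e)
    hs hB hW (by decide) (by decide) (by decide) ⟨by simp, fun _ _ => ⟨rfl, rfl⟩⟩ ?_ ?_
  · rintro j s' hj h8 ha hs' ⟨hP1, hP2⟩
    rw [hH.reg2] at hj
    have hH' := hH.of_agree ha (by decide)
    have h5 := hs'.arr 5 (by decide) j
    have hob := hobj j hj
    simp only [wp_seq, wp_store, Fits, eval, cost, h8, State.reg_setArr, State.arr_setArr,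
      Nat.reduceEqDiff, if_false, hH'.arr1]
    refine ⟨by omega, by omega, by omega, ?_, ?_, ?_⟩
    · refine Small.setArr (Small.setArr hs' _ _ ?_) _ _ ?_ <;> omega
    · intro e he
      simp only [if_true, Function.update_apply]
      split_ifs with h1
      · rw [h1, (hP2 j le_rfl).2]
        exact ⟨rfl, rfl⟩
      · exact hP1 e (by omega)
    · intro e he
      simp only [if_true, Function.update_apply]
      rw [if_neg (by omega), if_neg (by omega)]
      exact hP2 e (by omega)
  rintro t1 s1 ha1 hs1 ⟨hP1, hP2⟩ ht1
  rw [hH.reg2] at hP1 hP2 ht1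
  have hH1 := hH.of_agree ha1 (by decide)
  have c9 : s1.arr 9 = s.arr 9 := ha1.arr 9 (by decide)
  have c10 : s1.arr 10 = s.arr 10 := ha1.arr 10 (by decide)
  rw [wp_seq, wp_assign]
  simp only [Fits, eval, cost, hH1.reg0, hH1.reg1]
  refine ⟨by omega, ?_⟩
  refine Wp.forArr_const 12 (fun j A =>
    (∀ i < j, A 9 i = s.arr 10 i ∧ A 10 i = s.arr 9 i) ∧
      ∀ i, j ≤ i → A 9 i = s.arr 9 i ∧ A 10 i = s.arr 10 i)
    (hs1.setReg 25 (by omega)) hB hW (by decide) (by decide) (by decide)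
    ⟨by simp, fun i _ => by simp [c9, c10]⟩ ?_ ?_
  · rintro j s' hj h8 ha hs' ⟨hP3, hP4⟩
    simp only [State.reg_setReg, if_true] at hj
    have h9 := hs'.arr 9 (by decide) j
    have h10 := hs'.arr 10 (by decide) j
    simp only [wp_seq, wp_store, wp_assign, Fits, eval, cost, h8, State.reg_setArr,
      State.arr_setArr, State.reg_setReg, State.arr_setReg,
      Nat.reduceEqDiff, if_true, if_false]
    refine ⟨by omega, by omega, by omega, by omega, ?_, ?_, ?_⟩
    · exact Small.setArr (Small.setArr (Small.setReg hs' _ h9) _ _ h10) _ _ h9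
    · intro i hi
      simp only [Function.update_apply]
      split_ifs with h1
      · rw [h1]
        exact ⟨(hP4 j le_rfl).2, (hP4 j le_rfl).1⟩
      · exact hP3 i (by omega)
    · intro i hi
      simp only [Function.update_apply]
      rw [if_neg (by omega), if_neg (by omega)]
      exact hP4 i (by omega)
  · rintro t2 s2 ha2 hs2 ⟨hP3, -⟩ ht2
    simp only [State.reg_setReg, if_true] at hP3 ht2
    have d4 : s2.arr 4 = s1.arr 4 := ha2.arr 4 (by decide)
    have d5 : s2.arr 5 = s1.arr 5 := ha2.arr 5 (by decide)
    refine ⟨hs2, by omega, ?_, ?_, hP3⟩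
    · rw [d4, d5]
      exact hP1
    · rw [d4, d5]
      exact hP2

/-- With truncated subtraction, `1` minus the degree vanishes exactly if the agent has an edge. -/
theorem skipIsolated_spec (hT : Table G m off obj tab own) (hs : Small B s) (hB : 8 < B)
    (hW : B ≤ W) (hH : Holds p q m off obj tab s) (hn : p + q + m + 2 < B) :
    Wp W skipIsolated s (fun t s' => Small B s' ∧ t ≤ 40 * (p + 1) ∧
      s'.reg 4 = p ∧ s'.reg 5 = q + p ∧ s'.reg 6 = m + p ∧
      ∀ a < p, s'.arr 17 a = 0 ↔ off a < off (a + 1)) := by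
  unfold skipIsolated
  rw [wp_seq]
  refine Wp.forArr_const 12 (fun j A => ∀ a < j, A 17 a = 0 ↔ off a < off (a + 1))
    hs hB hW (by decide) (by decide) (by decide) (by simp) ?_ ?_
  · rintro j s' hj h8 ha hs' hP
    rw [hH.reg0] at hj
    have hH' := hH.of_agree ha (by decide)
    have h1 := hT.off_le j hj.le
    have h2 := hT.off_le (j + 1) hj
    simp only [wp_store, Fits, eval, cost, h8, hH'.arr0]
    refine ⟨by omega, by omega, Small.setArr hs' _ _ (by omega), ?_⟩
    intro a haj
    simp only [State.arr_setArr, if_true, Function.update_apply]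
    split_ifs with h3
    · rw [h3]
      omega
    · exact hP a (by omega)
  · rintro t1 s1 ha1 hs1 hP1 ht1
    rw [hH.reg0] at hP1 ht1
    have hH1 := hH.of_agree ha1 (by decide)
    simp only [wp_seq, wp_assign, Fits, eval, cost, State.reg_setReg, State.arr_setReg,
      Nat.reduceEqDiff, if_true, if_false, hH1.reg0, hH1.reg1, hH1.reg2]
    refine ⟨by omega, by omega, by omega, ?_, by omega, trivial, trivial, trivial, hP1⟩
    refine Small.setReg (Small.setReg (Small.setReg hs1 _ ?_) _ ?_) _ ?_ <;> omega

end RAM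

namespace RAM

open RAM.Expr RAM.Prog

/-! ### The second part of the algorithm -/

/-- The agents are the left vertices, and the objects and the last resorts `q + a` are the right
vertices. -/
structure SecondGraph {p q : ℕ} (G : PrefInstance (Fin p) (Fin q)) (S : Set (Fin q))
    (R : ℕ → ℕ → Prop) : Prop where
  obj : ∀ (a : Fin p) (b : Fin q), R a b ↔ G.TopEdge S a b ∨ G.LowEdge S a b
  last : ∀ (a : Fin p) (r : ℕ), q ≤ r → (R a r ↔ r = q + a ∧ ∀ b, (a, b) ∈ G.E → b ∈ S)

variable {W B : ℕ} {s : State} {p q m : ℕ} {G : PrefInstance (Fin p) (Fin q)}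
  {off obj tab own : ℕ → ℕ} {K : ℕ} {S : Set (Fin q)} {R : ℕ → ℕ → Prop} {ml mr : ℕ → ℕ}

/-- An agent without an object is either isolated or on its last resort, and the latter is available
only if all its neighbours lie in `S`. -/
theorem SecondGraph.certifies (h : SecondGraph G S R) (hM : Mates p (q + p) R ml mr)
    (hS : ∀ b : Fin q, b ∈ S → mr b ≠ 0)
    (hA : ∀ a : Fin p, (∃ b, (a, b) ∈ G.E) → ml a ≠ 0) : G.Certifies S (pairs p q ml) := by
  have hR : ∀ (a : Fin p) (b : Fin q), ml a = b + 1 → G.TopEdge S a b ∨ G.LowEdge S a b :=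
    fun a b hab => (h.obj a b).1 (hM.left a a.2 b hab).2.1
  refine ⟨isMatching_pairs (fun a b hab => ?_) (fun a a' b hab hab' => ?_),
    fun a b hab => hR a b (mem_pairs.1 hab), fun b hb => ?_, fun a ha b hab => ?_⟩
  · exact (hR a b hab).elim (fun h => h.1) fun h => h.1
  · have h1 := (hM.left a a.2 b hab).2.2
    have h2 := (hM.left a' a'.2 b hab').2.2
    exact Fin.ext (by omega)
  · obtain ⟨l, hl⟩ := Nat.exists_eq_succ_of_ne_zero (hS b hb)
    obtain ⟨h1, h2⟩ := hM.right b (by omega) l hl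
    exact ⟨⟨l, h1⟩, mem_pairs.2 h2⟩
  · obtain ⟨r, hr⟩ := Nat.exists_eq_succ_of_ne_zero (hA a ⟨b, hab⟩)
    have hqr : q ≤ r := by
      by_contra hlt
      exact ha ⟨r, by omega⟩ (mem_pairs.2 hr)
    exact ((h.last a r hqr).1 (hM.left a a.2 r hr).2.1).2 b hab

/-- A certificate, completed by last resorts, would inject the agents into the right vertices along
edges. For visited agents these right vertices have mates that were visited too but differ from the
unmatched `v`, so the visited agents would inject into one fewer. -/
theorem SecondGraph.not_certifies (h : SecondGraph G S R) (hM : Mates p (q + p) R ml mr)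
    {v qt : ℕ} {que : ℕ → ℕ} (hS : Stuck p (q + p) R mr v que qt) (hv : ml v = 0)
    (M : Finset (Fin p × Fin q)) : ¬ G.Certifies S M := by
  intro hC
  have hex : ∀ a : Fin p, ∃ r < q + p, R a r ∧
      ((∃ b : Fin q, (a, b) ∈ M ∧ r = b) ∨ r = q + a) := by
    intro a
    by_cases ha : ∃ b, (a, b) ∈ M
    · obtain ⟨b, hb⟩ := ha
      exact ⟨b, by omega, (h.obj a b).2 (hC.edge a b hb), Or.inl ⟨b, hb, rfl⟩⟩
    · exact ⟨q + a, by omega, (h.last a _ (by omega)).2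
        ⟨rfl, hC.free a fun b hb => ha ⟨b, hb⟩⟩, Or.inr rfl⟩
  choose f hf1 hf2 hf3 using hex
  have hinj : ∀ a a', f a = f a' → a = a' := by
    intro a a' he
    rcases hf3 a with ⟨b, hb, h1⟩ | h1 <;> rcases hf3 a' with ⟨b', hb', h2⟩ | h2
    · have : b = b' := Fin.ext (by omega)
      exact hC.matching.left_unique hb (this ▸ hb')
    · omega
    · omega
    · exact Fin.ext (by omega)
  let Q : Finset (Fin p) := Finset.univ.filter fun a => ∃ i < qt, que i = a
  have hvp : v < p := hS.start ▸ hS.lt 0 hS.pos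
  have hvQ : (⟨v, hvp⟩ : Fin p) ∈ Q :=
    Finset.mem_filter.2 ⟨Finset.mem_univ _, 0, hS.pos, hS.start⟩
  have hg : ∀ a ∈ Q, ∃ a' ∈ Q.erase ⟨v, hvp⟩, mr (f a) = a' + 1 := by
    intro a ha
    obtain ⟨-, i, hi, hia⟩ := Finset.mem_filter.1 ha
    obtain ⟨j, hj, hmj⟩ := hS.closed i hi (f a) (hf1 a) (hia ▸ hf2 a)
    refine ⟨⟨que j, hS.lt j hj⟩, Finset.mem_erase.2 ⟨fun he => ?_,
      Finset.mem_filter.2 ⟨Finset.mem_univ _, j, hj, rfl⟩⟩, hmj⟩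
    have h1 := (hM.right _ (hf1 a) _ hmj).2
    have h2 : que j = v := congrArg Fin.val he
    rw [h2] at h1
    omega
  choose! g hg1 hg2 using hg
  have hcard := Finset.card_le_card_of_injOn g hg1 (fun a ha a' ha' he => by
    have h1 := (hM.right _ (hf1 a) _ (hg2 a ha)).2
    have h2 := (hM.right _ (hf1 a') _ (hg2 a' ha')).2
    rw [he] at h1
    exact hinj a a' (by omega))
  have := Finset.card_erase_lt_of_mem hvQ
  omega

/-- Prepare the second part. -/
def secondGraph : Prog := lastResorts ;; lowFlags ;; swapSides ;; skipIsolated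

theorem secondGraph_spec (hT : Table G m off obj tab own) (hs : Small B s) (hB : 8 < B)
    (hW : B * B + B ≤ W) (hR : Ready p q m off obj tab own K s) (hn : p + q + m + 2 < B)
    (hM : Mates q p (Adj m (s.arr 4) (s.arr 5) (s.arr 6)) (s.arr 9) (s.arr 10))
    (hcov : ∀ b < q, s.arr 17 b = 0 → s.arr 9 b ≠ 0) :
    Wp W secondGraph s (fun t s' => Small B s' ∧ t ≤ 200 * (p + q + m * (q + 1) + 1) ∧
      Holds p q m off obj tab s' ∧ (s'.reg 4 = p ∧ s'.reg 5 = q + p ∧ s'.reg 6 = m + p) ∧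
      EndsLt p (q + p) (m + p) (s'.arr 4) (s'.arr 5) (s'.arr 6) ∧
      SecondGraph G (lowSet q (s.arr 17)) (Adj (m + p) (s'.arr 4) (s'.arr 5) (s'.arr 6)) ∧
      (∀ a < p, s'.arr 17 a = 0 ↔ off a < off (a + 1)) ∧
      Mates p (q + p) (Adj (m + p) (s'.arr 4) (s'.arr 5) (s'.arr 6)) (s'.arr 9) (s'.arr 10) ∧
      ∀ b < q, s.arr 17 b = 0 → s'.arr 10 b ≠ 0) := by
  have hW' : B ≤ W := by
    have := Nat.zero_le (B * B)
    omega
  unfold secondGraph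
  rw [wp_seq]
  refine (lastResorts_spec hs hB hW' hR.holds hn).mono ?_
  rintro t1 s1 ha1 ⟨hs1, ht1, hl1, he1⟩
  have hH1 := hR.holds.of_agree ha1 (by decide)
  rw [wp_seq]
  refine (lowFlags_spec hT hs1 hB hW hH1 hn (fun e he => by rw [(he1 e he).1, hR.src e he])
    (fun e he => by rw [(he1 e he).2.1, hR.tgt e he]) fun a ha => (hl1 a ha).2.2).mono ?_
  rintro t2 s2 ha2 ⟨hs2, ht2, he2, hl2⟩
  have hH2 := hH1.of_agree ha2 (by decide)
  rw [wp_seq]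
  refine (swapSides_spec hT.obj_lt hs2 hB hW' hH2 hn).mono ?_
  rintro t3 s3 ha3 ⟨hs3, ht3, he3, hl3, hm3⟩
  have hH3 := hH2.of_agree ha3 (by decide)
  refine (skipIsolated_spec hT hs3 hB hW' hH3 hn).mono ?_
  rintro t4 s4 ha4 ⟨hs4, ht4, h4, h5, h6, h17⟩
  have c4 : s4.arr 4 = s3.arr 4 := ha4.arr 4 (by decide)
  have c5 : s4.arr 5 = s3.arr 5 := ha4.arr 5 (by decide)
  have c6 : s4.arr 6 = s2.arr 6 := by rw [ha4.arr 6 (by decide), ha3.arr 6 (by decide)]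
  have c9 : s4.arr 9 = s3.arr 9 := ha4.arr 9 (by decide)
  have c10 : s4.arr 10 = s3.arr 10 := ha4.arr 10 (by decide)
  have d4 : s2.arr 4 = s1.arr 4 := ha2.arr 4 (by decide)
  have d5 : s2.arr 5 = s1.arr 5 := ha2.arr 5 (by decide)
  have d9 : s2.arr 9 = s.arr 9 := by rw [ha2.arr 9 (by decide), ha1.arr 9 (by decide)]
  have d10 : s2.arr 10 = s.arr 10 := by rw [ha2.arr 10 (by decide), ha1.arr 10 (by decide)]
  have d17 : s1.arr 17 = s.arr 17 := ha1.arr 17 (by decide)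
  have hsrc : ∀ e < m, s4.arr 4 e = own e := fun e he => by
    rw [c4, (he3 e he).1, d5, (he1 e he).2.1, hR.tgt e he]
  have htgt : ∀ e < m, s4.arr 5 e = obj e := fun e he => by rw [c5, (he3 e he).2]
  have hsrc' : ∀ a < p, s4.arr 4 (m + a) = a := fun a ha => by
    rw [c4, (hl3 _ (by omega)).1, d4, (hl1 a ha).1]
  have htgt' : ∀ a < p, s4.arr 5 (m + a) = q + a := fun a ha => by
    rw [c5, (hl3 _ (by omega)).2, d5, (hl1 a ha).2.1]
  have hflag : ∀ e < m, ∀ (a : Fin p) (b : Fin q), own e = a → obj e = b → (s4.arr 6 e ≠ 0 ↔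
      G.TopEdge (lowSet q (s.arr 17)) a b ∨ G.LowEdge (lowSet q (s.arr 17)) a b) := by
    intro e he a b hoa hob
    have htop := FlagInv.top_iff hT hR.flag he hoa hob
    rw [c6, he2 e he, SecondFlag, d17, (he1 e he).2.2, htop, hob]
    constructor
    · rintro (⟨-, h⟩ | ⟨h, h'⟩)
      · exact Or.inl h
      · refine Or.inr ⟨(hT.edge_iff a b).2 ⟨e, he, hoa, hob⟩, h, fun b' hb' hp => ?_⟩
        obtain ⟨e', he', hoa', hob'⟩ := (hT.edge_iff a b').1 (G.pref_nbr _ _ _ hp).1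
        exact (hT.tab_iff e' he' a b' b hoa' hob').2 hp
          (h' e' he' (hoa'.trans hoa.symm) (by rw [hob']; exact hb'))
    · rintro (h | h)
      · exact Or.inl ⟨h.mem, h⟩
      · refine Or.inr ⟨h.2.1, fun e' he' ho hl => ?_⟩
        by_contra h3
        exact h.2.2 ⟨obj e', hT.obj_lt e' he'⟩ hl
          ((hT.tab_iff e' he' a ⟨obj e', hT.obj_lt e' he'⟩ b (ho.trans hoa) rfl).1 h3)
  have hflag' : ∀ a : Fin p, s4.arr 6 (m + a) ≠ 0 ↔
      ∀ b, (a, b) ∈ G.E → b ∈ lowSet q (s.arr 17) := by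
    intro a
    rw [c6, hl2 a a.2, d17]
    constructor
    · intro h b hab
      obtain ⟨e, he, hoa, hob⟩ := (hT.edge_iff a b).1 hab
      have := h e he hoa
      rwa [hob] at this
    · intro h e he hoa
      exact h ⟨obj e, hT.obj_lt e he⟩ ((hT.edge_iff _ _).2 ⟨e, he, hoa, rfl⟩)
  have hG : SecondGraph G (lowSet q (s.arr 17))
      (Adj (m + p) (s4.arr 4) (s4.arr 5) (s4.arr 6)) := by
    constructor
    · intro a b
      constructor
      · rintro ⟨e, he, ⟨hf, hse⟩, hte⟩
        rcases Nat.lt_or_ge e m with hem | hem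
        · rw [hsrc e hem] at hse
          rw [htgt e hem] at hte
          exact (hflag e hem a b hse hte).1 hf
        · have h1 := htgt' (e - m) (by omega)
          rw [Nat.add_sub_cancel' hem] at h1
          omega
      · intro h
        obtain ⟨e, he, hoa, hob⟩ := (hT.edge_iff a b).1 (h.elim (fun h => h.1) fun h => h.1)
        exact ⟨e, by omega, ⟨(hflag e he a b hoa hob).2 h, (hsrc e he).trans hoa⟩,
          (htgt e he).trans hob⟩
    · intro a r hr
      constructor
      · rintro ⟨e, he, ⟨hf, hse⟩, hte⟩
        rcases Nat.lt_or_ge e m with hem | hem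
        · have := hT.obj_lt e hem
          rw [htgt e hem] at hte
          omega
        · obtain ⟨x, rfl⟩ := Nat.exists_eq_add_of_le hem
          rw [hsrc' x (by omega)] at hse
          rw [htgt' x (by omega)] at hte
          subst hse
          exact ⟨hte.symm, (hflag' a).1 hf⟩
      · rintro ⟨rfl, h⟩
        exact ⟨m + a, by omega, ⟨(hflag' a).2 h, hsrc' a a.2⟩, htgt' a a.2⟩
  have hml : ∀ i < p + q, s4.arr 9 i = s.arr 10 i := fun i hi => by rw [c9, (hm3 i hi).1, d10]
  have hmr : ∀ i < p + q, s4.arr 10 i = s.arr 9 i := fun i hi => by rw [c10, (hm3 i hi).2, d9]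
  refine ⟨hs4, ?_, hH3.of_agree ha4 (by decide), ⟨h4, h5, h6⟩, ?_, hG, h17, ⟨?_, ?_⟩, ?_⟩
  · rw [Nat.mul_succ m q] at ht2 ⊢
    omega
  · intro e he _
    rcases Nat.lt_or_ge e m with hem | hem
    · have h1 := hT.obj_lt e hem
      have h2 := hT.own_lt e hem
      rw [hsrc e hem, htgt e hem]
      omega
    · obtain ⟨x, rfl⟩ := Nat.exists_eq_add_of_le hem
      rw [hsrc' x (by omega), htgt' x (by omega)]
      omega
  · intro l hl r hlr
    rw [hml l (by omega)] at hlr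
    obtain ⟨h1, h2⟩ := hM.right l hl r hlr
    rw [hmr r (by omega)]
    refine ⟨by omega, ?_, h2⟩
    exact (hG.obj ⟨l, hl⟩ ⟨r, h1⟩).2 (Or.inl ((hR.adj_iff hT).1 (hM.left r h1 l h2).2.1))
  · intro r hr l hlr
    rw [hmr r (by omega)] at hlr
    -- The former left mates are zero beyond `q` by `Ready.ml`, so no last resort is matched at the
    -- start.
    have hrq : r < q := by
      by_contra hge
      rw [hR.ml r (by omega)] at hlr
      omega
    obtain ⟨h1, -, h2⟩ := hM.left r hrq l hlr
    rw [hml l (by omega)]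
    exact ⟨h1, h2⟩
  · intro b hb h0
    rw [hmr b (by omega)]
    exact hcov b hb h0

/-- Write the answer. -/
def output : Prog :=
  cond (reg 23) (assign 3 (const 0))
    (forTo 8 (const 0) 0 (cond (sub (read 9 (reg 8)) (reg 1)) skip
      (store 3 (reg 8) (read 9 (reg 8)))) ;;
    assign 3 (const 1))

theorem output_spec (hs : Small B s) (hB : 8 < B) (hW : B ≤ W) (hH : Holds p q m off obj tab s)
    (h3 : ∀ i, s.arr 3 i = 0) :
    Wp W output s (fun t s' => t ≤ 40 * (p + 1) ∧ (s.reg 23 ≠ 0 → s'.reg 3 = 0) ∧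
      (s.reg 23 = 0 → s'.reg 3 = 1 ∧ s'.Lists (pairs p q (s.arr 9)))) := by
  unfold output
  have h23 := hs.reg 23
  simp only [wp_cond, wp_assign, Fits, eval, cost]
  refine ⟨by omega, fun h => ⟨by omega, by omega, by simp, fun h' => absurd h' h⟩, fun h => ?_⟩
  rw [wp_seq]
  -- Since mates are stored with an offset of one, entries up to `q` are objects and larger entries
  -- are last resorts, which count as unmatched.
  refine Wp.forArr_const 13 (fun j A => ∀ i, A 3 i = if i < j ∧ s.arr 9 i ≤ q then s.arr 9 i else 0)
    hs hB hW (by decide) (by decide) (by decide) (fun i => by simp [h3]) ?_ ?_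
  · intro j s' hj h8 ha hs' hP
    have hH' := hH.of_agree ha (by decide)
    have c9 : s'.arr 9 = s.arr 9 := ha.arr 9 (by decide)
    have h9 := hs.arr 9 (by decide) j
    have hq := hs.reg 1
    rw [hH.reg1] at hq
    have hjp := hs.reg 0
    simp only [wp_cond, wp_store, wp_skip, Fits, eval, cost, h8, c9, hH'.reg1]
    refine ⟨by omega, fun h1 => ⟨by omega, hs', fun i => ?_⟩,
      fun h1 => ⟨by omega, by omega, hs'.setArr _ _ h9, fun i => ?_⟩⟩
    · rw [hP i]
      refine if_congr (and_congr_left fun h2 => ⟨fun h => by omega, fun h4 => ?_⟩) rfl rfl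
      rcases Nat.lt_succ_iff_lt_or_eq.1 h4 with h5 | rfl
      exacts [h5, absurd h2 (by omega)]
    · simp only [State.arr_setArr, if_true, Function.update_apply]
      split_ifs with h2 h4 h4
      · rw [h2]
      · exact absurd ⟨by omega, by rw [h2]; omega⟩ h4
      · rw [hP i, if_pos ⟨by omega, h4.2⟩]
      · rw [hP i, if_neg fun h5 => h4 ⟨by omega, h5.2⟩]
  · intro t1 s1 ha1 hs1 hP ht1
    rw [hH.reg0] at hP ht1
    rw [wp_assign]
    refine ⟨by simp only [Fits]; omega, by simp only [cost]; omega, fun h' => absurd h h',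
      fun _ => ⟨by simp [eval], fun a => ?_⟩⟩
    rw [State.arr_setReg, hP a]
    simp only [mem_pairs, a.2, true_and]
    refine ⟨fun b => ?_, ?_⟩
    · split_ifs with h1
      · rfl
      · exact iff_of_false (by omega) id
    · constructor
      · intro hno
        by_contra h0
        have h1 : s.arr 9 a ≤ q := by
          by_contra h1
          exact h0 (if_neg h1)
        rw [if_pos h1] at h0
        exact hno ⟨s.arr 9 a - 1, by omega⟩ (by simp only; omega)
      · intro h0 b hb
        rw [hb] at h0
        rw [if_pos (by omega)] at h0
        omega

/-- The second part of the algorithm. -/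
def finish : Prog := secondGraph ;; buildLists ;; cover ;; output

theorem finish_spec (hT : Table G m off obj tab own) (hs : Small B s) (hB : 8 < B)
    (hW : B * B + B ≤ W) (hR : Ready p q m off obj tab own K s) (hn : p + q + m + 2 < B)
    (hC : CertBound G (s.arr 17))
    (hM : Mates q p (Adj m (s.arr 4) (s.arr 5) (s.arr 6)) (s.arr 9) (s.arr 10))
    (hcov : ∀ b < q, s.arr 17 b = 0 → s.arr 9 b ≠ 0) (h3 : ∀ i, s.arr 3 i = 0) :
    Wp W finish s (fun t s' => G.SolvedBy s' ∧
      t ≤ (min m p + 4) * (500 * (p + q + m + 1)) + 200 * (m * (q + 1))) := by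
  have hW2 : 2 * B ≤ W := by
    have := Nat.mul_le_mul_right B hB.le
    omega
  unfold finish
  rw [wp_seq]
  refine (secondGraph_spec hT hs hB hW hR hn hM hcov).mono ?_
  rintro t1 s1 ha1 ⟨hs1, ht1, hH1, ⟨h4, h5, h6⟩, hlt, hG, h17, hM1, hcov1⟩
  rw [wp_seq]
  refine (buildLists_spec hs1 hB (by omega) (by rw [h4, h5, h6]; exact hlt)).mono ?_
  rintro t2 s2 ha2 ⟨hs2, hl2, ht2⟩
  have hH2 := hH1.of_agree ha2 (by decide)
  rw [h4, h6] at hl2 ht2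
  rw [← ha2.arr 4 (by decide), ← ha2.arr 5 (by decide), ← ha2.arr 6 (by decide)] at hlt hG
  rw [← ha2.arr 4 (by decide), ← ha2.arr 5 (by decide), ← ha2.arr 6 (by decide),
    ← ha2.arr 9 (by decide), ← ha2.arr 10 (by decide)] at hM1
  rw [← ha2.arr 4 (by decide), ← ha2.arr 6 (by decide)] at hl2
  rw [← ha2.arr 10 (by decide)] at hcov1
  rw [← ha2.arr 17 (by decide)] at h17
  rw [← ha2.reg 4 (by decide)] at h4
  rw [← ha2.reg 5 (by decide)] at h5
  rw [← ha2.reg 6 (by decide)] at h6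
  -- Agents still to be covered are not isolated, and each owns an edge of its own; this gives the
  -- bound `m` besides `p`.
  have hD : (uncovered p (s2.arr 17) (s2.arr 9)).card ≤ min m p := by
    refine le_min ?_ ((Finset.card_filter_le _ _).trans (Finset.card_range p).le)
    refine (Finset.card_le_card (t := (Finset.range m).image own) fun a ha => ?_).trans
      (Finset.card_image_le.trans (Finset.card_range m).le)
    simp only [uncovered, Finset.mem_filter, Finset.mem_range, Finset.mem_image] at ha ⊢
    have h1 := (h17 a ha.1).1 ha.2.1
    obtain ⟨h2, h3⟩ := (hT.row a ha.1 (off a)).1 ⟨le_rfl, h1⟩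
    exact ⟨_, h2, h3⟩
  rw [wp_seq]
  have hspec := cover_spec hs2 hB hW2 (by rw [h4, h5, h6]; exact hlt) (by rw [h4, h6]; exact hl2)
    (by rw [h4, h5, h6]; exact hM1) (min m p) fun ml mr _ => by
      rw [h4]
      exact hD.trans (Nat.le_add_left _ _)
  rw [h4, h5, h6] at hspec
  refine hspec.mono ?_
  rintro t3 s3 ha3 ⟨hs3, ht3, -, hM3, hE3, hall, hstuck⟩
  have hH3 := hH2.of_agree ha3 (by decide)
  refine (output_spec hs3 hB (by omega) hH3 fun i => ?_).mono ?_
  · rw [ha3.arr 3 (by decide), ha2.arr 3 (by decide), ha1.arr 3 (by decide), h3]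
  rintro t4 s4 - ⟨ht4, hno, hyes⟩
  constructor
  · by_cases h23 : s3.reg 23 = 0
    · obtain ⟨h1, h2⟩ := hyes h23
      refine Or.inl ⟨h1, _, (hG.certifies hM3 (fun b hb => ?_) fun a ⟨b, hab⟩ => ?_).isPopular, h2⟩
      · exact hE3.2 b (by omega) (hcov1 b b.2 hb)
      · obtain ⟨e, he, hoa, -⟩ := (hT.edge_iff a b).1 hab
        have := (hT.row a a.2 e).2 ⟨he, hoa⟩
        exact hall h23 a a.2 ((h17 a a.2).2 (by omega))
    -- A popular matching has a certificate, its set lies below the final `S`, and the exchange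
    -- makes it a certificate for `S`, which the stuck search excludes.
    · refine Or.inr ⟨hno h23, ?_⟩
      rintro ⟨M, hpop⟩
      obtain ⟨S', hS'⟩ := hpop.exists_certifies
      obtain ⟨hN, hNS, hmem⟩ := hR.isMatching hT hM
      obtain ⟨M', hM'⟩ := hS'.exists_of_cover (hC S' M hS') hN hNS fun b hb => by
        obtain ⟨l, hl⟩ := Nat.exists_eq_succ_of_ne_zero (hcov b b.2 hb)
        exact ⟨⟨l, (hM.left b b.2 l hl).1⟩, (hmem _ _).2 hl⟩
      obtain ⟨v, hv, -, hv0, hS⟩ := hstuck h23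
      exact hG.not_certifies hM3 hS hv0 M' hM'
  · have e1 : (min m p + 2) * (160 * (p + (q + p) + (m + p) + 1)) ≤
        (min m p + 2) * (500 * (p + q + m + 1)) := Nat.mul_le_mul_left _ (by omega)
    have e2 : (min m p + 4) * (500 * (p + q + m + 1)) = (min m p + 2) * (500 * (p + q + m + 1)) +
      1000 * (p + q + m + 1) := by ring
    rw [e2]
    omega

end RAM

/-! ### The whole algorithm and its running time -/

namespace RAM

open RAM.Expr RAM.Prog

/-- Decide whether there is a popular matching, and find one if so. -/
def popularMatching : Prog := cond (reg 2) (init ;; raiseLoop ;; finish) (assign 3 (const 1))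

variable {W B : ℕ} {s : State} {p q : ℕ} {G : PrefInstance (Fin p) (Fin q)}

theorem popularMatching_of_empty (hE : G.Encodes s) (hW : 1 < W) (hm : G.E.card = 0) :
    Wp W popularMatching s (fun t s' => G.SolvedBy s' ∧ t ≤ 4) := by
  have hE0 : G.E = ∅ := Finset.card_eq_zero.1 hm
  have hN : ∀ N, G.IsMatching N → N = ∅ := fun N hN =>
    Finset.subset_empty.1 (hE0 ▸ hN.subset)
  unfold popularMatching
  simp only [wp_cond, wp_assign, Fits, eval, cost, hE.edges, hm]
  refine ⟨by omega, fun h => absurd rfl h, fun _ => ⟨hW, Or.inl ⟨by simp, ∅, ⟨⟨by simp, by simp,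
    by simp⟩, fun N h => ?_⟩, fun a => ?_⟩, le_rfl⟩⟩
  · rw [hN N h, PrefInstance.Delta, sub_self]
  · simp [hE.arr_zero 3 le_rfl]

/-- The number of rounds `c` is at most both `m` and `n`, so `c * (n + m + 1)` is `O(m * n)`: the
bound `c ≤ m` serves the summand `n`, and `c ≤ n` serves the summand `m`. -/
theorem popularMatching_time {n m K c d t₁ t₂ t₃ q : ℕ} (hn : 0 < n) (hm : 0 < m) (hq : q ≤ n)
    (hcm : c ≤ m) (hcn : c ≤ n) (hdm : d ≤ m) (hdn : d ≤ n)
    (h₁ : t₁ ≤ 200 * (n + m * (q + 1) + 1))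
    (h₂ : t₂ ≤ (c + 1) * (1000 * ((n + m + 1) * (K + 2))) + 50 * (q + 1) * m + 10)
    (h₃ : t₃ ≤ (d + 4) * (500 * (n + m + 1)) + 200 * (m * (q + 1))) :
    2 + (t₁ + (t₂ + t₃)) ≤ 20000 * (m * n) * (K + 2) := by
  have hmn : 0 < m * n := Nat.mul_pos hm hn
  have hnm : n ≤ m * n := Nat.le_mul_of_pos_left n hm
  have hmq : m * (q + 1) ≤ 2 * (m * n) := by
    rw [Nat.mul_left_comm]
    exact Nat.mul_le_mul_left _ (by omega)
  have key : ∀ x, x ≤ m → x ≤ n → x * (n + m + 1) ≤ 3 * (m * n) := fun x h1 h2 => by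
    have e1 : x * n ≤ m * n := Nat.mul_le_mul_right _ h1
    have e2 : x * m ≤ n * m := Nat.mul_le_mul_right _ h2
    rw [Nat.mul_comm n m] at e2
    rw [Nat.mul_add, Nat.mul_add]
    omega
  have k1 := key 1 hm hn
  have k2 := Nat.mul_le_mul_right (1000 * (K + 2)) (Nat.add_le_add (key c hcm hcn) k1)
  have k3 := key d hdm hdn
  have e1 : (c * (n + m + 1) + 1 * (n + m + 1)) * (1000 * (K + 2)) =
    (c + 1) * (1000 * ((n + m + 1) * (K + 2))) := by ring
  have e2 : (d + 4) * (500 * (n + m + 1)) = 500 * (d * (n + m + 1)) + 2000 * (n + m + 1) := by ring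
  have e3 : 50 * (q + 1) * m = 50 * (m * (q + 1)) := by ring
  have e4 : (3 * (m * n) + 3 * (m * n)) * (1000 * (K + 2)) =
    6000 * (m * n * K) + 12000 * (m * n) := by ring
  have e5 : 20000 * (m * n) * (K + 2) = 20000 * (m * n * K) + 40000 * (m * n) := by ring
  rw [e1, e4] at k2
  rw [e2] at h₃
  rw [e3] at h₂
  rw [e5]
  omega

theorem popularMatching_spec (hE : G.Encodes s) (hB : 8 < B) (hW : B * B + B ≤ W)
    (hn : p + q + G.E.card + 2 < B) (hm : 0 < G.E.card) :
    Wp W popularMatching s (fun t s' => G.SolvedBy s' ∧ ∃ K, (K - 1) * (K - 1) ≤ p + q ∧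
      t ≤ 20000 * (G.E.card * (p + q)) * (K + 2)) := by
  obtain ⟨own, hT⟩ := exists_table hE
  set m := G.E.card with hmdef
  have hpq : 0 < p + q := by
    have := hT.own_lt 0 hm
    omega
  have hs : Small B s := by
    refine ⟨fun x => ?_, fun k hk i => ?_⟩
    · rcases Nat.lt_or_ge x 3 with hx | hx
      · have h0 := hE.agents
        have h1 := hE.objects
        have h2 := hE.edges
        interval_cases x <;> omega
      · rw [hE.reg_zero x hx]
        omega
    · rw [hE.arr_zero k hk i]
      omega
  have hH : Holds p q m (s.arr 0) (s.arr 1) (s.arr 2) s :=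
    ⟨hE.agents, hE.objects, hE.edges, rfl, rfl, rfl⟩
  unfold popularMatching
  rw [wp_cond]
  simp only [Fits, eval, cost, hE.edges]
  refine ⟨by omega, fun _ => ?_, fun h => absurd h hm.ne'⟩
  rw [wp_seq]
  refine (init_spec hT hs hB hW hH hn hpq fun i => hE.arr_zero 9 (by decide) i).mono ?_
  rintro t1 s1 ha1 ⟨hs1, ht1, K, hK0, hK1, hK2, hR1, hl1⟩
  -- At first only isolated objects are lowered, and a certificate has to cover all of its set.
  have hC : CertBound G (s1.arr 17) := by
    intro S' M hC b hb
    obtain ⟨a, hab⟩ := hC.cover b hb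
    obtain ⟨e, he, -, hob⟩ := (hT.edge_iff a b).1 (hC.matching.subset hab)
    exact (hl1 b b.2).2 ⟨e, he, hob⟩
  rw [wp_seq]
  refine (raiseLoop_spec hT hs1 hB hW hR1 hK0 (by omega) hn hC).mono ?_
  rintro t2 s2 ha2 ⟨hs2, hR2, hC2, hM2, hcov, ht2⟩
  refine (finish_spec hT hs2 hB hW hR2 hn hC2 hM2 hcov fun i => ?_).mono ?_
  · rw [ha2.arr 3 (by decide), ha1.arr 3 (by decide), hE.arr_zero 3 le_rfl i]
  rintro t3 s3 - ⟨hsol, ht3⟩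
  have hcq : upperObjects q (s1.arr 17) ≤ q :=
    (Finset.card_filter_le _ _).trans (Finset.card_range q).le
  have hcm : upperObjects q (s1.arr 17) ≤ m := by
    refine (Finset.card_le_card (t := (Finset.range m).image (s.arr 1)) fun b hb => ?_).trans
      (Finset.card_image_le.trans (Finset.card_range m).le)
    simp only [Finset.mem_filter, Finset.mem_range, Finset.mem_image] at hb ⊢
    obtain ⟨e, he, hob⟩ := (hl1 b hb.1).1 hb.2
    exact ⟨e, he, hob⟩
  have hue : upperEdges m (s.arr 1) (s1.arr 17) ≤ m :=
    (Finset.card_filter_le _ _).trans (Finset.card_range m).le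
  refine ⟨hsol, K, hK2, popularMatching_time hpq hm (Nat.le_add_left q p) hcm (by omega)
    (Nat.min_le_left m p) ((Nat.min_le_right m p).trans (Nat.le_add_right p q)) ht1
    (ht2.trans ?_) ht3⟩
  have := Nat.mul_le_mul_left (50 * (q + 1)) hue
  unfold phaseTime
  omega

end RAM

/-- One program, on a random access machine whose words have `O(log n)` bits (numbers less than
`(n + 2) ^ k`), decides for every instance with `n = p + q` vertices and `m` edges whether there is
a popular matching, and finds one if so, in `O(m * n ^ (3 / 2))` steps. (The summand `1` matters
only if there is no edge.) -/
theorem mainTheorem8 :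
    ∃ (P : RAM.Prog) (C : ℝ) (k : ℕ),
      ∀ (p q : ℕ) (G : PrefInstance (Fin p) (Fin q)) (s : RAM.State), G.Encodes s →
        ∃ (t : ℕ) (s' : RAM.State),
          RAM.Exec ((p + q + 2) ^ k) P s t s' ∧
          G.SolvedBy s' ∧
          (t : ℝ) ≤ C * (1 + (G.E.card : ℝ) * ((p + q : ℕ) : ℝ) ^ (3 / 2 : ℝ)) := by
  -- With `x = p + q + 2`, all stored numbers are below `x ^ 3`, as `m ≤ p * q`. Products of two of
  -- them, plus one more, are below `x ^ 7`.
  refine ⟨RAM.popularMatching, 80000, 7, fun p q G s hE => ?_⟩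
  rcases Nat.eq_zero_or_pos G.E.card with hm | hm
  · obtain ⟨t, s', hex, hsol, ht⟩ := RAM.popularMatching_of_empty hE
      (Nat.one_lt_pow (a := p + q + 2) (by decide : 7 ≠ 0) (by omega)) hm
    refine ⟨t, s', hex, hsol, ?_⟩
    have : (t : ℝ) ≤ 4 := by exact_mod_cast ht
    rw [hm, Nat.cast_zero, zero_mul]
    linarith
  · have hmpq : G.E.card ≤ p * q := by
      have := Finset.card_le_univ G.E
      rwa [Fintype.card_prod, Fintype.card_fin, Fintype.card_fin] at this
    have hpq : 0 < p * q := hm.trans_le hmpq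
    have hn1 : 1 ≤ p + q := by
      have := Nat.pos_of_mul_pos_right hpq
      omega
    obtain ⟨x, hx⟩ : ∃ x, x = p + q + 2 := ⟨_, rfl⟩
    have hx3 : 3 ≤ x := by omega
    have hmx : G.E.card ≤ (x - 2) * (x - 2) :=
      hmpq.trans (Nat.mul_le_mul (by omega) (by omega))
    have hB : 8 < x ^ 3 := by
      have := Nat.pow_le_pow_left hx3 3
      omega
    have hn : p + q + G.E.card + 2 < x ^ 3 := by
      obtain ⟨y, rfl⟩ := Nat.exists_eq_add_of_le' (show 2 ≤ x by omega)
      rw [Nat.add_sub_cancel] at hmx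
      have e : (y + 2) ^ 3 = y * (y * y) + 6 * (y * y) + 12 * y + 8 := by ring
      rw [e]
      have := Nat.zero_le (y * (y * y))
      omega
    have hW : x ^ 3 * x ^ 3 + x ^ 3 ≤ x ^ 7 := by
      have e1 : x ^ 7 = x ^ 6 * x := by ring
      have e2 : x ^ 3 * x ^ 3 = x ^ 6 := by ring
      have e3 := Nat.pow_le_pow_right (show 0 < x by omega) (show 3 ≤ 6 by decide)
      have e4 := Nat.mul_le_mul_left (x ^ 6) hx3
      rw [e1, e2]
      omega
    obtain ⟨t, s', hex, hsol, K, hK, ht⟩ := RAM.popularMatching_spec hE hB hW hn hm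
    refine ⟨t, s', hx ▸ hex, hsol, ?_⟩
    have hn1' : (1 : ℝ) ≤ ((p + q : ℕ) : ℝ) := by exact_mod_cast hn1
    set n : ℝ := ((p + q : ℕ) : ℝ) with hndef
    have hsqrt1 : 1 ≤ √n := Real.one_le_sqrt.2 hn1'
    have hKs : ((K - 1 : ℕ) : ℝ) ≤ √n := by
      refine Real.le_sqrt_of_sq_le ?_
      rw [pow_two, hndef]
      exact_mod_cast hK
    have hK' : (K : ℝ) ≤ ((K - 1 : ℕ) : ℝ) + 1 := by
      exact_mod_cast (by omega : K ≤ K - 1 + 1)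
    have ht' : (t : ℝ) ≤ 20000 * (G.E.card * n) * (K + 2) := by
      rw [hndef]
      exact_mod_cast ht
    have hpow : n ^ (3 / 2 : ℝ) = n * √n := by
      rw [Real.sqrt_eq_rpow, ← Real.rpow_one_add' (by linarith) (by norm_num)]
      norm_num
    have h0 : 0 ≤ 20000 * ((G.E.card : ℝ) * n) := by positivity
    -- As `1 ≤ √n`, the bound `K ≤ √n + 1` gives `K + 2 ≤ 4 * √n`, whence the constant `4 * 20000`.
    have h1 := mul_le_mul_of_nonneg_left (show (K : ℝ) + 2 ≤ 4 * √n by linarith) h0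
    rw [hpow]
    linarith
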